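/- Let $d\ge 1$, let $\Omega\subset\mathbb R^d$ be a bounded open set (for example a bounded polyhedral domain), and let $K>0$, $-1<\alpha<0$, $T>0$. Write $\langle\cdot,\cdot\rangle$ and $\|\cdot\|$ for the inner product and norm of $L_2(\Omega)$, $\|\cdot\|_1$ for the norm of $H^1(\Omega)$, $A(v,w)=K\langle\nabla v,\nabla w\rangle$ for $v,w\in H^1_0(\Omega)$, and $$\mathcal B_\alpha v(t)=\frac{\partial}{\partial t}\int_0^t\frac{(t-s)^{\alpha}}{\Gamma(\alpha+1)}\,v(s)\,ds .$$ Let $f\in L_1((0,T);L_2(\Omega))$, $u_0\in L_2(\Omega)$, and let $u\in W^{1,1}((0,T);H^1_0(\Omega))$ (continuous representative) be the solution of the fractional diffusion problem $u'-\mathcal B_\alpha\,\mathrm{div}(K\nabla u)=f$ with homogeneous Dirichlet boundary conditions and $u(0)=u_0$, that is, for almost every $t\in(0,T)$, $\langle u'(t),w\rangle+A(\mathcal B_\alpha u(t),w)=\langle f(t),w\rangle$ for all $w\in H^1_0(\Omega)$. Let $0=t_0<t_1<\dots<t_N=T$, $I_n=(t_{n-1},t_n)$, $k_n=t_n-t_{n-1}$,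 with nondecreasing time steps ($k_i\le k_j$ for $i\le j$), and let $p_1,\dots,p_N\ge 1$ be integers. Let $\mathbb P_q$ be the space of polynomials in $t$ of degree at most $q$ with coefficients in $H^1_0(\Omega)$, and let $\mathcal W$ be the space of functions $v:[0,T]\to H^1_0(\Omega)$ with $v|_{I_n}\in\mathbb P_{p_n}$ for $1\le n\le N$; write $v^n_\pm=v(t_n^\pm)$ and $v^0_-=v(0)$. Let $U\in\mathcal W$ be the discontinuous Galerkin solution with $U^0_-=u_0$: for $1\le n\le N$ and all $X\in\mathbb P_{p_n}$, $$\langle U^{n-1}_+-U^{n-1}_-,X^{n-1}_+\rangle+\int_{t_{n-1}}^{t_n}\big(\langle U',X\rangle+A(\mathcal B_\alpha U,X)\big)\,dt=\int_{t_{n-1}}^{t_n}\langle f,X\rangle\,dt .$$ Let $\Pi u\in\mathcal W$ be the projection given by $\Pi u(t_n^-)=u(t_n)$ and $\int_{t_{n-1}}^{t_n}\langle u-\Pi u,X\rangle\,dt=0$ for all $X\in\mathbb P_{p_n-1}$, $1\le n\le N$, and put $\eta=\Pi u-u$ and $\|\varphi\|_{L_\infty(L_2)}=\max_{1\le n\le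 N}\sup_{t\in I_n}\|\varphi(t)\|$. Then $$\max_{1\le n\le N}\max\big\{\|U^{n-1}_+-u(t_{n-1})\|^2,\ \|U^n_--u(t_n)\|^2\big\}+\min_{1\le n\le N}\Big(t_n^{-1}k_n^{\min\{1,p_n-1\}}\Big)\frac{\|u-U\|^2_{L_\infty(L_2)}}{\max_{1\le n\le N}p_n^2}\ \le\ C\max_{1\le n\le N}k_n^{\alpha}\Big(\int_{t_{n-1}}^{t_n}\|\eta'\|_1\,dt\Big)^2,$$ where the constant $C>0$ depends only on $\alpha$, $T$ and the fixed data $\Omega$, $K$ of the elliptic operator (and not on $f$, $u_0$, $u$, the mesh or the degrees). -/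

import Mathlib

open MeasureTheory Set Filter Topology

namespace SubdiffusionDG

noncomputable section

open scoped Distributions

/-! ### The spaces `L²(Ω)` and `H¹₀(Ω)` -/

/-- The real Hilbert space `L²(Ω)`, with norm `‖·‖` and inner product `⟨·,·⟩`. -/
abbrev L2 {d : ℕ} (Ω : TopologicalSpace.Opens (EuclideanSpace ℝ (Fin d))) : Type :=
  Lp ℝ 2 (volume.restrict (Ω : Set (EuclideanSpace ℝ (Fin d))))

/-- The real Hilbert space `L²(Ω; ℝᵈ)` of square integrable vector fields. -/
abbrev L2Vec {d : ℕ} (Ω : TopologicalSpace.Opens (EuclideanSpace ℝ (Fin d))) : Type :=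
  Lp (EuclideanSpace ℝ (Fin d)) 2 (volume.restrict (Ω : Set (EuclideanSpace ℝ (Fin d))))

/-- The pairs `(φ, ∇φ)` in `L²(Ω) × L²(Ω; ℝᵈ)`, for `φ` smooth with compact support in `Ω`.
The product carries the Hilbert norm `(‖v‖² + ‖g‖²)^(1/2)`. -/
def testGraph {d : ℕ} (Ω : TopologicalSpace.Opens (EuclideanSpace ℝ (Fin d))) :
    Submodule ℝ (WithLp 2 (L2 Ω × L2Vec Ω)) where
  carrier := {x | ∃ φ : 𝓓(Ω, ℝ),
    (x.fst =ᵐ[volume.restrict (Ω : Set (EuclideanSpace ℝ (Fin d)))] fun y => φ y) ∧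
    (x.snd =ᵐ[volume.restrict (Ω : Set (EuclideanSpace ℝ (Fin d)))] fun y => gradient φ y)}
  zero_mem' := by
    refine ⟨0, ?_, ?_⟩
    · filter_upwards [Lp.coeFn_zero ℝ 2
        (volume.restrict (Ω : Set (EuclideanSpace ℝ (Fin d))))] with y hy
      simpa using hy
    · filter_upwards [Lp.coeFn_zero (EuclideanSpace ℝ (Fin d)) 2
        (volume.restrict (Ω : Set (EuclideanSpace ℝ (Fin d))))] with y hy
      have : gradient (⇑(0 : 𝓓(Ω, ℝ))) y = 0 := by
        have h0 : (⇑(0 : 𝓓(Ω, ℝ))) = fun _ => (0 : ℝ) := by ext; simp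
        rw [h0, gradient_fun_const]
      rw [this]
      simpa using hy
  add_mem' := by
    rintro x x' ⟨φ, h1, h2⟩ ⟨ψ, h3, h4⟩
    refine ⟨φ + ψ, ?_, ?_⟩
    · filter_upwards [Lp.coeFn_add x.fst x'.fst, h1, h3] with y hy e1 e3
      simp only [WithLp.add_fst, hy, Pi.add_apply, e1, e3, FunLike.coe_add]
    · filter_upwards [Lp.coeFn_add x.snd x'.snd, h2, h4] with y hy e2 e4
      have hφ : DifferentiableAt ℝ φ y := (φ.contDiff.differentiable (by simp)) y
      have hψ : DifferentiableAt ℝ ψ y := (ψ.contDiff.differentiable (by simp)) y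
      have : gradient (⇑(φ + ψ)) y = gradient φ y + gradient ψ y := by
        rw [FunLike.coe_add]
        simp only [gradient]
        rw [fderiv_add hφ hψ, map_add]
      rw [this, WithLp.add_snd, hy, Pi.add_apply, e2, e4]
  smul_mem' := by
    rintro c x ⟨φ, h1, h2⟩
    refine ⟨c • φ, ?_, ?_⟩
    · filter_upwards [Lp.coeFn_smul c x.fst, h1] with y hy e1
      simp only [WithLp.smul_fst, hy, Pi.smul_apply, e1, FunLike.coe_smul]
    · filter_upwards [Lp.coeFn_smul c x.snd, h2] with y hy e2
      have hφ : DifferentiableAt ℝ φ y := (φ.contDiff.differentiable (by simp)) y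
      have : gradient (⇑(c • φ)) y = c • gradient φ y := by
        rw [FunLike.coe_smul]
        simp only [gradient]
        rw [fderiv_const_smul hφ, map_smul]
      rw [this, WithLp.smul_snd, hy, Pi.smul_apply, e2]

/-- `H¹₀(Ω)`: the closure of the smooth compactly supported functions in the `H¹` norm,
each function being stored together with its weak gradient. The norm of this space is the
norm `‖v‖₁ = (‖v‖² + ‖∇v‖²)^(1/2)` of `H¹(Ω)`. -/
abbrev H10 {d : ℕ} (Ω : TopologicalSpace.Opens (EuclideanSpace ℝ (Fin d))) :
    Submodule ℝ (WithLp 2 (L2 Ω × L2Vec Ω)) :=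
  (testGraph Ω).topologicalClosure

/-- The embedding of `H¹₀(Ω)` into `L²(Ω)`. -/
def toL2 {d : ℕ} {Ω : TopologicalSpace.Opens (EuclideanSpace ℝ (Fin d))} (v : H10 Ω) : L2 Ω :=
  (v : WithLp 2 (L2 Ω × L2Vec Ω)).fst

/-- The weak gradient of an element of `H¹₀(Ω)`. -/
def grad {d : ℕ} {Ω : TopologicalSpace.Opens (EuclideanSpace ℝ (Fin d))} (v : H10 Ω) : L2Vec Ω :=
  (v : WithLp 2 (L2 Ω × L2Vec Ω)).snd

/-- The bilinear form `A(v, w) = K ⟨∇v, ∇w⟩` of the operator `A = -div (K ∇ ·)` with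
homogeneous Dirichlet boundary conditions. -/
def aForm {d : ℕ} {Ω : TopologicalSpace.Opens (EuclideanSpace ℝ (Fin d))} (K : ℝ)
    (v w : H10 Ω) : ℝ :=
  K * inner ℝ (grad v) (grad w)

/-! ### Time-dependent functions -/

/-- The kernel `ω_β(t) = t^(β-1) / Γ(β)`. -/
def omegaKernel (β t : ℝ) : ℝ := t ^ (β - 1) / Real.Gamma β

/-- The Riemann–Liouville operator
`(B_α v)(t) = ∂/∂t ∫₀ᵗ ω_{α+1}(t-s) v(s) ds`, of order `-α` for `-1 < α < 0`. -/
def fracDeriv {E : Type*} [NormedAddCommGroup E] [NormedSpace ℝ E] (α : ℝ) (v : ℝ → E) (t : ℝ) :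
    E :=
  deriv (fun r => ∫ s in (0 : ℝ)..r, omegaKernel (α + 1) (r - s) • v s) t

/-- `v ∈ W^{1,1}((0,T); E)` (in its continuous representative on `[0,T]`): `v` is the
indefinite integral of a Bochner integrable function. -/
def IsW11 {E : Type*} [NormedAddCommGroup E] [NormedSpace ℝ E] (T : ℝ) (v : ℝ → E) : Prop :=
  ∃ g : ℝ → E, IntervalIntegrable g volume 0 T ∧
    ∀ t ∈ Icc (0 : ℝ) T, v t = v 0 + ∫ s in (0 : ℝ)..t, g s

/-- `u` solves `u' + B_α A u = f` on `Ω × (0,T)` with homogeneous Dirichlet boundary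
conditions and `u(0) = u₀`: the equation is tested with all `w ∈ H¹₀(Ω)` at almost every time. -/
structure IsSolution {d : ℕ} {Ω : TopologicalSpace.Opens (EuclideanSpace ℝ (Fin d))}
    (K α T : ℝ) (f : ℝ → L2 Ω) (u₀ : L2 Ω) (u : ℝ → H10 Ω) : Prop where
  initial : toL2 (u 0) = u₀
  equation : ∀ᵐ t ∂(volume.restrict (Ioo (0 : ℝ) T)), ∀ w : H10 Ω,
    inner ℝ (toL2 (deriv u t)) (toL2 w) + aForm K (fracDeriv α u t) w = inner ℝ (f t) (toL2 w)

/-! ### Time meshes and the discontinuous trial space -/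

/-- A partition `0 = t₀ < t₁ < ⋯ < t_N = T`; the values `t n` with `n > N` play no role. -/
structure TimeMesh (T : ℝ) where
  N : ℕ
  N_pos : 1 ≤ N
  t : ℕ → ℝ
  t_zero : t 0 = 0
  t_last : t N = T
  t_lt : ∀ n < N, t n < t (n + 1)

/-- The indices `n = 1, …, N` of the subintervals `I_n = (t_{n-1}, t_n)`. -/
def TimeMesh.idx {T : ℝ} (M : TimeMesh T) : Finset ℕ := Finset.Icc 1 M.N

theorem TimeMesh.idx_nonempty {T : ℝ} (M : TimeMesh T) : M.idx.Nonempty :=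
  ⟨1, Finset.mem_Icc.2 ⟨le_rfl, M.N_pos⟩⟩

/-- The subinterval `I_n = (t_{n-1}, t_n)`, for `1 ≤ n ≤ N`. -/
def TimeMesh.I {T : ℝ} (M : TimeMesh T) (n : ℕ) : Set ℝ := Ioo (M.t (n - 1)) (M.t n)

/-- The time step `k_n = t_n - t_{n-1}`, for `1 ≤ n ≤ N`. -/
def TimeMesh.k {T : ℝ} (M : TimeMesh T) (n : ℕ) : ℝ := M.t n - M.t (n - 1)

/-- The maximum of `a n` over `1 ≤ n ≤ N`. -/
def TimeMesh.max {T : ℝ} (M : TimeMesh T) (a : ℕ → ℝ) : ℝ := M.idx.sup' M.idx_nonempty a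

/-- The minimum of `a n` over `1 ≤ n ≤ N`. -/
def TimeMesh.min {T : ℝ} (M : TimeMesh T) (a : ℕ → ℝ) : ℝ := M.idx.inf' M.idx_nonempty a

/-- `X` is a polynomial in `t` of degree at most `p` with coefficients in `E`. -/
def IsPoly {E : Type*} [NormedAddCommGroup E] [NormedSpace ℝ E] (p : ℕ) (X : ℝ → E) : Prop :=
  ∃ c : ℕ → E, ∀ t, X t = ∑ i ∈ Finset.range (p + 1), t ^ i • c i

/-- The trial space `W(M, p)`: functions that agree with a polynomial of degree at most `p n`
on each open subinterval `I_n`. -/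
def InTrialSpace {E : Type*} [NormedAddCommGroup E] [NormedSpace ℝ E] {T : ℝ} (M : TimeMesh T)
    (p : ℕ → ℕ) (v : ℝ → E) : Prop :=
  ∀ n ∈ M.idx, ∃ X : ℝ → E, IsPoly (p n) X ∧ EqOn v X (M.I n)

/-- `v^n_- = v(t_n^-)` for `n ≥ 1`, and `v^0_- = v(0)`. -/
def TimeMesh.traceL {E : Type*} [NormedAddCommGroup E] {T : ℝ} (M : TimeMesh T) (v : ℝ → E)
    (n : ℕ) : E :=
  if n = 0 then v 0 else Function.leftLim v (M.t n)

/-- `v^n_+ = v(t_n^+)` for `n < N`. -/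
def TimeMesh.traceR {E : Type*} [NormedAddCommGroup E] {T : ℝ} (M : TimeMesh T) (v : ℝ → E)
    (n : ℕ) : E :=
  Function.rightLim v (M.t n)

/-- `U ∈ W(M, p)` satisfies the time-stepping DG scheme with `U^0_- = u₀`. -/
structure IsDGSolution {d : ℕ} {Ω : TopologicalSpace.Opens (EuclideanSpace ℝ (Fin d))} {T : ℝ}
    (M : TimeMesh T) (p : ℕ → ℕ) (K α : ℝ) (f : ℝ → L2 Ω) (u₀ : L2 Ω) (U : ℝ → H10 Ω) : Prop where
  mem : InTrialSpace M p U
  initial : toL2 (M.traceL U 0) = u₀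
  step : ∀ n ∈ M.idx, ∀ X : ℝ → H10 Ω, IsPoly (p n) X →
    inner ℝ (toL2 (M.traceR U (n - 1) - M.traceL U (n - 1))) (toL2 (X (M.t (n - 1))))
      + ∫ s in M.t (n - 1)..M.t n,
          (inner ℝ (toL2 (deriv U s)) (toL2 (X s)) + aForm K (fracDeriv α U s) (X s))
    = ∫ s in M.t (n - 1)..M.t n, inner ℝ (f s) (toL2 (X s))

/-- `P` is the `hp`-projection `Πu` of `u`, for degrees `p n ≥ 1`: `P ∈ W(M, p)`,
`P(t_n^-) = u(t_n)`, and `∫_{I_n} ⟨u - P, X⟩ dt = 0` for all polynomials `X` of degree at most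
`p n - 1` with coefficients in `H¹₀(Ω)`. -/
structure IsProjection {d : ℕ} {Ω : TopologicalSpace.Opens (EuclideanSpace ℝ (Fin d))} {T : ℝ}
    (M : TimeMesh T) (p : ℕ → ℕ) (u P : ℝ → H10 Ω) : Prop where
  mem : InTrialSpace M p P
  node : ∀ n ∈ M.idx, M.traceL P n = u (M.t n)
  orth : ∀ n ∈ M.idx, ∀ X : ℝ → H10 Ω, IsPoly (p n - 1) X →
    ∫ s in M.t (n - 1)..M.t n, inner ℝ (toL2 (u s - P s)) (toL2 (X s)) = 0

/-- `‖v‖_{L_∞(L_2)} = max_n sup_{t ∈ I_n} ‖v(t)‖`. -/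
def normLinfL2 {d : ℕ} {Ω : TopologicalSpace.Opens (EuclideanSpace ℝ (Fin d))} {T : ℝ}
    (M : TimeMesh T) (v : ℝ → H10 Ω) : ℝ :=
  M.max fun n => sSup ((fun t => ‖toL2 (v t)‖) '' M.I n)

end

end SubdiffusionDG

open SubdiffusionDG

/-!
The error `U - u` is split as `θ + η`, with `θ = U - Πu` a discrete function and `η = Πu - u` the
projection error, and the difference of the discrete and the continuous problem is tested with `θ`
itself. On every subinterval the defining properties of `Πu` remove the terms with `η'` and with
the jumps of `η` (`error_equation`, `energy_step`), so that the summed identity (`energy_sum`)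
bounds the nodal values and the jumps of `U - Πu` and the form `∫ ⟨B_α ∇θ, ∇θ⟩` by
`∫ ⟨B_α ∇η, ∇θ⟩`.

The analysis of these forms rests on writing the Riemann–Liouville derivative of a piecewise
absolutely continuous function as a Marchaud integral of backward differences,
`B_α v = ∫₀^∞ κ(h) (v - v(· - h)) dh` with `κ(h) = c h^(α-1)`. No Laplace or Fourier transform is
needed.

* Positivity: the form at `(v, v)` is half of the energy `N(v) = ∫₀^∞ κ(h) ‖v - v(· - h)‖² dh`, the
  norm being that of `L²(ℝ)` (`fracForm_self`).
* Sector condition (`abs_fracForm_le`): with `τ` the translation by `h`,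
  `(1 - τ)² = 2 (1 - τ) - (1 - τ²)`, and `κ` is homogeneous, so a double difference reproduces
  `(2 - 2^(-α)) B_α`. Moving one factor to the other argument shows that the form at `(v, w)` is at
  most a multiple of `N(v)^(1/2) N(w)^(1/2)`.
* Energy of the projection error: `η` vanishes at the right end of each subinterval, hence a single
  piece has energy at most a multiple of `k_n^(α+1) (∫ ‖η'‖)²` (`IsACPiece.fracEnergy_le`), and
  pieces with disjoint supports add up without a factor depending on their number
  (`fracEnergy_sum_le`). Since the time steps sum to `t_n`, this gives `t_n` times the right-hand
  side (`fracEnergy_projection_error_le`), which together with the above is `energy_estimate`.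
* Coercivity: the differences with `h > t_n` alone give `N(v) ≥ 2 ω_{α+1}(t_n) ∫ ‖v‖²` for functions
  supported in `[0, t_n]`; with the Poincaré inequality (`exists_poincare`) the energy estimate
  bounds `∫_{I_n} ‖θ‖²`.

These bounds for `θ` carry over to `U - u`, because `‖η(t)‖ ≤ ∫_{I_n} ‖η'‖` on `I_n`. The nodal part
of the claim is then immediate (`nodal_bounds`). For the maximum norm on `I_n`, a polynomial of
degree one attains its maximum at an end point; for a higher degree the inverse inequality
`‖X(t)‖² ≤ C p² k_n⁻¹ ∫ ‖X‖²` applies, its factor `k_n⁻¹` and the factor `t_n` of the energy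
estimate being compensated by the weight (`supWeight_mul_sq_le`).
-/

namespace SubdiffusionDG

/-! ### The Marchaud kernel -/

/-- The kernel `κ(h) = -α h^(α-1) / Γ(α+1)`, the negative of the derivative of `ω_{α+1}`. -/
noncomputable def marchaudKernel (α h : ℝ) : ℝ := -α / Real.Gamma (α + 1) * h ^ (α - 1)

section kernel

variable {α : ℝ}

theorem marchaudKernel_coeff_pos (hα : -1 < α) (hα' : α < 0) : 0 < -α / Real.Gamma (α + 1) :=
  div_pos (by linarith) (Real.Gamma_pos_of_pos (by linarith))

theorem marchaudKernel_nonneg (hα : -1 < α) (hα' : α < 0) {h : ℝ} (hh : 0 < h) :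
    0 ≤ marchaudKernel α h :=
  mul_nonneg (marchaudKernel_coeff_pos hα hα').le (Real.rpow_nonneg hh.le _)

theorem measurable_marchaudKernel : Measurable (marchaudKernel α) := by
  unfold marchaudKernel
  fun_prop

theorem integrableOn_marchaudKernel_Ioi (hα' : α < 0) {t : ℝ} (ht : 0 < t) :
    IntegrableOn (marchaudKernel α) (Ioi t) :=
  (integrableOn_Ioi_rpow_of_lt (by linarith) ht).const_mul _

theorem integral_marchaudKernel_Ioi (hα' : α < 0) {t : ℝ} (ht : 0 < t) :
    ∫ h in Ioi t, marchaudKernel α h = omegaKernel (α + 1) t := by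
  unfold marchaudKernel omegaKernel
  rw [integral_const_mul, integral_Ioi_rpow_of_lt (by linarith) ht]
  have : α - 1 + 1 = α := by ring
  have hα0 : α ≠ 0 := hα'.ne
  rw [this, add_sub_cancel_right]
  field_simp

theorem intervalIntegrable_omegaKernel (hα : -1 < α) (a b : ℝ) :
    IntervalIntegrable (omegaKernel (α + 1)) volume a b := by
  unfold omegaKernel
  exact (intervalIntegral.intervalIntegrable_rpow' (by linarith)).div_const _

theorem marchaudKernel_two_mul {h : ℝ} (hh : 0 < h) :
    marchaudKernel α (2 * h) = 2 ^ (α - 1) * marchaudKernel α h := by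
  unfold marchaudKernel
  rw [Real.mul_rpow (by norm_num) hh.le]
  ring

/-- The scaling of the kernel under `h ↦ 2 h`. -/
theorem integral_marchaudKernel_mul_comp_two_mul (I : ℝ → ℝ) :
    ∫ h in Ioi (0 : ℝ), marchaudKernel α h * I (2 * h)
      = 2 ^ (-α) * ∫ h in Ioi (0 : ℝ), marchaudKernel α h * I h := by
  have h1 := integral_comp_mul_left_Ioi (fun h => marchaudKernel α h * I h) 0
    (b := 2) (by norm_num)
  simp only [mul_zero, smul_eq_mul] at h1
  have h2 : ∫ h in Ioi (0 : ℝ), marchaudKernel α (2 * h) * I (2 * h)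
      = 2 ^ (α - 1) * ∫ h in Ioi (0 : ℝ), marchaudKernel α h * I (2 * h) := by
    rw [← integral_const_mul]
    refine setIntegral_congr_fun measurableSet_Ioi fun h hh => ?_
    simp only [marchaudKernel_two_mul hh]
    ring
  rw [h2] at h1
  have h3 : (2 : ℝ) ^ (-α) = 2⁻¹ / 2 ^ (α - 1) := by
    rw [Real.rpow_sub (by norm_num), Real.rpow_neg (by norm_num), Real.rpow_one]
    field_simp
  rw [h3, div_mul_eq_mul_div, ← h1]
  have : (2 : ℝ) ^ (α - 1) ≠ 0 := by positivity
  field_simp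

/-- The constant `C` in `∫₀^∞ κ(h) min(h, k) dh = C k^(α+1)`. -/
noncomputable def marchaudConst (α : ℝ) : ℝ :=
  -α / Real.Gamma (α + 1) / (α + 1) + 1 / Real.Gamma (α + 1)

theorem marchaudConst_pos (hα : -1 < α) (hα' : α < 0) : 0 < marchaudConst α := by
  have h1 := marchaudKernel_coeff_pos hα hα'
  have h2 : 0 < Real.Gamma (α + 1) := Real.Gamma_pos_of_pos (by linarith)
  have h3 : 0 < α + 1 := by linarith
  unfold marchaudConst
  positivity

theorem integrableOn_marchaudKernel_mul_min (hα : -1 < α) (hα' : α < 0) {k : ℝ} (hk : 0 < k) :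
    IntegrableOn (fun h => marchaudKernel α h * min h k) (Ioi 0) ∧
      ∫ h in Ioi (0 : ℝ), marchaudKernel α h * min h k = marchaudConst α * k ^ (α + 1) := by
  have e1 : EqOn (fun h => marchaudKernel α h * min h k)
      (fun h => -α / Real.Gamma (α + 1) * h ^ α) (Ioc 0 k) := by
    intro h hh
    simp only [marchaudKernel, min_eq_left hh.2, mul_assoc]
    rw [Real.rpow_sub_one hh.1.ne', div_mul_cancel₀ _ hh.1.ne']
  have e2 : EqOn (fun h => marchaudKernel α h * min h k)
      (fun h => marchaudKernel α h * k) (Ioi k) := by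
    intro h hh
    simp only [min_eq_right (le_of_lt (mem_Ioi.1 hh))]
  have i1 : IntegrableOn (fun h => marchaudKernel α h * min h k) (Ioc 0 k) := by
    rw [integrableOn_congr_fun e1 measurableSet_Ioc]
    exact ((intervalIntegrable_iff_integrableOn_Ioc_of_le hk.le).1
      (intervalIntegral.intervalIntegrable_rpow' hα)).const_mul _
  have i2 : IntegrableOn (fun h => marchaudKernel α h * min h k) (Ioi k) := by
    rw [integrableOn_congr_fun e2 measurableSet_Ioi]
    exact (integrableOn_marchaudKernel_Ioi hα' hk).mul_const _
  refine ⟨by rw [← Ioc_union_Ioi_eq_Ioi hk.le]; exact i1.union i2, ?_⟩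
  rw [← Ioc_union_Ioi_eq_Ioi hk.le, setIntegral_union (Ioc_disjoint_Ioi le_rfl)
    measurableSet_Ioi i1 i2, setIntegral_congr_fun measurableSet_Ioc e1,
    setIntegral_congr_fun measurableSet_Ioi e2, integral_const_mul, integral_mul_const,
    integral_marchaudKernel_Ioi hα' hk, ← intervalIntegral.integral_of_le hk.le,
    integral_rpow (Or.inl hα), Real.zero_rpow (by linarith), marchaudConst, omegaKernel,
    add_sub_cancel_right, Real.rpow_add_one hk.ne']
  ring

end kernel

/-! ### Compactly supported functions of bounded variation in time -/

variable {E : Type*} [NormedAddCommGroup E]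

/-- A bounded function on the line that vanishes outside `(0, T)` and has bounded variation,
in the sense that `∫ ‖v(t) - v(t-h)‖ dt = O(h)`. Functions on `(0, T)` are extended by zero, so
that a jump at the time `0` is part of the variation. -/
structure IsBump (T : ℝ) (v : ℝ → E) : Prop where
  meas : StronglyMeasurable v
  supp : ∀ t, t ∉ Ioo 0 T → v t = 0
  bdd : ∃ A, ∀ t, ‖v t‖ ≤ A
  var : ∃ V, ∀ h, 0 < h → ∫ t, ‖v t - v (t - h)‖ ≤ V * h

namespace IsBump

variable {T : ℝ} {v w : ℝ → E}

theorem integrable (hv : IsBump T v) : Integrable v := by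
  obtain ⟨A, hA⟩ := hv.bdd
  have : IntegrableOn v (Ioo 0 T) :=
    Integrable.of_bound (C := A) hv.meas.aestronglyMeasurable (Eventually.of_forall hA)
  rwa [integrableOn_iff_integrable_of_support_subset] at this
  intro t ht
  by_contra h
  exact ht (hv.supp t h)

theorem integrable_diff (hv : IsBump T v) (h : ℝ) : Integrable fun t => v t - v (t - h) :=
  hv.integrable.sub (hv.integrable.comp_sub_right h)

theorem stronglyMeasurable_diff (hv : IsBump T v) :
    StronglyMeasurable fun p : ℝ × ℝ => v p.2 - v (p.2 - p.1) :=
  (hv.meas.comp_measurable measurable_snd).sub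
    (hv.meas.comp_measurable (measurable_snd.sub measurable_fst))

theorem zero : IsBump T (fun _ => (0 : E)) :=
  ⟨stronglyMeasurable_const, fun _ _ => rfl, ⟨0, by simp⟩, ⟨0, by simp⟩⟩

theorem add (hv : IsBump T v) (hw : IsBump T w) : IsBump T (fun t => v t + w t) := by
  obtain ⟨A, hA⟩ := hv.bdd
  obtain ⟨B, hB⟩ := hw.bdd
  obtain ⟨V, hV⟩ := hv.var
  obtain ⟨W, hW⟩ := hw.var
  refine ⟨hv.meas.add hw.meas, fun t ht => by simp [hv.supp t ht, hw.supp t ht],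
    ⟨A + B, fun t => (norm_add_le _ _).trans (add_le_add (hA t) (hB t))⟩,
    ⟨V + W, fun h hh => ?_⟩⟩
  rw [add_mul]
  refine le_trans ?_ (add_le_add (hV h hh) (hW h hh))
  rw [← integral_add (hv.integrable_diff h).norm (hw.integrable_diff h).norm]
  refine integral_mono ?_ ((hv.integrable_diff h).norm.add (hw.integrable_diff h).norm) fun t => ?_
  · refine (((hv.integrable_diff h).add (hw.integrable_diff h)).congr ?_).norm
    exact Eventually.of_forall fun t => by simp only [Pi.add_apply]; abel
  · refine le_trans (le_of_eq ?_) (norm_add_le _ _)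
    congr 1
    abel

/-- The variation and the boundedness together bound `∫ ‖v(t) - v(t-h)‖ dt` for small and for
large `h`. -/
theorem exists_le_min (hv : IsBump T v) :
    ∃ V, 0 ≤ V ∧ ∀ h, 0 < h → ∫ t, ‖v t - v (t - h)‖ ≤ V * min h 1 := by
  obtain ⟨V, hV⟩ := hv.var
  have h2 : ∀ h, ∫ t, ‖v t - v (t - h)‖ ≤ 2 * ∫ t, ‖v t‖ := by
    intro h
    have e : ∫ t, ‖v (t - h)‖ = ∫ t, ‖v t‖ := integral_sub_right_eq_self (fun t => ‖v t‖) h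
    rw [two_mul]
    nth_rewrite 2 [← e]
    have i1 := hv.integrable.norm
    have i2 := (hv.integrable.comp_sub_right h).norm
    rw [← integral_add i1 i2]
    exact integral_mono (hv.integrable_diff h).norm (i1.add i2) fun t => norm_sub_le _ _
  refine ⟨max (max V 0) (2 * ∫ t, ‖v t‖), le_max_of_le_left (le_max_right _ _), fun h hh => ?_⟩
  rcases le_total h 1 with h1 | h1
  · rw [min_eq_left h1]
    refine (hV h hh).trans (mul_le_mul_of_nonneg_right ?_ hh.le)
    exact le_max_of_le_left (le_max_left _ _)
  · rw [min_eq_right h1, mul_one]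
    exact (h2 h).trans (le_max_right _ _)

/-- Functions dominated by the backward differences of a bump are integrable against the
singular kernel. -/
theorem integrable_kernel_smul {G : Type*} [NormedAddCommGroup G] [NormedSpace ℝ G]
    {α : ℝ} (hα : -1 < α) (hα' : α < 0) (hv : IsBump T v)
    {Φ : ℝ × ℝ → G} (hΦ : StronglyMeasurable Φ) {A : ℝ}
    (hA : ∀ h t, ‖Φ (h, t)‖ ≤ A * ‖v t - v (t - h)‖) :
    Integrable (fun p : ℝ × ℝ => marchaudKernel α p.1 • Φ p)
      ((volume.restrict (Ioi 0)).prod volume) := by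
  obtain ⟨V, hV0, hV⟩ := hv.exists_le_min
  have hm : StronglyMeasurable (fun p : ℝ × ℝ => marchaudKernel α p.1 • Φ p) :=
    (measurable_marchaudKernel.stronglyMeasurable.comp_measurable measurable_fst).smul hΦ
  have hsec : ∀ h, Integrable fun t => Φ (h, t) := fun h =>
    ((hv.integrable_diff h).norm.const_mul A).mono'
      (hΦ.comp_measurable measurable_prodMk_left).aestronglyMeasurable
      (Eventually.of_forall fun t => hA h t)
  rw [integrable_prod_iff hm.aestronglyMeasurable]
  refine ⟨Eventually.of_forall fun h => (hsec h).smul (marchaudKernel α h), ?_⟩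
  refine Integrable.mono' (g := fun h => |A| * V * (marchaudKernel α h * min h 1))
    ((integrableOn_marchaudKernel_mul_min hα hα' one_pos).1.const_mul _)
    (hm.norm.integral_prod_right).aestronglyMeasurable ?_
  filter_upwards [ae_restrict_mem measurableSet_Ioi] with h hh
  have hk := marchaudKernel_nonneg hα hα' hh
  rw [Real.norm_of_nonneg (integral_nonneg fun t => norm_nonneg _)]
  simp only [norm_smul, Real.norm_of_nonneg hk]
  rw [integral_const_mul]
  have : ∫ t, ‖Φ (h, t)‖ ≤ |A| * (V * min h 1) := by
    refine le_trans ?_ (mul_le_mul_of_nonneg_left (hV h hh) (abs_nonneg A))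
    rw [← integral_const_mul]
    refine integral_mono (hsec h).norm ((hv.integrable_diff h).norm.const_mul _) fun t => ?_
    exact (hA h t).trans (mul_le_mul_of_nonneg_right (le_abs_self A) (norm_nonneg _))
  calc _ ≤ marchaudKernel α h * (|A| * (V * min h 1)) := mul_le_mul_of_nonneg_left this hk
    _ = _ := by ring

theorem sum {ι : Type*} (s : Finset ι) {v : ι → ℝ → E} (hv : ∀ i ∈ s, IsBump T (v i)) :
    IsBump T (fun t => ∑ i ∈ s, v i t) := by
  classical
  induction s using Finset.induction_on with
  | empty => simpa using IsBump.zero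
  | insert a s ha ih =>
    simp only [Finset.sum_insert ha]
    exact (hv a (by simp)).add (ih fun i hi => hv i (by simp [hi]))

variable [NormedSpace ℝ E]

theorem clm {G : Type*} [NormedAddCommGroup G] [NormedSpace ℝ G] (hv : IsBump T v)
    (L : E →L[ℝ] G) : IsBump T (fun t => L (v t)) := by
  obtain ⟨A, hA⟩ := hv.bdd
  obtain ⟨V, hV⟩ := hv.var
  refine ⟨L.continuous.comp_stronglyMeasurable hv.meas, fun t ht => by simp [hv.supp t ht],
    ⟨‖L‖ * A, fun t => (L.le_opNorm _).trans (by gcongr; exact hA t)⟩,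
    ⟨‖L‖ * V, fun h hh => ?_⟩⟩
  rw [mul_assoc]
  refine le_trans ?_ (mul_le_mul_of_nonneg_left (hV h hh) (norm_nonneg L))
  rw [← integral_const_mul]
  refine integral_mono ?_ ((hv.integrable_diff h).norm.const_mul _) fun t => ?_
  · refine ((L.integrable_comp (hv.integrable_diff h)).congr ?_).norm
    exact Eventually.of_forall fun t => map_sub L _ _
  · simp only [← map_sub]
    exact L.le_opNorm _

end IsBump

/-! ### The Marchaud form of the fractional derivative -/

/-- The Marchaud derivative `∫₀^∞ κ(h) (v(t) - v(t-h)) dh`. -/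
noncomputable def marchaud {E : Type*} [NormedAddCommGroup E] [NormedSpace ℝ E] (α : ℝ)
    (v : ℝ → E) (t : ℝ) : E :=
  ∫ h in Ioi (0 : ℝ), marchaudKernel α h • (v t - v (t - h))

/-- `fracDeriv α v` on `(0, T)` depends only on the values of `v` on `(0, T)`, up to null sets. -/
theorem fracDeriv_congr_ae {E : Type*} [NormedAddCommGroup E] [NormedSpace ℝ E] {α T : ℝ}
    {v w : ℝ → E} (h : ∀ᵐ t, t ∈ Ioo 0 T → v t = w t) {t : ℝ} (ht : t ∈ Ioo 0 T) :
    fracDeriv α v t = fracDeriv α w t := by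
  unfold fracDeriv
  refine EventuallyEq.deriv_eq ?_
  filter_upwards [isOpen_Ioo.mem_nhds ht] with r hr
  refine intervalIntegral.integral_congr_ae ?_
  filter_upwards [h] with s hs hsr
  rw [uIoc_of_le hr.1.le] at hsr
  rw [hs ⟨hsr.1, hsr.2.trans_lt hr.2⟩]

theorem integral_marchaudKernel_smul_ite {E : Type*} [NormedAddCommGroup E] [NormedSpace ℝ E]
    [CompleteSpace E] {α : ℝ} (hα' : α < 0) {a : ℝ} (ha : 0 < a) (x : E) :
    ∫ h in Ioi (0 : ℝ), marchaudKernel α h • (if a < h then x else 0)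
      = omegaKernel (α + 1) a • x := by
  have e : ∀ h, marchaudKernel α h • (if a < h then x else 0)
      = (Ioi a).indicator (fun h => marchaudKernel α h • x) h := by
    intro h
    simp [indicator]
  simp only [e]
  rw [setIntegral_indicator measurableSet_Ioi, inter_eq_right.2 (Ioi_subset_Ioi ha.le),
    integral_smul_const, integral_marchaudKernel_Ioi hα' ha]

namespace IsBump

variable {E : Type*} [NormedAddCommGroup E] [NormedSpace ℝ E] {T α : ℝ} {v : ℝ → E}

theorem integrable_kernel_smul_diff (hα : -1 < α) (hα' : α < 0) (hv : IsBump T v) :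
    Integrable (fun p : ℝ × ℝ => marchaudKernel α p.1 • (v p.2 - v (p.2 - p.1)))
      ((volume.restrict (Ioi 0)).prod volume) :=
  hv.integrable_kernel_smul hα hα' hv.stronglyMeasurable_diff (A := 1) fun h t => by simp

theorem integrable_marchaud (hα : -1 < α) (hα' : α < 0) (hv : IsBump T v) :
    Integrable (marchaud α v) :=
  (hv.integrable_kernel_smul_diff hα hα').integral_prod_right

theorem ae_integrable_kernel_smul_diff (hα : -1 < α) (hα' : α < 0) (hv : IsBump T v) :
    ∀ᵐ t, IntegrableOn (fun h => marchaudKernel α h • (v t - v (t - h))) (Ioi 0) :=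
  (hv.integrable_kernel_smul_diff hα hα').prod_left_ae

variable [CompleteSpace E]

/-- The convolution with `ω_{α+1}` is the indefinite integral of the Marchaud derivative. -/
theorem integral_marchaud (hα : -1 < α) (hα' : α < 0) (hv : IsBump T v) {r : ℝ} (hr : 0 < r) :
    ∫ t in (0 : ℝ)..r, marchaud α v t
      = ∫ s in (0 : ℝ)..r, omegaKernel (α + 1) (r - s) • v s := by
  rw [intervalIntegral.integral_of_le hr.le, intervalIntegral.integral_of_le hr.le]
  set ν := volume.restrict (Ioc 0 r) with hν
  have hi : Integrable (fun p : ℝ × ℝ => marchaudKernel α p.1 • (v p.2 - v (p.2 - p.1)))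
      ((volume.restrict (Ioi 0)).prod ν) := by
    have := (hv.integrable_kernel_smul_diff hα hα').integrableOn (s := univ ×ˢ Ioc 0 r)
    rwa [IntegrableOn, ← Measure.prod_restrict, Measure.restrict_univ] at this
  have hs : ∫ t, marchaud α v t ∂ν
      = ∫ h in Ioi (0 : ℝ), marchaudKernel α h • ∫ t, (v t - v (t - h)) ∂ν := by
    simp only [marchaud, ← integral_smul]
    exact (integral_integral_swap hi).symm
  -- The translated integral only loses the mass of `v` on `(r - h, r]`.
  have hd : ∀ h, 0 < h →
      ∫ t, (v t - v (t - h)) ∂ν = ∫ s, (if r - s < h then v s else 0) ∂ν := by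
    intro h hh
    have j1 : Integrable v ν := hv.integrable.integrableOn
    have j2 : Integrable (fun t => v (t - h)) ν :=
      (hv.integrable.comp_sub_right h).integrableOn
    have hset : MeasurableSet {s : ℝ | s ≤ r - h} := measurableSet_Iic
    have j3 : Integrable (fun s => if s ≤ r - h then v s else 0) ν := by
      refine (j1.indicator hset).congr (Eventually.of_forall fun s => ?_)
      simp [indicator]
    have e : ∫ t, v (t - h) ∂ν = ∫ s, (if s ≤ r - h then v s else 0) ∂ν := by
      rw [hν, ← integral_indicator measurableSet_Ioc, ← integral_indicator measurableSet_Ioc,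
        ← integral_add_right_eq_self _ h]
      congr 1 with s
      simp only [indicator, mem_Ioc, add_sub_cancel_right]
      by_cases hs : s ∈ Ioo 0 T
      · have h1 := hs.1
        grind
      · simp [hv.supp s hs]
    rw [integral_sub j1 j2, e, ← integral_sub j1 j3]
    congr 1 with s
    split_ifs <;> first | (exfalso; linarith) | simp
  have hs2 : ∫ h in Ioi (0 : ℝ), marchaudKernel α h • ∫ t, (v t - v (t - h)) ∂ν
      = ∫ h in Ioi (0 : ℝ), ∫ s, marchaudKernel α h • (if r - s < h then v s else 0) ∂ν := by
    refine setIntegral_congr_fun measurableSet_Ioi fun h hh => ?_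
    simp only [integral_smul]
    rw [hd h hh]
  have hne : ∀ᵐ s ∂ν, s ∈ Ioo 0 r := by
    have h1 : ∀ᵐ s ∂ν, s ≠ r := ae_restrict_of_ae (Measure.ae_ne volume r)
    filter_upwards [h1, ae_restrict_mem measurableSet_Ioc] with s h1 h2
    exact ⟨h2.1, lt_of_le_of_ne h2.2 h1⟩
  have hpt : ∀ s h, marchaudKernel α h • (if r - s < h then v s else 0)
      = (Ioi (r - s)).indicator (fun h => marchaudKernel α h • v s) h := by
    intro s h
    simp [indicator]
  have hsec : ∀ s ∈ Ioo 0 r, IntegrableOn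
      (fun h => marchaudKernel α h • (if r - s < h then v s else 0)) (Ioi 0) := by
    intro s hs
    have hrs : 0 < r - s := sub_pos.2 hs.2
    simp only [hpt]
    have h1 : IntegrableOn (fun h => marchaudKernel α h • v s) (Ioi (r - s)) :=
      Integrable.smul_const (integrableOn_marchaudKernel_Ioi hα' hrs) (v s)
    exact (h1.integrable_indicator measurableSet_Ioi).integrableOn
  have hval : ∀ s ∈ Ioo 0 r, ∀ x : E, ∫ h in Ioi (0 : ℝ),
      marchaudKernel α h • (if r - s < h then x else 0) = omegaKernel (α + 1) (r - s) • x := by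
    intro s hs x
    exact integral_marchaudKernel_smul_ite hα' (sub_pos.2 hs.2) x
  rw [hs, hs2]
  have hprod : Integrable (fun p : ℝ × ℝ =>
      marchaudKernel α p.1 • (if r - p.2 < p.1 then v p.2 else 0))
      ((volume.restrict (Ioi 0)).prod ν) := by
    have hm : StronglyMeasurable (fun p : ℝ × ℝ =>
        marchaudKernel α p.1 • (if r - p.2 < p.1 then v p.2 else 0)) := by
      refine (measurable_marchaudKernel.stronglyMeasurable.comp_measurable measurable_fst).smul ?_
      exact StronglyMeasurable.ite (measurableSet_lt (by fun_prop) (by fun_prop))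
        (hv.meas.comp_measurable measurable_snd) stronglyMeasurable_const
    rw [integrable_prod_iff' hm.aestronglyMeasurable]
    refine ⟨hne.mono fun s hs => hsec s hs, ?_⟩
    obtain ⟨A, hA⟩ := hv.bdd
    have hk : Integrable (fun s => omegaKernel (α + 1) (r - s) * ‖v s‖) ν := by
      have h1 : IntervalIntegrable (fun s => omegaKernel (α + 1) (r - s)) volume 0 r := by
        simpa using ((intervalIntegrable_omegaKernel hα 0 r).comp_sub_left r).symm
      rw [intervalIntegrable_iff_integrableOn_Ioc_of_le hr.le] at h1
      refine Integrable.mul_bdd (c := A) h1 hv.meas.norm.aestronglyMeasurable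
        (Eventually.of_forall fun s => by simpa using hA s)
    refine hk.congr (hne.mono fun s hs => ?_)
    simp only
    rw [← smul_eq_mul, ← integral_marchaudKernel_smul_ite hα' (sub_pos.2 hs.2)]
    refine setIntegral_congr_fun measurableSet_Ioi fun h hh => ?_
    simp only [norm_smul, Real.norm_of_nonneg (marchaudKernel_nonneg hα hα' hh), smul_eq_mul]
    split_ifs <;> simp
  rw [integral_integral_swap hprod]
  exact integral_congr_ae (hne.mono fun s hs => hval s hs (v s))

theorem ae_fracDeriv_eq_marchaud (hα : -1 < α) (hα' : α < 0) (hv : IsBump T v) :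
    ∀ᵐ t, 0 < t → fracDeriv α v t = marchaud α v t := by
  have h := LocallyIntegrable.ae_hasDerivAt_integral
    (hv.integrable_marchaud hα hα').locallyIntegrable
  filter_upwards [h] with t ht ht0
  refine HasDerivAt.deriv ((ht 0).congr_of_eventuallyEq ?_)
  filter_upwards [lt_mem_nhds ht0] with r hr
  exact (hv.integral_marchaud hα hα' hr).symm

/-- The fractional derivative of a bump, seen through a continuous linear map. -/
theorem ae_map_fracDeriv {G : Type*} [NormedAddCommGroup G] [NormedSpace ℝ G] [CompleteSpace G]
    (hα : -1 < α) (hα' : α < 0) (hv : IsBump T v) (L : E →L[ℝ] G) :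
    ∀ᵐ t, 0 < t → L (fracDeriv α v t) = marchaud α (fun s => L (v s)) t := by
  filter_upwards [hv.ae_fracDeriv_eq_marchaud hα hα', hv.ae_integrable_kernel_smul_diff hα hα']
    with t ht hi h0
  rw [ht h0, marchaud, ← L.integral_comp_comm hi]
  simp [marchaud]

end IsBump

/-! ### The fractional form and its energy -/

section energy

variable {F : Type*} [NormedAddCommGroup F]

/-- The energy `∫₀^∞ κ(h) ∫ ‖v(t) - v(t-h)‖² dt dh`, the square of a seminorm of order `-α/2`. -/
noncomputable def fracEnergy (α : ℝ) (v : ℝ → F) : ℝ :=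
  ∫ h in Ioi (0 : ℝ), marchaudKernel α h * ∫ t, ‖v t - v (t - h)‖ ^ 2

namespace IsBump

variable {T α : ℝ} {v : ℝ → F}

theorem integrable_kernel_mul_sq (hα : -1 < α) (hα' : α < 0) (hv : IsBump T v) :
    Integrable (fun p : ℝ × ℝ => marchaudKernel α p.1 • ‖v p.2 - v (p.2 - p.1)‖ ^ 2)
      ((volume.restrict (Ioi 0)).prod volume) := by
  obtain ⟨A, hA⟩ := hv.bdd
  refine hv.integrable_kernel_smul hα hα' (hv.stronglyMeasurable_diff.norm.pow 2) (A := A + A) ?_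
  intro h t
  rw [Real.norm_of_nonneg (by positivity), sq]
  gcongr
  exact (norm_sub_le _ _).trans (add_le_add (hA _) (hA _))

theorem integrableOn_energy (hα : -1 < α) (hα' : α < 0) (hv : IsBump T v) :
    IntegrableOn (fun h => marchaudKernel α h * ∫ t, ‖v t - v (t - h)‖ ^ 2) (Ioi 0) := by
  have := (hv.integrable_kernel_mul_sq hα hα').integral_prod_left
  simpa only [IntegrableOn, smul_eq_mul, integral_const_mul] using this

theorem integrable_sq_diff (hv : IsBump T v) (h : ℝ) :
    Integrable fun t => ‖v t - v (t - h)‖ ^ 2 := by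
  obtain ⟨A, hA⟩ := hv.bdd
  refine ((hv.integrable_diff h).norm.const_mul (A + A)).mono'
    ((hv.integrable_diff h).aestronglyMeasurable.norm.pow 2) (Eventually.of_forall fun t => ?_)
  rw [Real.norm_of_nonneg (by positivity), sq]
  gcongr
  exact (norm_sub_le _ _).trans (add_le_add (hA _) (hA _))

theorem integrable_sq (hv : IsBump T v) : Integrable fun t => ‖v t‖ ^ 2 := by
  obtain ⟨A, hA⟩ := hv.bdd
  refine (hv.integrable.norm.const_mul A).mono'
    (hv.integrable.aestronglyMeasurable.norm.pow 2) (Eventually.of_forall fun t => ?_)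
  rw [Real.norm_of_nonneg (by positivity), sq]
  gcongr
  exact hA _

theorem fracEnergy_nonneg (hα : -1 < α) (hα' : α < 0) : 0 ≤ fracEnergy α v :=
  setIntegral_nonneg measurableSet_Ioi fun _ hh =>
    mul_nonneg (marchaudKernel_nonneg hα hα' hh) (integral_nonneg fun _ => by positivity)

/-- Coercivity: for `h ≥ T` the two functions `v` and `v(· - h)` have disjoint supports. -/
theorem two_mul_omegaKernel_mul_le (hα : -1 < α) (hα' : α < 0) (hT : 0 < T) (hv : IsBump T v) :
    2 * omegaKernel (α + 1) T * ∫ t, ‖v t‖ ^ 2 ≤ fracEnergy α v := by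
  have h1 : ∫ h in Ioi T, marchaudKernel α h * ∫ t, ‖v t - v (t - h)‖ ^ 2
      = 2 * omegaKernel (α + 1) T * ∫ t, ‖v t‖ ^ 2 := by
    rw [← integral_marchaudKernel_Ioi hα' hT, mul_comm 2, mul_assoc, ← integral_mul_const]
    refine setIntegral_congr_fun measurableSet_Ioi fun h hh => ?_
    have hh : T < h := hh
    congr 1
    have e : ∀ t, ‖v t - v (t - h)‖ ^ 2 = ‖v t‖ ^ 2 + ‖v (t - h)‖ ^ 2 := by
      intro t
      by_cases ht : t ∈ Ioo 0 T
      · rw [hv.supp (t - h) fun h' => by have := h'.1; have := ht.2; linarith]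
        simp
      · rw [hv.supp t ht]
        simp
    simp only [e]
    rw [integral_add hv.integrable_sq (hv.integrable_sq.comp_sub_right h),
      integral_sub_right_eq_self (fun t => ‖v t‖ ^ 2) h, two_mul]
  rw [← h1]
  refine setIntegral_mono_set (hv.integrableOn_energy hα hα') ?_
    (Ioi_subset_Ioi hT.le).eventuallyLE
  filter_upwards [ae_restrict_mem measurableSet_Ioi] with h hh
  exact mul_nonneg (marchaudKernel_nonneg hα hα' hh) (integral_nonneg fun _ => by positivity)

end IsBump

end energy

variable {F : Type*} [NormedAddCommGroup F] [InnerProductSpace ℝ F]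

/-- The bilinear form `∫₀^∞ κ(h) ∫ ⟨v(t) - v(t-h), w(t)⟩ dt dh`, which is `∫ ⟨B_α v, w⟩ dt`. -/
noncomputable def fracForm (α : ℝ) (v w : ℝ → F) : ℝ :=
  ∫ h in Ioi (0 : ℝ), marchaudKernel α h * ∫ t, inner ℝ (v t - v (t - h)) (w t)

namespace IsBump

variable {T α : ℝ} {v w : ℝ → F}

theorem integrable_inner {f g : ℝ → F} (hf : Integrable f) (hg : StronglyMeasurable g)
    {A : ℝ} (hA : ∀ t, ‖g t‖ ≤ A) : Integrable fun t => inner ℝ (f t) (g t) := by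
  refine (hf.norm.mul_const A).mono' (hf.aestronglyMeasurable.inner hg.aestronglyMeasurable) ?_
  exact Eventually.of_forall fun t => (norm_inner_le_norm _ _).trans (by gcongr; exact hA t)

theorem stronglyMeasurable_inner_diff (hv : IsBump T v) (hw : IsBump T w) :
    StronglyMeasurable fun p : ℝ × ℝ => inner ℝ (v p.2 - v (p.2 - p.1)) (w p.2) :=
  hv.stronglyMeasurable_diff.inner (hw.meas.comp_measurable measurable_snd)

theorem integrable_kernel_mul_inner (hα : -1 < α) (hα' : α < 0) (hv : IsBump T v)
    (hw : IsBump T w) :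
    Integrable (fun p : ℝ × ℝ => marchaudKernel α p.1 • inner ℝ (v p.2 - v (p.2 - p.1)) (w p.2))
      ((volume.restrict (Ioi 0)).prod volume) := by
  obtain ⟨A, hA⟩ := hw.bdd
  refine hv.integrable_kernel_smul hα hα' (hv.stronglyMeasurable_inner_diff hw) (A := A) ?_
  intro h t
  refine (norm_inner_le_norm _ _).trans ?_
  rw [mul_comm]
  gcongr
  exact hA t

theorem integrableOn_form (hα : -1 < α) (hα' : α < 0) (hv : IsBump T v) (hw : IsBump T w) :
    IntegrableOn (fun h => marchaudKernel α h * ∫ t, inner ℝ (v t - v (t - h)) (w t))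
      (Ioi 0) := by
  have := (hv.integrable_kernel_mul_inner hα hα' hw).integral_prod_left
  simpa only [IntegrableOn, smul_eq_mul, integral_const_mul] using this

theorem integrable_inner_diff (hv : IsBump T v) (hw : IsBump T w) (h : ℝ) :
    Integrable fun t => inner ℝ (v t - v (t - h)) (w t) := by
  obtain ⟨A, hA⟩ := hw.bdd
  exact integrable_inner (hv.integrable_diff h) hw.meas hA

/-- The fractional form is the time integral of the Marchaud derivative against `w`. -/
theorem integral_inner_marchaud [CompleteSpace F] (hα : -1 < α) (hα' : α < 0) (hv : IsBump T v)
    (hw : IsBump T w) : ∫ t, inner ℝ (marchaud α v t) (w t) = fracForm α v w := by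
  have hs := integral_integral_swap
    (f := fun h t => marchaudKernel α h • inner ℝ (v t - v (t - h)) (w t))
    (hv.integrable_kernel_mul_inner hα hα' hw)
  simp only [smul_eq_mul] at hs
  simp only [fracForm, ← integral_const_mul]
  rw [hs]
  refine integral_congr_ae ?_
  filter_upwards [hv.ae_integrable_kernel_smul_diff hα hα'] with t ht
  rw [marchaud, real_inner_comm, ← integral_inner ht]
  refine integral_congr_ae (Eventually.of_forall fun h => ?_)
  simp only [inner_smul_right]
  rw [real_inner_comm]

theorem fracForm_add_left (hα : -1 < α) (hα' : α < 0) {v' : ℝ → F} (hv : IsBump T v)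
    (hv' : IsBump T v') (hw : IsBump T w) :
    fracForm α (fun t => v t + v' t) w = fracForm α v w + fracForm α v' w := by
  unfold fracForm
  rw [← integral_add (hv.integrableOn_form hα hα' hw) (hv'.integrableOn_form hα hα' hw)]
  congr 1 with h
  rw [← mul_add, ← integral_add (hv.integrable_inner_diff hw h) (hv'.integrable_inner_diff hw h)]
  congr 2 with t
  rw [← inner_add_left, add_sub_add_comm]

/-- The form is causal: against a `w` supported in `(-∞, r)` it sees only the values of `v`
before `r`. -/
theorem fracForm_congr_left {v' : ℝ → F} {r : ℝ} (h : ∀ t < r, v t = v' t)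
    (hw : ∀ t, r ≤ t → w t = 0) : fracForm α v w = fracForm α v' w := by
  unfold fracForm
  refine setIntegral_congr_fun measurableSet_Ioi fun s hs => ?_
  have hs : 0 < s := hs
  congr 2 with t
  rcases lt_or_ge t r with ht | ht
  · rw [h t ht, h (t - s) (by linarith)]
  · rw [hw t ht, inner_zero_right, inner_zero_right]

/-- Shifting the time in `‖v(t-h)‖²` shows that `⟨v - τ_h v, v⟩` and `‖v - τ_h v‖² / 2` have the
same integral. -/
theorem fracForm_self (hv : IsBump T v) : fracForm α v v = fracEnergy α v / 2 := by
  unfold fracForm fracEnergy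
  rw [← integral_div]
  congr 1 with h
  have e : ∀ t, inner ℝ (v t - v (t - h)) (v t)
      = (‖v t - v (t - h)‖ ^ 2 + (‖v t‖ ^ 2 - ‖v (t - h)‖ ^ 2)) / 2 := by
    intro t
    rw [norm_sub_sq_real, inner_sub_left, real_inner_self_eq_norm_sq, real_inner_comm]
    ring
  have i := hv.integrable_sq
  have i' := i.comp_sub_right h
  simp only [e]
  have a := integral_add (hv.integrable_sq_diff h) (i.sub i')
  simp only [Pi.sub_apply] at a
  rw [integral_div, a, integral_sub i i',
    integral_sub_right_eq_self (fun t => ‖v t‖ ^ 2) h, sub_self, add_zero, mul_div_assoc]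

/-- Since `(1 - τ_h)² = 2 (1 - τ_h) - (1 - τ_{2h})` for the translations `τ_h`, and the kernel is
homogeneous, one backward difference of the form can be moved onto `w` as a forward difference. -/
theorem mul_fracForm_eq (hα : -1 < α) (hα' : α < 0) (hv : IsBump T v) (hw : IsBump T w) :
    (2 - 2 ^ (-α)) * fracForm α v w
      = ∫ h in Ioi (0 : ℝ),
          marchaudKernel α h * ∫ t, inner ℝ (v t - v (t - h)) (w t - w (t + h)) := by
  have hi := hv.integrableOn_form hα hα' hw
  have key : ∀ h, ∫ t, inner ℝ (v t - v (t - h)) (w t - w (t + h))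
      = 2 * (∫ t, inner ℝ (v t - v (t - h)) (w t))
        - ∫ t, inner ℝ (v t - v (t - 2 * h)) (w t) := by
    intro h
    have j := hv.integrable_inner_diff hw h
    have j' : Integrable fun t => inner ℝ (v t - v (t - h)) (w (t + h)) := by
      obtain ⟨A, hA⟩ := hw.bdd
      exact integrable_inner (hv.integrable_diff h)
        (hw.meas.comp_measurable (measurable_id.add_const h)) fun t => hA _
    have j2 : Integrable fun t => inner ℝ (v (t - h) - v (t - h - h)) (w t) := by
      obtain ⟨A, hA⟩ := hw.bdd
      exact integrable_inner ((hv.integrable_diff h).comp_sub_right h) hw.meas hA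
    have s : ∫ t, inner ℝ (v t - v (t - h)) (w (t + h))
        = ∫ t, inner ℝ (v (t - h) - v (t - h - h)) (w t) := by
      rw [← integral_add_right_eq_self
        (fun t => inner ℝ (v (t - h) - v (t - h - h)) (w t) : ℝ → ℝ) h]
      simp only [add_sub_cancel_right]
    have e : ∫ t, inner ℝ (v t - v (t - h)) (w t - w (t + h))
        = (∫ t, inner ℝ (v t - v (t - h)) (w t)) - ∫ t, inner ℝ (v t - v (t - h)) (w (t + h)) := by
      rw [← integral_sub j j']
      simp only [inner_sub_right]
    have e2 : ∫ t, inner ℝ (v t - v (t - 2 * h)) (w t)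
        = (∫ t, inner ℝ (v t - v (t - h)) (w t))
          + ∫ t, inner ℝ (v (t - h) - v (t - h - h)) (w t) := by
      rw [← integral_add j j2]
      congr 1 with t
      rw [← inner_add_left, sub_add_sub_cancel, two_mul, sub_sub]
    rw [e, e2, s]
    ring
  simp only [key, mul_sub]
  have hi2 : IntegrableOn
      (fun h => marchaudKernel α h * ∫ t, inner ℝ (v t - v (t - 2 * h)) (w t)) (Ioi 0) := by
    have h2 : IntegrableOn (fun h => 2 ^ (1 - α) * (marchaudKernel α (2 * h)
        * ∫ t, inner ℝ (v t - v (t - 2 * h)) (w t))) (Ioi 0) := by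
      refine Integrable.const_mul ?_ _
      have := (integrableOn_Ioi_comp_mul_left_iff
        (fun h => marchaudKernel α h * ∫ t, inner ℝ (v t - v (t - h)) (w t)) 0
        (a := 2) (by norm_num)).2 (by simpa using hi)
      exact this
    refine h2.congr_fun (fun h hh => ?_) measurableSet_Ioi
    simp only
    rw [marchaudKernel_two_mul hh, mul_assoc, ← mul_assoc, ← Real.rpow_add two_pos]
    simp
  have hi1 : IntegrableOn
      (fun h => marchaudKernel α h * (2 * ∫ t, inner ℝ (v t - v (t - h)) (w t))) (Ioi 0) := by
    refine (hi.const_mul 2).congr (Eventually.of_forall fun h => ?_)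
    simp only
    ring
  rw [integral_sub hi1 hi2, integral_marchaudKernel_mul_comp_two_mul
    (fun h => ∫ t, inner ℝ (v t - v (t - h)) (w t)), sub_mul]
  congr 1
  rw [fracForm, ← integral_const_mul]
  congr 1 with h
  ring

theorem two_sub_two_rpow_pos (hα : -1 < α) : (0 : ℝ) < 2 - 2 ^ (-α) := by
  have : (2 : ℝ) ^ (-α) < 2 ^ (1 : ℝ) :=
    Real.rpow_lt_rpow_of_exponent_lt (by norm_num) (by linarith)
  rw [Real.rpow_one] at this
  linarith

/-- The sector condition of the fractional form, with the second energy weighted by `1/4`. -/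
theorem abs_fracForm_le (hα : -1 < α) (hα' : α < 0) (hv : IsBump T v) (hw : IsBump T w) :
    |fracForm α v w| ≤ fracEnergy α v / (2 - 2 ^ (-α)) ^ 2 + fracEnergy α w / 4 := by
  set c : ℝ := 2 - 2 ^ (-α) with hc
  have hc0 : 0 < c := two_sub_two_rpow_pos hα
  have hE := (hv.integrableOn_energy hα hα').const_mul (1 / c)
  have hE' := (hw.integrableOn_energy hα hα').const_mul (c / 4)
  have hmain : |c * fracForm α v w| ≤ 1 / c * fracEnergy α v + c / 4 * fracEnergy α w := by
    rw [hc, hv.mul_fracForm_eq hα hα' hw, ← hc, ← Real.norm_eq_abs]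
    unfold fracEnergy
    rw [← integral_const_mul, ← integral_const_mul, ← integral_add hE hE']
    refine norm_integral_le_of_norm_le (hE.add hE') ?_
    filter_upwards [ae_restrict_mem measurableSet_Ioi] with h hh
    have hk := marchaudKernel_nonneg hα hα' hh
    have e : ∫ t, ‖w t - w (t - h)‖ ^ 2 = ∫ t, ‖w t - w (t + h)‖ ^ 2 := by
      rw [← integral_add_right_eq_self (fun t => ‖w t - w (t - h)‖ ^ 2) h]
      congr 1 with t
      rw [add_sub_cancel_right, norm_sub_rev]
    have i1 := (hv.integrable_sq_diff h).const_mul (1 / c)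
    have i2 : Integrable fun t => c / 4 * ‖w t - w (t + h)‖ ^ 2 := by
      refine (((hw.integrable_sq_diff h).comp_add_right h).const_mul (c / 4)).congr ?_
      refine Eventually.of_forall fun t => ?_
      simp only [add_sub_cancel_right]
      rw [norm_sub_rev]
    rw [norm_mul, Real.norm_of_nonneg hk]
    calc marchaudKernel α h * ‖∫ t, inner ℝ (v t - v (t - h)) (w t - w (t + h))‖
        ≤ marchaudKernel α h * ∫ t, (1 / c * ‖v t - v (t - h)‖ ^ 2
            + c / 4 * ‖w t - w (t + h)‖ ^ 2) := by
          refine mul_le_mul_of_nonneg_left ?_ hk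
          refine norm_integral_le_of_norm_le (i1.add i2) (Eventually.of_forall fun t => ?_)
          refine (norm_inner_le_norm _ _).trans ?_
          -- Young's inequality, weighted so that the energy of `w` gets the factor `1/4` after the
          -- division by `c`.
          generalize ‖v t - v (t - h)‖ = x
          generalize ‖w t - w (t + h)‖ = y
          have : 1 / c * x ^ 2 + c / 4 * y ^ 2 - x * y = (x / c - y / 2) ^ 2 * c := by
            field_simp
            ring
          have h2 : 0 ≤ (x / c - y / 2) ^ 2 * c := by positivity
          linarith
      _ = _ := by
          rw [integral_add i1 i2, integral_const_mul, integral_const_mul, ← e]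
          ring
  rw [abs_mul, abs_of_pos hc0] at hmain
  have := (le_div_iff₀' hc0).2 hmain
  refine this.trans (le_of_eq ?_)
  field_simp

end IsBump

/-! ### Functions that are absolutely continuous on one subinterval -/

/-- `g` vanishes outside `(a, b)` and is absolutely continuous on `(a, b)`, with derivative `G` and
with the limit `c` at `b`. -/
structure IsACPiece {E : Type*} [NormedAddCommGroup E] [NormedSpace ℝ E] (a b : ℝ) (c : E)
    (G g : ℝ → E) : Prop where
  lt : a < b
  integrable : IntervalIntegrable G volume a b
  eq : ∀ t ∈ Ioo a b, g t = c - ∫ s in t..b, G s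
  supp : ∀ t, t ∉ Ioo a b → g t = 0

theorem integral_sliding_window {Γ : ℝ → ℝ} (hΓ : Integrable Γ) {h : ℝ} (hh : 0 < h) :
    Integrable (fun t => ∫ s in (t - h)..t, Γ s) ∧
      ∫ t, (∫ s in (t - h)..t, Γ s) = h * ∫ s, Γ s := by
  have e : ∀ t, ∫ s in (t - h)..t, Γ s = ∫ s in Ioc 0 h, Γ (t - s) := by
    intro t
    rw [← intervalIntegral.integral_of_le hh.le, intervalIntegral.integral_comp_sub_left]
    simp
  have hi : Integrable (fun p : ℝ × ℝ => Γ (p.1 - p.2))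
      (volume.prod (volume.restrict (Ioc 0 h))) := by
    have hm : AEStronglyMeasurable (fun p : ℝ × ℝ => Γ (p.1 - p.2))
        (volume.prod (volume.restrict (Ioc 0 h))) := by
      refine hΓ.aestronglyMeasurable.comp_quasiMeasurePreserving ?_
      refine (quasiMeasurePreserving_sub volume volume).mono_left ?_
      rw [← Measure.restrict_univ (μ := (volume : Measure ℝ)), Measure.prod_restrict]
      simpa using Measure.absolutelyContinuous_of_le Measure.restrict_le_self
    rw [integrable_prod_iff' hm]
    refine ⟨Eventually.of_forall fun s => hΓ.comp_sub_right s, ?_⟩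
    simp only [integral_sub_right_eq_self (fun t => ‖Γ t‖)]
    exact integrable_const _
  simp only [e]
  refine ⟨hi.integral_prod_left, ?_⟩
  rw [integral_integral_swap hi]
  simp only [integral_sub_right_eq_self Γ]
  simp [hh.le]

namespace IsACPiece

variable {E : Type*} [NormedAddCommGroup E] [NormedSpace ℝ E] {a b : ℝ} {c : E} {G g : ℝ → E}

theorem norm_integral_le (hg : IsACPiece a b c G g) {t r : ℝ} (hat : a ≤ t) (htr : t ≤ r)
    (hrb : r ≤ b) : ‖∫ s in t..r, G s‖ ≤ ∫ s in a..b, ‖G s‖ := by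
  refine (intervalIntegral.norm_integral_le_integral_norm htr).trans ?_
  exact intervalIntegral.integral_mono_interval hat htr hrb
    (Eventually.of_forall fun s => norm_nonneg _) hg.integrable.norm

theorem norm_le (hg : IsACPiece a b c G g) (t : ℝ) : ‖g t‖ ≤ ‖c‖ + ∫ s in a..b, ‖G s‖ := by
  have h0 : 0 ≤ ∫ s in a..b, ‖G s‖ :=
    intervalIntegral.integral_nonneg hg.lt.le fun s _ => norm_nonneg _
  by_cases ht : t ∈ Ioo a b
  · rw [hg.eq t ht]
    refine (norm_sub_le _ _).trans ?_
    gcongr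
    exact hg.norm_integral_le ht.1.le ht.2.le le_rfl
  · rw [hg.supp t ht, norm_zero]
    positivity

theorem stronglyMeasurable (hg : IsACPiece a b c G g) : StronglyMeasurable g := by
  set G' := (Ioc a b).indicator G with hG'
  have hG'i : Integrable G' :=
    ((intervalIntegrable_iff_integrableOn_Ioc_of_le hg.lt.le).1 hg.integrable).integrable_indicator
      measurableSet_Ioc
  have hc : Continuous fun t => c - ∫ s in t..b, G' s := by
    have := intervalIntegral.continuous_primitive (fun x y => hG'i.intervalIntegrable) b
    simp only [intervalIntegral.integral_symm b]
    fun_prop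
  have e : g = (Ioo a b).indicator fun t => c - ∫ s in t..b, G' s := by
    ext t
    by_cases ht : t ∈ Ioo a b
    · rw [indicator_of_mem ht, hg.eq t ht]
      congr 1
      refine intervalIntegral.integral_congr_ae (Eventually.of_forall fun s hs => ?_)
      rw [uIoc_of_le ht.2.le] at hs
      have m : s ∈ Ioc a b := ⟨ht.1.trans hs.1, hs.2⟩
      rw [hG', indicator_of_mem m]
    · rw [indicator_of_notMem ht, hg.supp t ht]
  rw [e]
  exact hc.stronglyMeasurable.indicator measurableSet_Ioo

theorem integrable' (hg : IsACPiece a b c G g) : Integrable g := by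
  have : IntegrableOn g (Ioo a b) :=
    Integrable.of_bound hg.stronglyMeasurable.aestronglyMeasurable _
      (Eventually.of_forall hg.norm_le)
  rwa [integrableOn_iff_integrable_of_support_subset] at this
  intro t ht
  by_contra h
  exact ht (hg.supp t h)

/-- The total variation of a piece, its jumps at `a` and `b` included, is at most twice
`‖c‖ + ∫ ‖G‖`. For `h` beyond the length of the piece, its `L¹` norm gives the bound instead. -/
theorem integral_norm_diff_le (hg : IsACPiece a b c G g) {h : ℝ} (hh : 0 < h) :
    ∫ t, ‖g t - g (t - h)‖ ≤ 2 * (‖c‖ + ∫ s in a..b, ‖G s‖) * min h (b - a) := by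
  set A := ‖c‖ + ∫ s in a..b, ‖G s‖ with hA
  have hA0 : 0 ≤ A := (norm_nonneg _).trans (hg.norm_le a)
  have hab := hg.lt
  have hi := hg.integrable'
  have hid : Integrable fun t => g t - g (t - h) := hi.sub (hi.comp_sub_right h)
  have hwin : ∀ (S : Set ℝ) (d : ℝ), MeasurableSet S → volume S ≠ ⊤ →
      Integrable (indicator S fun _ => d) := fun S d hS hS' =>
    (integrableOn_const hS').integrable_indicator hS
  rcases le_total h (b - a) with hle | hle
  · rw [min_eq_left hle]
    set Γ := (Ioc a b).indicator fun s => ‖G s‖ with hΓ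
    have hΓi : Integrable Γ := ((intervalIntegrable_iff_integrableOn_Ioc_of_le hab.le).1
      hg.integrable.norm).integrable_indicator measurableSet_Ioc
    have hΓ0 : ∀ s, 0 ≤ Γ s := fun s => indicator_nonneg (fun _ _ => norm_nonneg _) s
    have hΓI : ∫ s, Γ s = ∫ s in a..b, ‖G s‖ := by
      rw [hΓ, integral_indicator measurableSet_Ioc, intervalIntegral.integral_of_le hab.le]
    have hle : ∀ t r, a ≤ t → t ≤ r → r ≤ b → ‖∫ s in t..r, G s‖ ≤ ∫ s in t..r, Γ s := by
      intro t r h1 h2 h3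
      refine (intervalIntegral.norm_integral_le_integral_norm h2).trans (le_of_eq ?_)
      refine intervalIntegral.integral_congr_ae (Eventually.of_forall fun s hs => ?_)
      rw [uIoc_of_le h2] at hs
      have m : s ∈ Ioc a b := ⟨h1.trans_lt hs.1, hs.2.trans h3⟩
      rw [hΓ, indicator_of_mem m]
    obtain ⟨hw1, hw2⟩ := integral_sliding_window hΓi hh
    -- The three terms account for the derivative, the jump at `b` and the jump at `a`.
    set B := fun t => (∫ s in (t - h)..t, Γ s) + indicator (Ico b (b + h)) (fun _ => ‖c‖) t
      + indicator (Ioc a (a + h)) (fun _ => A) t with hB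
    have i1 : Integrable (indicator (Ico b (b + h)) fun _ => ‖c‖) :=
      hwin _ _ measurableSet_Ico (by simp)
    have i2 : Integrable (indicator (Ioc a (a + h)) fun _ => A) :=
      hwin _ _ measurableSet_Ioc (by simp)
    have hBI : ∫ t, B t = 2 * A * h := by
      have s1 := integral_add (hw1.add i1) i2
      have s2 := integral_add hw1 i1
      simp only [Pi.add_apply] at s1
      rw [hB, s1, s2, hw2, hΓI,
        integral_indicator measurableSet_Ico, integral_indicator measurableSet_Ioc]
      simp [hh.le]
      rw [hA]
      ring
    rw [← hBI]
    refine integral_mono hid.norm ((hw1.add i1).add i2) fun t => ?_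
    have n1 : 0 ≤ ∫ s in (t - h)..t, Γ s :=
      intervalIntegral.integral_nonneg (by linarith) fun s _ => hΓ0 s
    have n2 : 0 ≤ indicator (Ico b (b + h)) (fun _ => ‖c‖) t :=
      indicator_nonneg (fun _ _ => norm_nonneg _) t
    have n3 : 0 ≤ indicator (Ioc a (a + h)) (fun _ => A) t :=
      indicator_nonneg (fun _ _ => hA0) t
    simp only [hB]
    by_cases ht : t ∈ Ioo a b
    · rcases lt_or_ge a (t - h) with hta | hta
      · have hth : t - h ∈ Ioo a b := ⟨hta, by linarith [ht.2]⟩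
        have e : g t - g (t - h) = ∫ s in (t - h)..t, G s := by
          have s1 : IntervalIntegrable G volume (t - h) t :=
            hg.integrable.mono_set (by
              rw [uIcc_of_le (by linarith), uIcc_of_le hab.le]
              exact Icc_subset_Icc hta.le ht.2.le)
          have s2 : IntervalIntegrable G volume t b :=
            hg.integrable.mono_set (by
              rw [uIcc_of_le ht.2.le, uIcc_of_le hab.le]
              exact Icc_subset_Icc ht.1.le le_rfl)
          rw [hg.eq t ht, hg.eq _ hth, ← intervalIntegral.integral_add_adjacent_intervals s1 s2]
          abel
        have := hle (t - h) t hta.le (by linarith) ht.2.le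
        rw [e]
        linarith
      · have m : t ∈ Ioc a (a + h) := ⟨ht.1, by linarith⟩
        rw [hg.supp (t - h) fun h' => not_lt.2 hta h'.1, sub_zero,
          indicator_of_mem m]
        have := hg.norm_le t
        linarith
    · rw [hg.supp t ht, zero_sub, norm_neg]
      by_cases hth : t - h ∈ Ioo a b
      · have hbt : b ≤ t := by
          by_contra hc
          exact ht ⟨by linarith [hth.1], not_le.1 hc⟩
        have m : t ∈ Ico b (b + h) := ⟨hbt, by linarith [hth.2]⟩
        have h1 := hle (t - h) b hth.1.le hth.2.le le_rfl
        have h2 : ∫ s in (t - h)..b, Γ s ≤ ∫ s in (t - h)..t, Γ s :=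
          intervalIntegral.integral_mono_interval le_rfl hth.2.le hbt
            (Eventually.of_forall hΓ0) hΓi.intervalIntegrable
        rw [hg.eq _ hth, indicator_of_mem m]
        have := norm_sub_le c (∫ s in (t - h)..b, G s)
        linarith
      · rw [hg.supp _ hth, norm_zero]
        positivity
  · rw [min_eq_right hle]
    have h1 : ∫ t, ‖g t‖ ≤ A * (b - a) := by
      have : ∫ t, indicator (Ioc a b) (fun _ => A) t = A * (b - a) := by
        rw [integral_indicator measurableSet_Ioc]
        simp [hab.le, mul_comm]
      rw [← this]
      refine integral_mono hi.norm (hwin _ _ measurableSet_Ioc (by simp)) fun t => ?_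
      by_cases ht : t ∈ Ioo a b
      · have m : t ∈ Ioc a b := ⟨ht.1, ht.2.le⟩
        rw [indicator_of_mem m]
        exact hg.norm_le t
      · rw [hg.supp t ht, norm_zero]
        exact indicator_nonneg (fun _ _ => hA0) t
    have h2 : ∫ t, ‖g t - g (t - h)‖ ≤ (∫ t, ‖g t‖) + ∫ t, ‖g t‖ := by
      nth_rewrite 2 [← integral_sub_right_eq_self (fun t => ‖g t‖) h]
      have i1 := hi.norm
      have i2 := (hi.comp_sub_right h).norm
      rw [← integral_add i1 i2]
      exact integral_mono hid.norm (i1.add i2) fun t => norm_sub_le _ _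
    linarith

theorem isBump (hg : IsACPiece a b c G g) {T : ℝ} (ha : 0 ≤ a) (hb : b ≤ T) : IsBump T g where
  meas := hg.stronglyMeasurable
  supp t ht := hg.supp t fun h => ht ⟨ha.trans_lt h.1, h.2.trans_le hb⟩
  bdd := ⟨_, hg.norm_le⟩
  var := by
    refine ⟨_, fun h hh => (hg.integral_norm_diff_le hh).trans
      (mul_le_mul_of_nonneg_left (min_le_left _ _) ?_)⟩
    exact mul_nonneg zero_le_two ((norm_nonneg _).trans (hg.norm_le a))

/-- One factor of the squared difference is bounded by the maximum of the piece, the other by its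
variation; the kernel then integrates `min(h, b - a)` to a multiple of `(b - a)^(α+1)`. -/
theorem fracEnergy_le (hg : IsACPiece a b c G g) (ha : 0 ≤ a) {α : ℝ} (hα : -1 < α)
    (hα' : α < 0) :
    fracEnergy α g
      ≤ 4 * marchaudConst α * (b - a) ^ (α + 1) * (‖c‖ + ∫ s in a..b, ‖G s‖) ^ 2 := by
  have hbump := hg.isBump ha le_rfl
  set A := ‖c‖ + ∫ s in a..b, ‖G s‖ with hA
  have hA0 : 0 ≤ A := (norm_nonneg _).trans (hg.norm_le a)
  obtain ⟨k1, k2⟩ := integrableOn_marchaudKernel_mul_min hα hα' (sub_pos.2 hg.lt)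
  have e : 4 * marchaudConst α * (b - a) ^ (α + 1) * A ^ 2
      = ∫ h in Ioi (0 : ℝ), 4 * A ^ 2 * (marchaudKernel α h * min h (b - a)) := by
    rw [integral_const_mul, k2]
    ring
  rw [e]
  refine setIntegral_mono_on (hbump.integrableOn_energy hα hα') (k1.const_mul _) measurableSet_Ioi
    fun h hh => ?_
  have h1 : ∫ t, ‖g t - g (t - h)‖ ^ 2 ≤ 2 * A * (2 * A * min h (b - a)) := by
    refine le_trans ?_ (mul_le_mul_of_nonneg_left (hg.integral_norm_diff_le hh) (by positivity))
    rw [← integral_const_mul]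
    refine integral_mono (hbump.integrable_sq_diff h)
      ((hbump.integrable_diff h).norm.const_mul _) fun t => ?_
    simp only
    rw [sq]
    gcongr
    have := norm_sub_le (g t) (g (t - h))
    linarith [hg.norm_le t, hg.norm_le (t - h)]
  calc _ ≤ marchaudKernel α h * (2 * A * (2 * A * min h (b - a))) :=
        mul_le_mul_of_nonneg_left h1 (marchaudKernel_nonneg hα hα' hh)
    _ = _ := by ring

end IsACPiece

/-- For functions with disjoint supports at most two of the differences `g i t - g i s` do not
vanish. -/
theorem sq_norm_sum_diff_le {F ι : Type*} [NormedAddCommGroup F] (S : Finset ι) (g : ι → ℝ → F)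
    (hg : ∀ t, ∀ i ∈ S, ∀ j ∈ S, g i t ≠ 0 → g j t ≠ 0 → i = j) (t s : ℝ) :
    ‖∑ i ∈ S, g i t - ∑ i ∈ S, g i s‖ ^ 2 ≤ 2 * ∑ i ∈ S, ‖g i t - g i s‖ ^ 2 := by
  classical
  rw [← Finset.sum_sub_distrib]
  set R := S.filter fun i => g i t ≠ 0 ∨ g i s ≠ 0 with hR
  have hcard : R.card ≤ 2 := by
    rw [hR, Finset.filter_or]
    refine (Finset.card_union_le _ _).trans ?_
    have : ∀ t, (S.filter fun i => g i t ≠ 0).card ≤ 1 := fun t => by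
      rw [Finset.card_le_one]
      intro i hi j hj
      rw [Finset.mem_filter] at hi hj
      exact hg t i hi.1 j hj.1 hi.2 hj.2
    exact add_le_add (this t) (this s)
  have e1 : ∑ i ∈ S, (g i t - g i s) = ∑ i ∈ R, (g i t - g i s) := by
    refine (Finset.sum_filter_of_ne fun i _ hi => ?_).symm
    by_contra h
    push Not at h
    exact hi (by rw [h.1, h.2, sub_zero])
  rw [e1]
  calc ‖∑ i ∈ R, (g i t - g i s)‖ ^ 2 ≤ (∑ i ∈ R, ‖g i t - g i s‖) ^ 2 := by
        gcongr
        exact norm_sum_le _ _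
    _ ≤ R.card * ∑ i ∈ R, ‖g i t - g i s‖ ^ 2 := sq_sum_le_card_mul_sum_sq
    _ ≤ 2 * ∑ i ∈ S, ‖g i t - g i s‖ ^ 2 := by
        gcongr
        · exact_mod_cast hcard
        · exact Finset.filter_subset _ _

/-- The energy is additive over disjoint supports up to a factor, however the supports are
placed. -/
theorem fracEnergy_sum_le {F ι : Type*} [NormedAddCommGroup F] {α T : ℝ} (hα : -1 < α)
    (hα' : α < 0) (S : Finset ι) (g : ι → ℝ → F) (hb : ∀ i ∈ S, IsBump T (g i))
    (hg : ∀ t, ∀ i ∈ S, ∀ j ∈ S, g i t ≠ 0 → g j t ≠ 0 → i = j) :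
    fracEnergy α (fun t => ∑ i ∈ S, g i t) ≤ 2 * ∑ i ∈ S, fracEnergy α (g i) := by
  unfold fracEnergy
  rw [← integral_finsetSum _ fun i hi => (hb i hi).integrableOn_energy hα hα',
    ← integral_const_mul]
  refine setIntegral_mono_on ((IsBump.sum S hb).integrableOn_energy hα hα')
    ((integrable_finsetSum _ fun i hi => (hb i hi).integrableOn_energy hα hα').const_mul _)
    measurableSet_Ioi fun h hh => ?_
  rw [← Finset.mul_sum, mul_left_comm]
  refine mul_le_mul_of_nonneg_left ?_ (marchaudKernel_nonneg hα hα' hh)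
  rw [← integral_finsetSum _ fun i hi => (hb i hi).integrable_sq_diff h, ← integral_const_mul]
  exact integral_mono ((IsBump.sum S hb).integrable_sq_diff h)
    ((integrable_finsetSum _ fun i hi => (hb i hi).integrable_sq_diff h).const_mul _)
    fun t => sq_norm_sum_diff_le S g hg t (t - h)

/-! ### Polynomials in time -/

namespace IsPoly

variable {E : Type*} [NormedAddCommGroup E] [NormedSpace ℝ E] {p : ℕ} {X Y : ℝ → E}

theorem continuous (hX : IsPoly p X) : Continuous X := by
  obtain ⟨c, hc⟩ := hX
  have : X = fun t => ∑ i ∈ Finset.range (p + 1), t ^ i • c i := funext hc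
  rw [this]
  fun_prop

theorem sub (hX : IsPoly p X) (hY : IsPoly p Y) : IsPoly p (fun t => X t - Y t) := by
  obtain ⟨c, hc⟩ := hX
  obtain ⟨d, hd⟩ := hY
  refine ⟨fun i => c i - d i, fun t => ?_⟩
  simp only [hc, hd, smul_sub, Finset.sum_sub_distrib]

theorem clm {G : Type*} [NormedAddCommGroup G] [NormedSpace ℝ G] (hX : IsPoly p X)
    (L : E →L[ℝ] G) : IsPoly p (fun t => L (X t)) := by
  obtain ⟨c, hc⟩ := hX
  refine ⟨fun i => L (c i), fun t => ?_⟩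
  simp only [hc, map_sum, map_smul]

/-- The derivative of a polynomial of degree at most `p` has degree at most `p - 1`. -/
theorem exists_hasDerivAt (hp : 1 ≤ p) (hX : IsPoly p X) :
    ∃ X' : ℝ → E, IsPoly (p - 1) X' ∧ ∀ t, HasDerivAt X (X' t) t := by
  obtain ⟨c, hc⟩ := hX
  refine ⟨_, ⟨fun i => ((i : ℝ) + 1) • c (i + 1), fun t => rfl⟩, fun t => ?_⟩
  have e : X = fun t => ∑ i ∈ Finset.range (p + 1), t ^ i • c i := funext hc
  rw [e, Nat.sub_add_cancel hp]
  have h : HasDerivAt (fun t : ℝ => ∑ i ∈ Finset.range (p + 1), t ^ i • c i)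
      (∑ i ∈ Finset.range (p + 1), ((i : ℝ) * t ^ (i - 1)) • c i) t :=
    HasDerivAt.fun_sum fun i _ => (hasDerivAt_pow i t).smul_const (c i)
  rw [Finset.sum_range_succ'] at h
  simp only [Nat.cast_zero, zero_mul, zero_smul, add_zero, Nat.add_sub_cancel] at h
  convert h using 2 with i
  rw [smul_smul, mul_comm]
  push_cast
  rfl

end IsPoly

/-! ### The inverse inequality -/

section inverse

open Polynomial

variable (p : ℕ) (a b : ℝ)

/-- The polynomial `(X - a)^(p+1) (X - b)^p`. Its derivative of order `p + 1` represents, up to a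
factor, the evaluation at `b` on polynomials of degree at most `p`. -/
noncomputable def radauPoly : ℝ[X] := (X - C a) ^ (p + 1) * (X - C b) ^ p

theorem eval_iterate_derivative (f : ℝ[X]) (m : ℕ) (x : ℝ) :
    (derivative^[m] f).eval x = m.factorial * (taylor x f).coeff m := by
  rw [taylor_coeff, ← Polynomial.factorial_smul_hasseDeriv]
  simp

theorem taylor_left_radauPoly :
    taylor a (radauPoly p a b) = (X + C (a - b)) ^ p * X ^ (p + 1) := by
  simp only [radauPoly, taylor_mul, taylor_pow, map_sub, taylor_X, taylor_C]
  ring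

theorem taylor_right_radauPoly :
    taylor b (radauPoly p a b) = (X + C (b - a)) ^ (p + 1) * X ^ p := by
  simp only [radauPoly, taylor_mul, taylor_pow, map_sub, taylor_X, taylor_C]
  ring

theorem integral_derivative_mul (f g : ℝ[X]) :
    ∫ t in a..b, (derivative f).eval t * g.eval t
      = f.eval b * g.eval b - f.eval a * g.eval a
        - ∫ t in a..b, f.eval t * (derivative g).eval t := by
  rw [eq_sub_iff_add_eq, ← intervalIntegral.integral_add
    (Continuous.intervalIntegrable (by fun_prop) _ _)
    (Continuous.intervalIntegrable (by fun_prop) _ _)]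
  exact intervalIntegral.integral_deriv_mul_eq_sub (fun t _ => f.hasDerivAt t)
    (fun t _ => g.hasDerivAt t) (Continuous.intervalIntegrable (by fun_prop) _ _)
    (Continuous.intervalIntegrable (by fun_prop) _ _)

variable {p a b}

theorem eval_left_radauPoly {m : ℕ} (hm : m ≤ p) :
    (derivative^[m] (radauPoly p a b)).eval a = 0 := by
  rw [eval_iterate_derivative, taylor_left_radauPoly, coeff_mul_X_pow', if_neg (by omega),
    mul_zero]

theorem eval_right_radauPoly {m : ℕ} (hm : m < p) :
    (derivative^[m] (radauPoly p a b)).eval b = 0 := by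
  rw [eval_iterate_derivative, taylor_right_radauPoly, coeff_mul_X_pow', if_neg (by omega),
    mul_zero]

theorem integral_iterate_derivative_radauPoly_mul {m : ℕ} (hm : m ≤ p) (R : ℝ[X]) :
    ∫ t in a..b, (derivative^[m] (radauPoly p a b)).eval t * R.eval t
      = (-1) ^ m * ∫ t in a..b, (radauPoly p a b).eval t * (derivative^[m] R).eval t := by
  induction m generalizing R with
  | zero => simp
  | succ m ih =>
    rw [Function.iterate_succ_apply' derivative m (radauPoly p a b), integral_derivative_mul,
      eval_left_radauPoly (by omega), eval_right_radauPoly (by omega), ih (by omega),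
      Function.iterate_succ_apply]
    ring

/-- Evaluation at the end point `b` is represented on the polynomials of degree at most `p` by a
polynomial `ρ` of degree at most `p` whose square has the integral `(p+1)² / (b - a)`. The end
points need not be in increasing order. -/
theorem exists_endpoint_representer (p : ℕ) {a b : ℝ} (hab : a ≠ b) :
    ∃ ρ : ℝ[X], (∀ R : ℝ[X], R.natDegree ≤ p → ∫ t in a..b, ρ.eval t * R.eval t = R.eval b) ∧
      ∫ t in a..b, ρ.eval t * ρ.eval t = ((p : ℝ) + 1) ^ 2 / (b - a) := by
  set Q := radauPoly p a b with hQ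
  have hba : b - a ≠ 0 := sub_ne_zero.2 hab.symm
  have hfac : (p.factorial : ℝ) ≠ 0 := by positivity
  set κ : ℝ := (p.factorial * (b - a) ^ (p + 1))⁻¹ with hκ
  have hκ0 : (p.factorial * (b - a) ^ (p + 1) : ℝ) ≠ 0 := mul_ne_zero hfac (pow_ne_zero _ hba)
  have hdeg : (C κ * derivative^[p + 1] Q).natDegree ≤ p := by
    refine (natDegree_C_mul_le _ _).trans ((natDegree_iterate_derivative _ _).trans ?_)
    have : Q.natDegree ≤ (p + 1) + p := by
      refine natDegree_mul_le.trans (add_le_add ?_ ?_)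
      · exact natDegree_pow_le.trans (by rw [natDegree_X_sub_C, mul_one])
      · exact natDegree_pow_le.trans (by rw [natDegree_X_sub_C, mul_one])
    omega
  have hp0 : (derivative^[p] Q).eval b = p.factorial * (b - a) ^ (p + 1) := by
    rw [hQ, eval_iterate_derivative, taylor_right_radauPoly, coeff_mul_X_pow', if_pos le_rfl,
      Nat.sub_self, coeff_X_add_C_pow]
    simp
  have hp1 : (derivative^[p + 1] Q).eval b
      = (p + 1).factorial * ((b - a) ^ p * (p + 1)) := by
    rw [hQ, eval_iterate_derivative, taylor_right_radauPoly, coeff_mul_X_pow',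
      if_pos (Nat.le_succ p), Nat.add_sub_cancel_left, coeff_X_add_C_pow]
    simp
  have hrep : ∀ R : ℝ[X], R.natDegree ≤ p →
      ∫ t in a..b, (C κ * derivative^[p + 1] Q).eval t * R.eval t = R.eval b := by
    intro R hR
    simp only [eval_mul, eval_C, mul_assoc]
    rw [intervalIntegral.integral_const_mul, Function.iterate_succ_apply',
      integral_derivative_mul, hQ, integral_iterate_derivative_radauPoly_mul le_rfl,
      eval_left_radauPoly le_rfl, ← Function.iterate_succ_apply,
      iterate_derivative_eq_zero (p := R) (Nat.lt_succ_of_le hR), ← hQ, hp0]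
    simp only [eval_zero, mul_zero, zero_mul, intervalIntegral.integral_zero, sub_zero]
    rw [← mul_assoc, hκ, inv_mul_cancel₀ hκ0, one_mul]
  refine ⟨_, hrep, ?_⟩
  rw [hrep _ hdeg, eval_mul, eval_C, hp1, hκ, Nat.factorial_succ]
  push_cast
  field_simp
  ring

variable {F : Type*} [NormedAddCommGroup F] [InnerProductSpace ℝ F] {q : ℝ → F}

theorem integral_eval_mul_inner {ρ : ℝ[X]}
    (hρ : ∀ R : ℝ[X], R.natDegree ≤ p → ∫ t in a..b, ρ.eval t * R.eval t = R.eval b)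
    (hq : IsPoly p q) (x : F) :
    ∫ t in a..b, ρ.eval t * inner ℝ (q t) x = inner ℝ (q b) x := by
  obtain ⟨c, hc⟩ := hq
  set R : ℝ[X] := ∑ i ∈ Finset.range (p + 1), C (inner ℝ (c i) x) * X ^ i with hR
  have e : ∀ t, inner ℝ (q t) x = R.eval t := by
    intro t
    rw [hc, sum_inner, hR, eval_finsetSum]
    refine Finset.sum_congr rfl fun i _ => ?_
    rw [real_inner_smul_left]
    rw [eval_mul, eval_C, eval_pow, eval_X, mul_comm]
  simp only [e]
  refine hρ R (natDegree_sum_le_of_forall_le _ _ fun i hi => ?_)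
  exact (natDegree_C_mul_X_pow_le _ _).trans (Nat.lt_succ_iff.1 (Finset.mem_range.1 hi))

/-- Young's inequality under the integral, with the weight that balances the two terms. -/
theorem sq_norm_le_of_representer {ρ : ℝ → ℝ} (hρ : Continuous ρ) (hq : Continuous q)
    (hab : a < b) {M : ℝ} (hM : 0 < M) (hρM : ∫ t in a..b, ρ t * ρ t = M) {x : F}
    (hx : ∫ t in a..b, ρ t * inner ℝ (q t) x = inner ℝ x x) :
    ‖x‖ ^ 2 ≤ M * ∫ t in a..b, ‖q t‖ ^ 2 := by
  have h : ∫ t in a..b, ρ t * inner ℝ (q t) x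
      ≤ ∫ t in a..b, (M / 2 * ‖q t‖ ^ 2 + ‖x‖ ^ 2 / (2 * M) * (ρ t * ρ t)) := by
    refine intervalIntegral.integral_mono_on hab.le
      (Continuous.intervalIntegrable (by fun_prop) _ _)
      (Continuous.intervalIntegrable (by fun_prop) _ _) fun t _ => ?_
    have h1 : ρ t * inner ℝ (q t) x ≤ |ρ t| * (‖q t‖ * ‖x‖) := by
      refine (le_abs_self _).trans ?_
      rw [abs_mul]
      gcongr
      exact abs_real_inner_le_norm _ _
    refine h1.trans ?_
    rw [← abs_mul_abs_self (ρ t)]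
    have h2 : M / 2 * ‖q t‖ ^ 2 + ‖x‖ ^ 2 / (2 * M) * (|ρ t| * |ρ t|) - |ρ t| * (‖q t‖ * ‖x‖)
        = (M * ‖q t‖ - ‖x‖ * |ρ t|) ^ 2 / (2 * M) := by
      field_simp
      ring
    have h3 : 0 ≤ (M * ‖q t‖ - ‖x‖ * |ρ t|) ^ 2 / (2 * M) := by positivity
    linarith
  rw [hx, real_inner_self_eq_norm_sq, intervalIntegral.integral_add
    (Continuous.intervalIntegrable (by fun_prop) _ _)
    (Continuous.intervalIntegrable (by fun_prop) _ _), intervalIntegral.integral_const_mul,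
    intervalIntegral.integral_const_mul, hρM] at h
  have : ‖x‖ ^ 2 / (2 * M) * M = ‖x‖ ^ 2 / 2 := by field_simp
  rw [this] at h
  linarith

theorem IsPoly.sq_norm_right_le (hq : IsPoly p q) (hab : a < b) :
    ‖q b‖ ^ 2 ≤ ((p : ℝ) + 1) ^ 2 / (b - a) * ∫ t in a..b, ‖q t‖ ^ 2 := by
  obtain ⟨ρ, h1, h2⟩ := exists_endpoint_representer p hab.ne
  have : 0 < b - a := sub_pos.2 hab
  exact sq_norm_le_of_representer (ρ := fun t => ρ.eval t) (by fun_prop) hq.continuous hab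
    (by positivity) h2 (integral_eval_mul_inner h1 hq (q b))

theorem IsPoly.sq_norm_left_le (hq : IsPoly p q) (hab : a < b) :
    ‖q a‖ ^ 2 ≤ ((p : ℝ) + 1) ^ 2 / (b - a) * ∫ t in a..b, ‖q t‖ ^ 2 := by
  obtain ⟨ρ, h1, h2⟩ := exists_endpoint_representer p hab.ne'
  have hpos : 0 < b - a := sub_pos.2 hab
  refine sq_norm_le_of_representer (ρ := fun t => -ρ.eval t) (by fun_prop) hq.continuous hab
    (by positivity) ?_ ?_
  · simp only [neg_mul_neg]
    rw [intervalIntegral.integral_symm, h2, ← neg_sub b a, div_neg, neg_neg]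
  · simp only [neg_mul]
    rw [intervalIntegral.integral_neg, ← intervalIntegral.integral_symm]
    exact integral_eval_mul_inner h1 hq (q a)

/-- The inverse inequality between the maximum and the mean square of a polynomial. -/
theorem IsPoly.sq_norm_le (hq : IsPoly p q) (hab : a < b) {t : ℝ} (ht : t ∈ Icc a b) :
    ‖q t‖ ^ 2 ≤ 2 * ((p : ℝ) + 1) ^ 2 / (b - a) * ∫ s in a..b, ‖q s‖ ^ 2 := by
  have hpos : 0 < b - a := sub_pos.2 hab
  have hc := hq.continuous
  have hi : ∀ x y : ℝ, IntervalIntegrable (fun s => ‖q s‖ ^ 2) volume x y := fun x y =>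
    Continuous.intervalIntegrable (by fun_prop) _ _
  have mono : ∀ x y : ℝ, a ≤ x → x ≤ y → y ≤ b →
      ∫ s in x..y, ‖q s‖ ^ 2 ≤ ∫ s in a..b, ‖q s‖ ^ 2 := fun x y h1 h2 h3 =>
    intervalIntegral.integral_mono_interval h1 h2 h3
      (Eventually.of_forall fun s => by positivity) (hi a b)
  have coef : ∀ d : ℝ, (b - a) / 2 ≤ d →
      ((p : ℝ) + 1) ^ 2 / d ≤ 2 * ((p : ℝ) + 1) ^ 2 / (b - a) := by
    intro d hd
    rw [div_le_div_iff₀ (by linarith) hpos]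
    have : 0 ≤ ((p : ℝ) + 1) ^ 2 := by positivity
    nlinarith
  -- The end point inequality is applied on the longer of the two parts into which `t` divides
  -- the interval.
  rcases le_total ((b - a) / 2) (t - a) with h | h
  · refine (hq.sq_norm_right_le (a := a) (by linarith)).trans ?_
    exact mul_le_mul (coef _ h) (mono _ _ le_rfl ht.1 ht.2)
      (intervalIntegral.integral_nonneg ht.1 fun s _ => by positivity) (by positivity)
  · have h' : (b - a) / 2 ≤ b - t := by linarith
    refine (hq.sq_norm_left_le (b := b) (by linarith)).trans ?_
    exact mul_le_mul (coef _ h') (mono _ _ ht.1 ht.2 le_rfl)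
      (intervalIntegral.integral_nonneg ht.2 fun s _ => by positivity) (by positivity)

/-- A polynomial of degree at most one is bounded by its values at the end points. -/
theorem IsPoly.norm_le_max_of_degree_one (hq : IsPoly 1 q) {t : ℝ} (ht : t ∈ Icc a b) :
    ‖q t‖ ≤ max ‖q a‖ ‖q b‖ := by
  obtain ⟨c, hc⟩ := hq
  have hcv : ConvexOn ℝ univ fun t => ‖q t‖ := by
    refine ⟨convex_univ, fun x _ y _ r s hr hs hrs => ?_⟩
    have e : q (r • x + s • y) = r • q x + s • q y := by
      simp only [hc, Finset.sum_range_succ, Finset.sum_range_zero, zero_add, pow_zero, pow_one,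
        one_smul, smul_eq_mul, smul_add, add_smul, mul_smul]
      have : c 0 = r • c 0 + s • c 0 := by rw [← add_smul, hrs, one_smul]
      nth_rewrite 1 [this]
      abel
    simp only [e]
    refine (norm_add_le _ _).trans ?_
    rw [norm_smul, norm_smul, Real.norm_of_nonneg hr, Real.norm_of_nonneg hs]
    rfl
  exact hcv.le_max_of_mem_Icc (mem_univ a) (mem_univ b) ht

end inverse

/-! ### The space `H¹₀(Ω)` -/

section poincare

open scoped Distributions

variable {d : ℕ} {Ω : TopologicalSpace.Opens (EuclideanSpace ℝ (Fin d))}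

/-- The embedding `H¹₀(Ω) → L²(Ω)` as a continuous linear map. -/
noncomputable def toL2CLM (Ω : TopologicalSpace.Opens (EuclideanSpace ℝ (Fin d))) :
    H10 Ω →L[ℝ] L2 Ω :=
  (WithLp.fstL 2 ℝ (L2 Ω) (L2Vec Ω)).comp (H10 Ω).subtypeL

/-- The weak gradient `H¹₀(Ω) → L²(Ω; ℝᵈ)` as a continuous linear map. -/
noncomputable def gradCLM (Ω : TopologicalSpace.Opens (EuclideanSpace ℝ (Fin d))) :
    H10 Ω →L[ℝ] L2Vec Ω :=
  (WithLp.sndL 2 ℝ (L2 Ω) (L2Vec Ω)).comp (H10 Ω).subtypeL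

theorem toL2CLM_apply (v : H10 Ω) : toL2CLM Ω v = toL2 v := rfl

theorem gradCLM_apply (v : H10 Ω) : gradCLM Ω v = grad v := rfl

theorem norm_toL2_le (v : H10 Ω) : ‖toL2 v‖ ≤ ‖v‖ :=
  WithLp.norm_fst_le _ (v : WithLp 2 (L2 Ω × L2Vec Ω))

theorem norm_grad_le (v : H10 Ω) : ‖grad v‖ ≤ ‖v‖ :=
  WithLp.norm_snd_le _ (v : WithLp 2 (L2 Ω × L2Vec Ω))

/-- The Poincaré inequality for a test function, by integrating `φ² = φ² ∂₁x₁` by parts. -/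
theorem integral_sq_le_of_testFunction (hd : 1 ≤ d) {R : ℝ}
    (hR : ∀ x ∈ Ω, ‖x‖ ≤ R) (φ : 𝓓(Ω, ℝ)) :
    ∫ x, φ x ^ 2 ≤ 4 * R ^ 2 * ∫ x, ‖gradient φ x‖ ^ 2 := by
  set i : Fin d := ⟨0, hd⟩
  set e : EuclideanSpace ℝ (Fin d) := EuclideanSpace.single i 1 with he
  have hdiff : Differentiable ℝ φ := φ.contDiff.differentiable (by simp)
  have hcs := φ.hasCompactSupport
  have hfd : Continuous (fderiv ℝ φ) := φ.contDiff.continuous_fderiv (by simp)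
  have hcsd : HasCompactSupport (fderiv ℝ φ) := hcs.fderiv ℝ
  set g : EuclideanSpace ℝ (Fin d) → ℝ := fun x => x i with hg
  have hgd : ∀ x, HasFDerivAt g (EuclideanSpace.proj i : EuclideanSpace ℝ (Fin d) →L[ℝ] ℝ) x :=
    fun x => (EuclideanSpace.proj i : EuclideanSpace ℝ (Fin d) →L[ℝ] ℝ).hasFDerivAt
  have hfd2 : ∀ x, fderiv ℝ (fun x => φ x ^ 2) x e = 2 * φ x * fderiv ℝ φ x e := by
    intro x
    rw [((hdiff x).hasFDerivAt.pow 2).fderiv]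
    simp
  have hge : ∀ x, fderiv ℝ g x e = 1 := by
    intro x
    rw [(hgd x).fderiv]
    simp [he]
  have hgc : Continuous g := by fun_prop
  have hsq : Integrable fun x => φ x ^ 2 :=
    Continuous.integrable_of_hasCompactSupport (by fun_prop)
      (hcs.comp_left (g := fun y => y ^ 2) (by simp))
  have hgrad : ∀ x, ‖gradient φ x‖ = ‖fderiv ℝ φ x‖ := fun x => by simp [gradient]
  have hgs : Integrable fun x => ‖gradient φ x‖ ^ 2 := by
    simp only [hgrad]
    exact Continuous.integrable_of_hasCompactSupport (by fun_prop)
      (hcsd.comp_left (g := fun y => ‖y‖ ^ 2) (by simp))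
  have hparts := integral_mul_fderiv_eq_neg_fderiv_mul_of_integrable (μ := volume) (f := g)
    (g := fun x => φ x ^ 2) (v := e) (by simpa only [hge, one_mul] using hsq)
    (by
      simp only [hfd2]
      refine Continuous.integrable_of_hasCompactSupport (by fun_prop) ?_
      exact ((hcs.mul_left (f := fun _ => (2 : ℝ))).mul_right).mul_left)
    (Continuous.integrable_of_hasCompactSupport (by fun_prop)
      ((hcs.comp_left (g := fun y => y ^ 2) (by simp)).mul_left))
    (fun x _ => (hgd x).differentiableAt) (fun x _ => (hdiff x).pow 2)
  simp only [hge, one_mul, hfd2] at hparts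
  have hle : ∫ x, φ x ^ 2 ≤ ∫ x, (φ x ^ 2 / 2 + 2 * R ^ 2 * ‖gradient φ x‖ ^ 2) := by
    have hpt : ∀ x, -(g x * (2 * φ x * fderiv ℝ φ x e))
        ≤ φ x ^ 2 / 2 + 2 * R ^ 2 * ‖gradient φ x‖ ^ 2 := by
      intro x
      by_cases hx : x ∈ tsupport φ
      · have h1 : |g x| ≤ R := (PiLp.norm_apply_le x i).trans (hR x (φ.tsupport_subset hx))
        have h2 : |fderiv ℝ φ x e| ≤ ‖gradient φ x‖ := by
          rw [hgrad]
          refine ((fderiv ℝ φ x).le_opNorm e).trans (le_of_eq ?_)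
          simp [he]
        have h3 : |g x * fderiv ℝ φ x e| ≤ R * ‖gradient φ x‖ := by
          rw [abs_mul]
          exact mul_le_mul h1 h2 (abs_nonneg _) ((abs_nonneg _).trans h1)
        have h4 : (g x * fderiv ℝ φ x e) ^ 2 ≤ (R * ‖gradient φ x‖) ^ 2 := sq_le_sq' (by
          linarith [neg_abs_le (g x * fderiv ℝ φ x e)]) ((le_abs_self _).trans h3)
        nlinarith [sq_nonneg (φ x + 2 * (g x * fderiv ℝ φ x e))]
      · rw [image_eq_zero_of_notMem_tsupport hx]
        simp only [mul_zero, zero_mul, neg_zero, ne_eq, OfNat.ofNat_ne_zero, not_false_eq_true,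
          zero_pow, zero_div, zero_add]
        positivity
    have hint : Integrable fun x => -(g x * (2 * φ x * fderiv ℝ φ x e)) := by
      refine Continuous.integrable_of_hasCompactSupport (by fun_prop) ?_
      exact ((hcs.mul_left (f := fun _ => (2 : ℝ))).mul_right).mul_left.neg
    calc ∫ x, φ x ^ 2 = ∫ x, -(g x * (2 * φ x * fderiv ℝ φ x e)) := by
          rw [integral_neg, hparts, neg_neg]
      _ ≤ _ := integral_mono hint ((hsq.div_const 2).add (hgs.const_mul _)) hpt
  rw [integral_add (hsq.div_const 2) (hgs.const_mul _), integral_div, integral_const_mul] at hle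
  linarith

/-- The Poincaré inequality on a bounded open set. -/
theorem exists_poincare (hd : 1 ≤ d)
    (hΩ : Bornology.IsBounded (Ω : Set (EuclideanSpace ℝ (Fin d)))) :
    ∃ R : ℝ, 0 < R ∧ ∀ v : H10 Ω, ‖toL2 v‖ ≤ R * ‖grad v‖ := by
  obtain ⟨R, hR0, hR⟩ := hΩ.exists_pos_norm_le
  refine ⟨2 * R, by positivity, fun v => ?_⟩
  have hclosed : IsClosed {x : WithLp 2 (L2 Ω × L2Vec Ω) | ‖x.fst‖ ≤ 2 * R * ‖x.snd‖} :=
    isClosed_le (by fun_prop) (by fun_prop)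
  refine closure_minimal ?_ hclosed v.2
  rintro x ⟨φ, h1, h2⟩
  have hsub : ∀ x, x ∉ Ω → φ x = 0 ∧ gradient φ x = 0 := by
    intro x hx
    have hx' : x ∉ tsupport φ := fun h => hx (φ.tsupport_subset h)
    refine ⟨image_eq_zero_of_notMem_tsupport hx', ?_⟩
    rw [gradient, fderiv_of_notMem_tsupport ℝ hx', map_zero]
  have e1 : ‖x.fst‖ ^ 2 = ∫ y, φ y ^ 2 := by
    rw [← real_inner_self_eq_norm_sq, MeasureTheory.L2.inner_def,
      ← setIntegral_eq_integral_of_forall_compl_eq_zero (s := (Ω : Set _))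
        (f := fun y => φ y ^ 2) (fun y hy => by rw [(hsub y hy).1]; simp)]
    refine integral_congr_ae ?_
    filter_upwards [h1] with y hy
    rw [hy, real_inner_self_eq_norm_sq, Real.norm_eq_abs, sq_abs]
  have e2 : ‖x.snd‖ ^ 2 = ∫ y, ‖gradient φ y‖ ^ 2 := by
    rw [← real_inner_self_eq_norm_sq, MeasureTheory.L2.inner_def,
      ← setIntegral_eq_integral_of_forall_compl_eq_zero (s := (Ω : Set _))
        (f := fun y => ‖gradient φ y‖ ^ 2) (fun y hy => by rw [(hsub y hy).2]; simp)]
    refine integral_congr_ae ?_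
    filter_upwards [h2] with y hy
    rw [hy, real_inner_self_eq_norm_sq]
  have := integral_sq_le_of_testFunction hd hR φ
  rw [← e1, ← e2] at this
  change ‖x.fst‖ ≤ 2 * R * ‖x.snd‖
  rw [← sq_le_sq₀ (norm_nonneg _) (by positivity)]
  calc _ ≤ _ := this
    _ = _ := by ring

end poincare

/-! ### Piecewise absolutely continuous functions on a time mesh -/

namespace TimeMesh

variable {T : ℝ} (M : TimeMesh T)

theorem mem_idx {j : ℕ} : j ∈ M.idx ↔ 1 ≤ j ∧ j ≤ M.N := Finset.mem_Icc

theorem t_mono {i j : ℕ} (hij : i ≤ j) (hj : j ≤ M.N) : M.t i ≤ M.t j := by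
  induction j, hij using Nat.le_induction with
  | base => exact le_rfl
  | succ j _ ih => exact (ih (by omega)).trans (M.t_lt j (by omega)).le

theorem t_nonneg {j : ℕ} (hj : j ≤ M.N) : 0 ≤ M.t j := by
  simpa [M.t_zero] using M.t_mono (Nat.zero_le j) hj

theorem t_le {j : ℕ} (hj : j ≤ M.N) : M.t j ≤ T := by
  simpa [M.t_last] using M.t_mono hj le_rfl

theorem t_pred_lt {j : ℕ} (hj : j ∈ M.idx) : M.t (j - 1) < M.t j := by
  rw [mem_idx] at hj
  have := M.t_lt (j - 1) (by omega)
  rwa [Nat.sub_add_cancel hj.1] at this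

theorem k_pos {j : ℕ} (hj : j ∈ M.idx) : 0 < M.k j := sub_pos.2 (M.t_pred_lt hj)

theorem t_pred_nonneg {j : ℕ} (hj : j ∈ M.idx) : 0 ≤ M.t (j - 1) := by
  rw [mem_idx] at hj
  exact M.t_nonneg (by omega)

theorem t_pos {j : ℕ} (hj : j ∈ M.idx) : 0 < M.t j :=
  (M.t_pred_nonneg hj).trans_lt (M.t_pred_lt hj)

theorem t_le_of_idx {j : ℕ} (hj : j ∈ M.idx) : M.t j ≤ T := M.t_le (M.mem_idx.1 hj).2

theorem k_le {j : ℕ} (hj : j ∈ M.idx) : M.k j ≤ T := by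
  have := M.t_pred_nonneg hj
  have := M.t_le_of_idx hj
  unfold k
  linarith

theorem sum_k (n : ℕ) : ∑ j ∈ Finset.Icc 1 n, M.k j = M.t n := by
  induction n with
  | zero => simp [M.t_zero]
  | succ n ih =>
    rw [Finset.sum_Icc_succ_top (by omega), ih, k, Nat.add_sub_cancel]
    ring

theorem I_subset {j : ℕ} (hj : j ∈ M.idx) : M.I j ⊆ Ioo 0 T :=
  Ioo_subset_Ioo (M.t_pred_nonneg hj) (M.t_le_of_idx hj)

theorem eq_of_mem_I {i j : ℕ} (hi : i ∈ M.idx) (hj : j ∈ M.idx) {t : ℝ} (hti : t ∈ M.I i)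
    (htj : t ∈ M.I j) : i = j := by
  have key : ∀ i j : ℕ, j ∈ M.idx → t ∈ M.I i → t ∈ M.I j → ¬ i < j := by
    intro i j hj hti htj hij
    have h1 := hti.2
    have h2 := htj.1
    have h3 := M.t_mono (i := i) (j := j - 1) (by omega) (by rw [mem_idx] at hj; omega)
    linarith
  have h1 := key i j hj hti htj
  have h2 := key j i hi htj hti
  omega

theorem ae_exists_mem_I : ∀ᵐ t : ℝ, t ∈ Ioo 0 T → ∃ j ∈ M.idx, t ∈ M.I j := by
  have hfin : ((Finset.range (M.N + 1)).image M.t : Set ℝ).Finite := Finset.finite_toSet _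
  filter_upwards [compl_mem_ae_iff.2 (hfin.measure_zero volume)] with t ht h0
  classical
  have hex : ∃ j, t < M.t j := ⟨M.N, by rw [M.t_last]; exact h0.2⟩
  have hlt := Nat.find_spec hex
  have hle : Nat.find hex ≤ M.N := Nat.find_min' hex (by rw [M.t_last]; exact h0.2)
  have hne : Nat.find hex ≠ 0 := by
    intro h
    rw [h, M.t_zero] at hlt
    exact lt_asymm hlt h0.1
  have hmin := Nat.find_min hex (m := Nat.find hex - 1) (by omega)
  refine ⟨Nat.find hex, M.mem_idx.2 ⟨by omega, hle⟩, lt_of_le_of_ne (not_lt.1 hmin) ?_, hlt⟩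
  intro h
  apply ht
  simp only [Finset.coe_image, Finset.coe_range, mem_image, mem_Iio]
  exact ⟨_, by omega, h⟩

/-- The function `v` on `I_1 ∪ ⋯ ∪ I_n`, extended by zero. -/
noncomputable def cut {E : Type*} [NormedAddCommGroup E] (n : ℕ) (v : ℝ → E) (t : ℝ) : E :=
  ∑ j ∈ Finset.Icc 1 n, (M.I j).indicator v t

variable {E : Type*} [NormedAddCommGroup E] {n : ℕ} {v w : ℝ → E} {t : ℝ}

theorem mem_idx_of_le (hn : n ≤ M.N) {j : ℕ} (hj : j ∈ Finset.Icc 1 n) : j ∈ M.idx := by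
  rw [Finset.mem_Icc] at hj
  exact M.mem_idx.2 ⟨hj.1, hj.2.trans hn⟩

theorem cut_of_mem (hn : n ≤ M.N) {j : ℕ} (hj : j ∈ Finset.Icc 1 n) (ht : t ∈ M.I j) :
    M.cut n v t = v t := by
  rw [cut, Finset.sum_eq_single j, indicator_of_mem ht]
  · intro i hi hij
    rw [indicator_of_notMem]
    exact fun h => hij (M.eq_of_mem_I (M.mem_idx_of_le hn hi) (M.mem_idx_of_le hn hj) h ht)
  · exact fun h => absurd hj h

theorem cut_eq_zero_of_ge (hn : n ≤ M.N) (ht : M.t n ≤ t) : M.cut n v t = 0 := by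
  refine Finset.sum_eq_zero fun j hj => indicator_of_notMem (fun h => ?_) _
  have := h.2
  have := M.t_mono (Finset.mem_Icc.1 hj).2 hn
  linarith

theorem cut_last_eq_of_lt (hn : n ≤ M.N) (ht : t < M.t n) : M.cut M.N v t = M.cut n v t := by
  refine (Finset.sum_subset (Finset.Icc_subset_Icc_right hn) fun j hj hj' => ?_).symm
  refine indicator_of_notMem (fun h => ?_) _
  rw [Finset.mem_Icc] at hj hj'
  have := h.1
  have := M.t_mono (i := n) (j := j - 1) (by omega) (by omega)
  linarith

theorem cut_sub (t : ℝ) : M.cut n (fun s => v s - w s) t = M.cut n v t - M.cut n w t := by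
  simp only [cut, ← Finset.sum_sub_distrib]
  refine Finset.sum_congr rfl fun j _ => ?_
  by_cases ht : t ∈ M.I j <;> simp [ht]

theorem cut_add (t : ℝ) : M.cut n (fun s => v s + w s) t = M.cut n v t + M.cut n w t := by
  simp only [cut, ← Finset.sum_add_distrib]
  refine Finset.sum_congr rfl fun j _ => ?_
  by_cases ht : t ∈ M.I j <;> simp [ht]

theorem cut_clm [NormedSpace ℝ E] {G : Type*} [NormedAddCommGroup G] [NormedSpace ℝ G]
    (L : E →L[ℝ] G) (t : ℝ) : M.cut n (fun s => L (v s)) t = L (M.cut n v t) := by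
  simp only [cut, map_sum]
  refine Finset.sum_congr rfl fun j _ => ?_
  by_cases ht : t ∈ M.I j <;> simp [ht]

theorem ae_cut_last_eq : ∀ᵐ t, t ∈ Ioo 0 T → v t = M.cut M.N v t := by
  filter_upwards [M.ae_exists_mem_I] with t ht h0
  obtain ⟨j, hj, hjt⟩ := ht h0
  exact (M.cut_of_mem le_rfl hj hjt).symm

theorem integral_indicator_I {f : ℝ → ℝ} {j : ℕ} (hj : j ∈ M.idx) :
    ∫ t, (M.I j).indicator f t = ∫ t in M.t (j - 1)..M.t j, f t := by
  rw [I, integral_indicator measurableSet_Ioo, intervalIntegral.integral_of_le (M.t_pred_lt hj).le,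
    integral_Ioc_eq_integral_Ioo]

theorem integrable_indicator_I {f : ℝ → ℝ} {j : ℕ} (hj : j ∈ M.idx)
    (hf : IntervalIntegrable f volume (M.t (j - 1)) (M.t j)) :
    Integrable ((M.I j).indicator f) :=
  IntegrableOn.integrable_indicator
    ((intervalIntegrable_iff_integrableOn_Ioo_of_le (M.t_pred_lt hj).le).1 hf) measurableSet_Ioo

theorem integral_inner_cut {F : Type*} [NormedAddCommGroup F] [InnerProductSpace ℝ F]
    (hn : n ≤ M.N) {m w : ℝ → F}
    (hi : ∀ j ∈ M.idx, IntervalIntegrable (fun t => (inner ℝ (m t) (w t) : ℝ)) volume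
      (M.t (j - 1)) (M.t j)) :
    ∫ t, inner ℝ (m t) (M.cut n w t)
      = ∑ j ∈ Finset.Icc 1 n, ∫ t in M.t (j - 1)..M.t j, inner ℝ (m t) (w t) := by
  have e : ∀ t, inner ℝ (m t) (M.cut n w t)
      = ∑ j ∈ Finset.Icc 1 n, (M.I j).indicator (fun t => inner ℝ (m t) (w t)) t := by
    intro t
    rw [cut, inner_sum]
    refine Finset.sum_congr rfl fun j _ => ?_
    by_cases ht : t ∈ M.I j <;> simp [ht]
  simp only [e]
  rw [integral_finsetSum _ fun j hj => M.integrable_indicator_I (M.mem_idx_of_le hn hj)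
    (hi j (M.mem_idx_of_le hn hj))]
  exact Finset.sum_congr rfl fun j hj => M.integral_indicator_I (M.mem_idx_of_le hn hj)

end TimeMesh

namespace IsACPiece

variable {E : Type*} [NormedAddCommGroup E] [NormedSpace ℝ E] {a b : ℝ} {c c' : E}
  {G G' g g' : ℝ → E}

theorem sub (h : IsACPiece a b c G g) (h' : IsACPiece a b c' G' g') :
    IsACPiece a b (c - c') (fun t => G t - G' t) (fun t => g t - g' t) where
  lt := h.lt
  integrable := h.integrable.sub h'.integrable
  eq t ht := by
    have hs : uIcc t b ⊆ uIcc a b := by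
      rw [uIcc_of_le ht.2.le, uIcc_of_le h.lt.le]
      exact Icc_subset_Icc ht.1.le le_rfl
    rw [h.eq t ht, h'.eq t ht, intervalIntegral.integral_sub (h.integrable.mono_set hs)
      (h'.integrable.mono_set hs)]
    abel
  supp t ht := by rw [h.supp t ht, h'.supp t ht, sub_zero]

theorem clm [CompleteSpace E] {H : Type*} [NormedAddCommGroup H] [NormedSpace ℝ H]
    [CompleteSpace H] (h : IsACPiece a b c G g) (L : E →L[ℝ] H) :
    IsACPiece a b (L c) (fun t => L (G t)) (fun t => L (g t)) where
  lt := h.lt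
  integrable := by
    have := h.integrable
    rw [intervalIntegrable_iff] at this ⊢
    exact L.integrable_comp this
  eq t ht := by
    have hs : uIcc t b ⊆ uIcc a b := by
      rw [uIcc_of_le ht.2.le, uIcc_of_le h.lt.le]
      exact Icc_subset_Icc ht.1.le le_rfl
    rw [h.eq t ht, map_sub, L.intervalIntegral_comp_comm (h.integrable.mono_set hs)]
  supp t ht := by rw [h.supp t ht, map_zero]

end IsACPiece

/-- The restriction of `v` to each subinterval of the mesh is absolutely continuous. -/
def IsPiecewiseAC {T : ℝ} {E : Type*} [NormedAddCommGroup E] [NormedSpace ℝ E] (M : TimeMesh T)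
    (v : ℝ → E) : Prop :=
  ∀ j ∈ M.idx, ∃ c G, IsACPiece (M.t (j - 1)) (M.t j) c G ((M.I j).indicator v)

theorem indicator_fun_sub {E : Type*} [NormedAddCommGroup E] (s : Set ℝ)
    (v w : ℝ → E) :
    (fun t => s.indicator v t - s.indicator w t) = s.indicator (fun t => v t - w t) := by
  ext t
  by_cases ht : t ∈ s <;> simp [ht]

section pieces

variable {T : ℝ} {M : TimeMesh T} {E : Type*} [NormedAddCommGroup E] [NormedSpace ℝ E]
  {v w : ℝ → E} {p : ℕ → ℕ}

theorem indicator_fun_clm {H : Type*} [NormedAddCommGroup H] [NormedSpace ℝ H] (s : Set ℝ)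
    (v : ℝ → E) (L : E →L[ℝ] H) :
    (fun t => L (s.indicator v t)) = s.indicator (fun t => L (v t)) := by
  ext t
  by_cases ht : t ∈ s <;> simp [ht]

theorem IsPiecewiseAC.sub (hv : IsPiecewiseAC M v) (hw : IsPiecewiseAC M w) :
    IsPiecewiseAC M (fun t => v t - w t) := by
  intro j hj
  obtain ⟨c, G, h⟩ := hv j hj
  obtain ⟨c', G', h'⟩ := hw j hj
  exact ⟨_, _, by simpa only [indicator_fun_sub] using h.sub h'⟩

theorem IsPiecewiseAC.clm [CompleteSpace E] {H : Type*} [NormedAddCommGroup H]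
    [NormedSpace ℝ H] [CompleteSpace H] (hv : IsPiecewiseAC M v) (L : E →L[ℝ] H) :
    IsPiecewiseAC M (fun t => L (v t)) := by
  intro j hj
  obtain ⟨c, G, h⟩ := hv j hj
  exact ⟨_, _, by simpa only [indicator_fun_clm] using h.clm L⟩

theorem IsPiecewiseAC.isBump_cut (hv : IsPiecewiseAC M v) {n : ℕ} (hn : n ≤ M.N) :
    IsBump (M.t n) (M.cut n v) := by
  refine IsBump.sum _ fun j hj => ?_
  have hj' := M.mem_idx_of_le hn hj
  obtain ⟨c, G, h⟩ := hv j hj'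
  exact h.isBump (M.t_pred_nonneg hj') (M.t_mono (Finset.mem_Icc.1 hj).2 hn)

theorem isACPiece_of_eqOn_isPoly [CompleteSpace E] {X X' : ℝ → E} {j : ℕ} (hj : j ∈ M.idx)
    (hv : EqOn v X (M.I j)) (hX' : Continuous X') (hd : ∀ t, HasDerivAt X (X' t) t) :
    IsACPiece (M.t (j - 1)) (M.t j) (X (M.t j)) X' ((M.I j).indicator v) where
  lt := M.t_pred_lt hj
  integrable := hX'.intervalIntegrable _ _
  eq t ht := by
    have m : t ∈ M.I j := ht
    rw [indicator_of_mem m, hv m, intervalIntegral.integral_eq_sub_of_hasDerivAt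
      (fun s _ => hd s) (hX'.intervalIntegrable _ _)]
    abel
  supp t ht := indicator_of_notMem ht _

theorem InTrialSpace.isPiecewiseAC [CompleteSpace E] (hv : InTrialSpace M p v)
    (hp : ∀ n ∈ M.idx, 1 ≤ p n) : IsPiecewiseAC M v := by
  intro j hj
  obtain ⟨X, hX, hvX⟩ := hv j hj
  obtain ⟨X', hX', hd⟩ := hX.exists_hasDerivAt (hp j hj)
  exact ⟨_, _, isACPiece_of_eqOn_isPoly hj hvX hX'.continuous hd⟩

theorem isACPiece_of_eq_integral {g : ℝ → E} (hg : IntervalIntegrable g volume 0 T)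
    (hv : ∀ t ∈ Icc (0 : ℝ) T, v t = v 0 + ∫ s in (0 : ℝ)..t, g s) {j : ℕ} (hj : j ∈ M.idx) :
    IsACPiece (M.t (j - 1)) (M.t j) (v (M.t j)) g ((M.I j).indicator v) where
  lt := M.t_pred_lt hj
  integrable := by
    refine hg.mono_set ?_
    have h1 := M.t_pred_nonneg hj
    have h2 := M.t_le_of_idx hj
    have h3 := M.t_pred_lt hj
    rw [uIcc_of_le h3.le, uIcc_of_le (by linarith)]
    exact Icc_subset_Icc h1 h2
  eq t ht := by
    have m : t ∈ M.I j := ht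
    have h1 := (M.I_subset hj m).1
    have h2 := (M.I_subset hj m).2
    have h3 := M.t_le_of_idx hj
    have h4 := M.t_pos hj
    have s1 : IntervalIntegrable g volume 0 t := hg.mono_set (by
      rw [uIcc_of_le h1.le, uIcc_of_le (by linarith)]
      exact Icc_subset_Icc le_rfl h2.le)
    have s2 : IntervalIntegrable g volume t (M.t j) := hg.mono_set (by
      rw [uIcc_of_le ht.2.le, uIcc_of_le (by linarith)]
      exact Icc_subset_Icc h1.le h3)
    rw [indicator_of_mem m, hv t ⟨h1.le, h2.le⟩, hv _ ⟨h4.le, h3⟩,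
      ← intervalIntegral.integral_add_adjacent_intervals s1 s2]
    abel
  supp t ht := indicator_of_notMem ht _

theorem IsW11.isPiecewiseAC (hv : IsW11 T v) : IsPiecewiseAC M v := by
  obtain ⟨g, hg, h⟩ := hv
  exact fun j hj => ⟨_, _, isACPiece_of_eq_integral hg h hj⟩

/-- The fractional derivative of a piecewise absolutely continuous function, seen through a
continuous linear map. -/
theorem IsPiecewiseAC.ae_map_fracDeriv [CompleteSpace E] {H : Type*} [NormedAddCommGroup H]
    [NormedSpace ℝ H] [CompleteSpace H] {α : ℝ} (hα : -1 < α) (hα' : α < 0)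
    (hv : IsPiecewiseAC M v) (L : E →L[ℝ] H) :
    ∀ᵐ t, t ∈ Ioo 0 T →
      L (fracDeriv α v t) = marchaud α (M.cut M.N fun s => L (v s)) t := by
  filter_upwards [(hv.isBump_cut le_rfl).ae_map_fracDeriv hα hα' L] with t ht h0
  rw [fracDeriv_congr_ae (M.ae_cut_last_eq (v := v)) h0, ht h0.1]
  congr 1
  ext s
  exact (M.cut_clm L s).symm

theorem IsBump.ae_marchaud_sub {α S : ℝ} (hα : -1 < α) (hα' : α < 0) (hv : IsBump S v)
    (hw : IsBump S w) :
    ∀ᵐ t, marchaud α (fun s => v s - w s) t = marchaud α v t - marchaud α w t := by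
  filter_upwards [hv.ae_integrable_kernel_smul_diff hα hα',
    hw.ae_integrable_kernel_smul_diff hα hα'] with t h1 h2
  simp only [marchaud]
  rw [← integral_sub h1 h2]
  congr 1 with h
  rw [← smul_sub]
  congr 1
  abel

end pieces

/-! ### Integration by parts in time -/

theorem integral_mul_eq_of_primitive {g φ φ' : ℝ → ℝ} {a b : ℝ}
    (hg : IntervalIntegrable g volume a b) (hφ : ∀ t, HasDerivAt φ (φ' t) t)
    (hφ' : Continuous φ') :
    ∫ t in a..b, g t * φ t
      = (∫ t in a..b, g t) * φ b - ∫ t in a..b, (∫ s in a..t, g s) * φ' t := by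
  have h1 := hg.absolutelyContinuousOnInterval_intervalIntegral (c := a) (by simp)
  have hφ1 : ContDiff ℝ 1 φ := by
    rw [contDiff_one_iff_deriv]
    refine ⟨fun t => (hφ t).differentiableAt, ?_⟩
    rwa [show deriv φ = φ' from funext fun t => (hφ t).deriv]
  have h2 : AbsolutelyContinuousOnInterval φ a b :=
    hφ1.contDiffOn.absolutelyContinuousOnInterval
  have h3 := h1.integral_mul_deriv_eq_deriv_mul h2
  have e1 : ∫ t in a..b, deriv (fun x => ∫ s in a..x, g s) t * φ t = ∫ t in a..b, g t * φ t := by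
    refine intervalIntegral.integral_congr_ae ?_
    filter_upwards [hg.ae_hasDerivAt_integral] with t ht hm
    rw [(ht (uIoc_subset_uIcc hm) a (by simp)).deriv]
  have e2 : ∀ t, deriv φ t = φ' t := fun t => (hφ t).deriv
  rw [e1] at h3
  simp only [e2, intervalIntegral.integral_same, zero_mul, sub_zero] at h3
  linarith

section parts

variable {F : Type*} [NormedAddCommGroup F] [InnerProductSpace ℝ F]
  {a b : ℝ} {p : ℕ}

theorem intervalIntegrable_inner {G X : ℝ → F} (hG : IntervalIntegrable G volume a b)
    (hX : Continuous X) : IntervalIntegrable (fun t => (inner ℝ (G t) (X t) : ℝ)) volume a b := by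
  obtain ⟨A, hA⟩ := (isCompact_uIcc (a := a) (b := b)).exists_bound_of_continuousOn
    hX.continuousOn
  rw [intervalIntegrable_iff] at hG ⊢
  refine (hG.norm.mul_const A).mono' (hG.aestronglyMeasurable.inner hX.aestronglyMeasurable) ?_
  filter_upwards [ae_restrict_mem measurableSet_uIoc] with t ht
  exact (norm_inner_le_norm _ _).trans (by gcongr; exact hA t (uIoc_subset_uIcc ht))

theorem integral_inner_deriv_self {X X' : ℝ → F} (hX' : Continuous X')
    (hd : ∀ t, HasDerivAt X (X' t) t) :
    ∫ t in a..b, inner ℝ (X' t) (X t) = ‖X b‖ ^ 2 / 2 - ‖X a‖ ^ 2 / 2 := by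
  have hXc : Continuous X := continuous_iff_continuousAt.2 fun t => (hd t).continuousAt
  refine intervalIntegral.integral_eq_sub_of_hasDerivAt (f := fun t => ‖X t‖ ^ 2 / 2)
    (fun t _ => ?_) (Continuous.intervalIntegrable (by fun_prop) _ _)
  have := (hd t).norm_sq.div_const 2
  rw [mul_div_cancel_left₀ _ two_ne_zero, real_inner_comm] at this
  exact this

variable [CompleteSpace F]

/-- Integration by parts of an indefinite integral `h` against a polynomial `X`. -/
theorem integral_inner_isPoly {G h X X' : ℝ → F} (hab : a ≤ b)
    (hG : IntervalIntegrable G volume a b) (hh : ∀ t ∈ Icc a b, h t = h a + ∫ s in a..t, G s)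
    (hX : IsPoly p X) (hX' : Continuous X') (hd : ∀ t, HasDerivAt X (X' t) t) :
    ∫ t in a..b, inner ℝ (G t) (X t)
      = inner ℝ (h b) (X b) - inner ℝ (h a) (X a) - ∫ t in a..b, inner ℝ (h t) (X' t) := by
  obtain ⟨c, hc⟩ := hX
  have hX'e : ∀ t, X' t = ∑ i ∈ Finset.range (p + 1), ((i : ℝ) * t ^ (i - 1)) • c i := by
    intro t
    have e : X = fun t => ∑ i ∈ Finset.range (p + 1), t ^ i • c i := funext hc
    refine (hd t).unique ?_
    rw [e]
    exact HasDerivAt.fun_sum fun i _ => (hasDerivAt_pow i t).smul_const (c i)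
  have hGc : ∀ i, IntervalIntegrable (fun t => (inner ℝ (G t) (c i) : ℝ)) volume a b := fun i =>
    intervalIntegrable_inner hG continuous_const
  have hP : ContinuousOn (fun t => ∫ s in a..t, G s) (uIcc a b) :=
    intervalIntegral.continuousOn_primitive_interval' hG (by simp)
  have hin : ∀ t ∈ Icc a b, ∀ i, ∫ s in a..t, inner ℝ (G s) (c i)
      = inner ℝ (∫ s in a..t, G s) (c i) := by
    intro t ht i
    have hs : IntervalIntegrable G volume a t := hG.mono_set (by
      rw [uIcc_of_le ht.1, uIcc_of_le hab]
      exact Icc_subset_Icc le_rfl ht.2)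
    simp only [real_inner_comm (c i)]
    exact (innerSL ℝ (c i)).intervalIntegral_comp_comm hs
  have hXc : Continuous X := by
    rw [show X = fun t => ∑ i ∈ Finset.range (p + 1), t ^ i • c i from funext hc]
    fun_prop
  -- The identity without boundary terms at `a`, by linearity from the monomials.
  have key : ∫ t in a..b, inner ℝ (G t) (X t)
      = inner ℝ (∫ t in a..b, G t) (X b) - ∫ t in a..b, inner ℝ (∫ s in a..t, G s) (X' t) := by
    have l1 : ∫ t in a..b, inner ℝ (G t) (X t)
        = ∑ i ∈ Finset.range (p + 1), ∫ t in a..b, inner ℝ (G t) (c i) * t ^ i := by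
      rw [← intervalIntegral.integral_finsetSum fun i _ =>
        (hGc i).mul_continuousOn (by fun_prop)]
      congr 1 with t
      rw [hc, inner_sum]
      refine Finset.sum_congr rfl fun i _ => ?_
      rw [real_inner_smul_right, mul_comm]
    have l2 : ∫ t in a..b, inner ℝ (∫ s in a..t, G s) (X' t)
        = ∑ i ∈ Finset.range (p + 1),
            ∫ t in a..b, (∫ s in a..t, inner ℝ (G s) (c i)) * ((i : ℝ) * t ^ (i - 1)) := by
      rw [← intervalIntegral.integral_finsetSum]
      · refine intervalIntegral.integral_congr fun t ht => ?_
        rw [uIcc_of_le hab] at ht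
        rw [hX'e, inner_sum]
        refine Finset.sum_congr rfl fun i _ => ?_
        rw [real_inner_smul_right, hin t ht, mul_comm]
      · intro i _
        refine ContinuousOn.intervalIntegrable ?_
        refine ContinuousOn.mul ?_ (by fun_prop)
        exact intervalIntegral.continuousOn_primitive_interval' (hGc i) (by simp)
    rw [l1, l2, hc b, inner_sum, ← Finset.sum_sub_distrib]
    refine Finset.sum_congr rfl fun i _ => ?_
    rw [integral_mul_eq_of_primitive (hGc i) (fun t => hasDerivAt_pow i t) (by fun_prop),
      hin b ⟨hab, le_rfl⟩, real_inner_smul_right]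
    ring
  have hX'i : ∫ t in a..b, inner ℝ (h a) (X' t) = inner ℝ (h a) (X b - X a) := by
    rw [← intervalIntegral.integral_eq_sub_of_hasDerivAt (fun s _ => hd s)
      (hX'.intervalIntegrable _ _)]
    exact (innerSL ℝ (h a)).intervalIntegral_comp_comm (hX'.intervalIntegrable _ _)
  have hsplit : ∫ t in a..b, inner ℝ (h t) (X' t)
      = (∫ t in a..b, inner ℝ (h a) (X' t))
        + ∫ t in a..b, inner ℝ (∫ s in a..t, G s) (X' t) := by
    rw [← intervalIntegral.integral_add]
    · refine intervalIntegral.integral_congr fun t ht => ?_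
      rw [uIcc_of_le hab] at ht
      rw [hh t ht, inner_add_left]
    · exact Continuous.intervalIntegrable (by fun_prop) _ _
    · exact ContinuousOn.intervalIntegrable (hP.inner hX'.continuousOn)
  rw [key, hsplit, hX'i, hh b ⟨hab, le_rfl⟩, inner_add_left, inner_sub_right]
  ring

end parts

/-! ### The error equation -/

theorem intervalIntegrable_congr_ae_Ioo {E : Type*} [NormedAddCommGroup E] {a b : ℝ}
    (hab : a ≤ b) {f g : ℝ → E} (h : ∀ᵐ t, t ∈ Ioo a b → f t = g t)
    (hg : IntervalIntegrable g volume a b) : IntervalIntegrable f volume a b := by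
  rw [intervalIntegrable_iff_integrableOn_Ioo_of_le hab] at hg ⊢
  refine hg.congr ?_
  filter_upwards [ae_restrict_of_ae h, ae_restrict_mem measurableSet_Ioo] with t h1 h2
  exact (h1 h2).symm

theorem integral_congr_ae_Ioo {E : Type*} [NormedAddCommGroup E] [NormedSpace ℝ E] {a b : ℝ}
    (hab : a ≤ b) {f g : ℝ → E} (h : ∀ᵐ t, t ∈ Ioo a b → f t = g t) :
    ∫ t in a..b, f t = ∫ t in a..b, g t := by
  rw [intervalIntegral.integral_of_le hab, intervalIntegral.integral_of_le hab,
    integral_Ioc_eq_integral_Ioo, integral_Ioc_eq_integral_Ioo]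
  refine integral_congr_ae ?_
  filter_upwards [ae_restrict_of_ae h, ae_restrict_mem measurableSet_Ioo] with t h1 h2
  exact h1 h2

section traces

variable {T : ℝ} {M : TimeMesh T} {E : Type*} [NormedAddCommGroup E] {v X : ℝ → E} {n : ℕ}

theorem TimeMesh.traceR_eq (hn : n ∈ M.idx) (hv : EqOn v X (M.I n)) (hX : Continuous X) :
    M.traceR v (n - 1) = X (M.t (n - 1)) := by
  refine rightLim_eq_of_tendsto ?_
  refine ((hX.tendsto _).mono_left nhdsWithin_le_nhds).congr' ?_
  filter_upwards [Ioo_mem_nhdsGT (M.t_pred_lt hn)] with t ht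
  exact (hv ht).symm

theorem TimeMesh.traceL_eq (hn : n ∈ M.idx) (hv : EqOn v X (M.I n)) (hX : Continuous X) :
    M.traceL v n = X (M.t n) := by
  rw [TimeMesh.traceL, if_neg (by rw [M.mem_idx] at hn; omega)]
  refine leftLim_eq_of_tendsto ?_
  refine ((hX.tendsto _).mono_left nhdsWithin_le_nhds).congr' ?_
  filter_upwards [Ioo_mem_nhdsLT (M.t_pred_lt hn)] with t ht
  exact (hv ht).symm

end traces

/-- A function in `W^{1,1}` is almost everywhere differentiable, and the indefinite integral of its
derivative. -/
theorem IsW11.exists_ae_hasDerivAt {T : ℝ} {E : Type*} [NormedAddCommGroup E] [NormedSpace ℝ E]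
    [CompleteSpace E] {v : ℝ → E} (hT : 0 < T) (hv : IsW11 T v) :
    ∃ g : ℝ → E, IntervalIntegrable g volume 0 T ∧
      (∀ t ∈ Icc (0 : ℝ) T, v t = v 0 + ∫ s in (0 : ℝ)..t, g s) ∧
      ∀ᵐ t, t ∈ Ioo 0 T → HasDerivAt v (g t) t := by
  obtain ⟨g, hg, h⟩ := hv
  refine ⟨g, hg, h, ?_⟩
  filter_upwards [hg.ae_hasDerivAt_integral] with t ht hm
  have h0 : (0 : ℝ) ∈ uIcc 0 T := by simp
  have hd := (ht (by rw [uIcc_of_le hT.le]; exact Ioo_subset_Icc_self hm) 0 h0).const_add (v 0)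
  refine hd.congr_of_eventuallyEq ?_
  filter_upwards [isOpen_Ioo.mem_nhds hm] with s hs
  exact h s (Ioo_subset_Icc_self hs)

section dg

variable {d : ℕ} {Ω : TopologicalSpace.Opens (EuclideanSpace ℝ (Fin d))} {T K α : ℝ}
  {M : TimeMesh T} {p : ℕ → ℕ} {f : ℝ → L2 Ω} {u₀ : L2 Ω} {u U P : ℝ → H10 Ω}

theorem toL2_sub (v w : H10 Ω) : toL2 (v - w) = toL2 v - toL2 w := map_sub (toL2CLM Ω) v w

theorem grad_sub (v w : H10 Ω) : grad (v - w) = grad v - grad w := map_sub (gradCLM Ω) v w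

theorem deriv_eq_of_eqOn_I {E : Type*} [NormedAddCommGroup E] [NormedSpace ℝ E] {v X X' : ℝ → E}
    {n : ℕ} (hv : EqOn v X (M.I n)) (hd : ∀ t, HasDerivAt X (X' t) t) {t : ℝ} (ht : t ∈ M.I n) :
    HasDerivAt v (X' t) t := by
  refine (hd t).congr_of_eventuallyEq ?_
  filter_upwards [isOpen_Ioo.mem_nhds ht] with s hs
  exact hv hs

theorem ae_mem_I_of_ae {Q : ℝ → Prop} (h : ∀ᵐ t, t ∈ Ioo 0 T → Q t) {n : ℕ} (hn : n ∈ M.idx) :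
    ∀ᵐ t, t ∈ Ioo (M.t (n - 1)) (M.t n) → Q t := by
  filter_upwards [h] with t ht hm
  exact ht (M.I_subset hn hm)

/-- The scheme and the equation, tested with the same polynomial and subtracted. -/
theorem error_equation (hα : -1 < α) (hα' : α < 0) (hT : 0 < T)
    (hp : ∀ n ∈ M.idx, 1 ≤ p n) (hu : IsW11 T u) (hsol : IsSolution K α T f u₀ u)
    (hU : IsDGSolution M p K α f u₀ U) {n : ℕ} (hn : n ∈ M.idx) {X : ℝ → H10 Ω}
    (hX : IsPoly (p n) X) :
    inner ℝ (toL2 (M.traceR U (n - 1) - M.traceL U (n - 1))) (toL2 (X (M.t (n - 1))))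
      + (∫ s in M.t (n - 1)..M.t n, inner ℝ (toL2 (deriv U s) - toL2 (deriv u s)) (toL2 (X s)))
      + K * ∫ s in M.t (n - 1)..M.t n,
          inner ℝ (marchaud α (M.cut M.N fun r => grad (U r - u r)) s) (grad (X s)) = 0 := by
  have hlt := M.t_pred_lt hn
  have hUac : IsPiecewiseAC M U := hU.mem.isPiecewiseAC hp
  have huac : IsPiecewiseAC M u := hu.isPiecewiseAC
  have hXL : Continuous fun s => toL2 (X s) := (toL2CLM Ω).continuous.comp hX.continuous
  have hXG : Continuous fun s => grad (X s) := (gradCLM Ω).continuous.comp hX.continuous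
  -- the time derivatives
  obtain ⟨Y, hY, hUY⟩ := hU.mem n hn
  obtain ⟨Y', hY', hYd⟩ := hY.exists_hasDerivAt (hp n hn)
  obtain ⟨g, hg, hug, hgd⟩ := hu.exists_ae_hasDerivAt hT
  have iU : IntervalIntegrable (fun s => toL2 (deriv U s)) volume (M.t (n - 1)) (M.t n) := by
    refine intervalIntegrable_congr_ae_Ioo hlt.le (g := fun s => toL2CLM Ω (Y' s)) ?_
      (((toL2CLM Ω).continuous.comp hY'.continuous).intervalIntegrable _ _)
    refine Eventually.of_forall fun t ht => ?_
    rw [(deriv_eq_of_eqOn_I hUY hYd ht).deriv, toL2CLM_apply]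
  have iu : IntervalIntegrable (fun s => toL2 (deriv u s)) volume (M.t (n - 1)) (M.t n) := by
    refine intervalIntegrable_congr_ae_Ioo hlt.le (g := fun s => toL2CLM Ω (g s)) ?_
      ((isACPiece_of_eq_integral hg hug hn).clm (toL2CLM Ω)).integrable
    filter_upwards [ae_mem_I_of_ae hgd hn] with t ht hm
    rw [(ht hm).deriv, toL2CLM_apply]
  -- the fractional derivatives
  have bU := (hUac.clm (gradCLM Ω)).isBump_cut le_rfl
  have bu := (huac.clm (gradCLM Ω)).isBump_cut le_rfl
  have mU := ae_mem_I_of_ae (hUac.ae_map_fracDeriv hα hα' (gradCLM Ω)) hn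
  have mu := ae_mem_I_of_ae (huac.ae_map_fracDeriv hα hα' (gradCLM Ω)) hn
  have jU : IntervalIntegrable (fun s => grad (fracDeriv α U s)) volume (M.t (n - 1)) (M.t n) :=
    intervalIntegrable_congr_ae_Ioo hlt.le mU (bU.integrable_marchaud hα hα').intervalIntegrable
  have ju : IntervalIntegrable (fun s => grad (fracDeriv α u s)) volume (M.t (n - 1)) (M.t n) :=
    intervalIntegrable_congr_ae_Ioo hlt.le mu (bu.integrable_marchaud hα hα').intervalIntegrable
  have hdiff : ∫ s in M.t (n - 1)..M.t n,
        inner ℝ (marchaud α (M.cut M.N fun r => grad (U r - u r)) s) (grad (X s))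
      = (∫ s in M.t (n - 1)..M.t n, inner ℝ (grad (fracDeriv α U s)) (grad (X s)))
        - ∫ s in M.t (n - 1)..M.t n, inner ℝ (grad (fracDeriv α u s)) (grad (X s)) := by
    rw [← intervalIntegral.integral_sub (intervalIntegrable_inner jU hXG)
      (intervalIntegrable_inner ju hXG)]
    refine integral_congr_ae_Ioo hlt.le ?_
    filter_upwards [mU, mu, bU.ae_marchaud_sub hα hα' bu] with t h1 h2 h3 hm
    have h1 := h1 hm
    have h2 := h2 hm
    rw [gradCLM_apply] at h1 h2
    rw [h1, h2, ← inner_sub_left, ← h3]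
    congr 2
    funext s
    rw [← M.cut_sub]
    simp only [grad_sub, gradCLM_apply]
  have hstep := hU.step n hn X hX
  have hf : ∫ s in M.t (n - 1)..M.t n, inner ℝ (f s) (toL2 (X s))
      = ∫ s in M.t (n - 1)..M.t n,
          (inner ℝ (toL2 (deriv u s)) (toL2 (X s)) + aForm K (fracDeriv α u s) (X s)) := by
    refine integral_congr_ae_Ioo hlt.le ?_
    have := (ae_restrict_iff' measurableSet_Ioo).1 hsol.equation
    filter_upwards [ae_mem_I_of_ae this hn] with t ht hm
    exact (ht hm (X t)).symm
  simp only [aForm] at hstep hf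
  rw [hf, intervalIntegral.integral_add (intervalIntegrable_inner iU hXL)
    ((intervalIntegrable_inner jU hXG).const_mul K),
    intervalIntegral.integral_add (intervalIntegrable_inner iu hXL)
    ((intervalIntegrable_inner ju hXG).const_mul K), intervalIntegral.integral_const_mul,
    intervalIntegral.integral_const_mul] at hstep
  have hD : ∫ s in M.t (n - 1)..M.t n, inner ℝ (toL2 (deriv U s) - toL2 (deriv u s)) (toL2 (X s))
      = (∫ s in M.t (n - 1)..M.t n, inner ℝ (toL2 (deriv U s)) (toL2 (X s)))
        - ∫ s in M.t (n - 1)..M.t n, inner ℝ (toL2 (deriv u s)) (toL2 (X s)) := by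
    rw [← intervalIntegral.integral_sub (intervalIntegrable_inner iU hXL)
      (intervalIntegrable_inner iu hXL)]
    simp only [inner_sub_left]
  rw [hdiff, hD]
  linarith

set_option maxHeartbeats 400000 in
/-- The energy identity on one subinterval. The defining properties of the projection remove the
contribution of `(P - u)'` completely. -/
theorem energy_step (hα : -1 < α) (hα' : α < 0) (hT : 0 < T)
    (hp : ∀ n ∈ M.idx, 1 ≤ p n) (hu : IsW11 T u) (hsol : IsSolution K α T f u₀ u)
    (hU : IsDGSolution M p K α f u₀ U) (hP : IsProjection M p u P) {n : ℕ} (hn : n ∈ M.idx) :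
    ‖toL2 (M.traceL U n - u (M.t n))‖ ^ 2 / 2
      + ‖toL2 (M.traceR U (n - 1) - M.traceR P (n - 1))
          - toL2 (M.traceL U (n - 1) - u (M.t (n - 1)))‖ ^ 2 / 2
      - ‖toL2 (M.traceL U (n - 1) - u (M.t (n - 1)))‖ ^ 2 / 2
      + K * ∫ s in M.t (n - 1)..M.t n,
          inner ℝ (marchaud α (M.cut M.N fun r => grad (U r - u r)) s) (grad (U s - P s)) = 0 := by
  have hlt := M.t_pred_lt hn
  obtain ⟨Y, hY, hUY⟩ := hU.mem n hn
  obtain ⟨Z, hZ, hPZ⟩ := hP.mem n hn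
  obtain ⟨Y', hY', hYd⟩ := hY.exists_hasDerivAt (hp n hn)
  obtain ⟨Z', hZ', hZd⟩ := hZ.exists_hasDerivAt (hp n hn)
  obtain ⟨g, hg, hug, hgd⟩ := hu.exists_ae_hasDerivAt hT
  have hθ := hY.sub hZ
  have hθ' := hY'.sub hZ'
  have hθd : ∀ t, HasDerivAt (fun t => Y t - Z t) (Y' t - Z' t) t := fun t => (hYd t).sub (hZd t)
  have hZb : Z (M.t n) = u (M.t n) := by
    rw [← hP.node n hn, M.traceL_eq hn hPZ hZ.continuous]
  have herr := error_equation hα hα' hT hp hu hsol hU hn hθ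
  set a := M.t (n - 1) with ha
  set b := M.t n with hb
  set L := toL2CLM Ω with hL
  have hLd : ∀ t, HasDerivAt (fun t => L (Y t - Z t)) (L (Y' t - Z' t)) t := fun t =>
    L.hasFDerivAt.comp_hasDerivAt t (hθd t)
  have hLc : Continuous fun t => L (Y' t - Z' t) := L.continuous.comp hθ'.continuous
  have iG : IntervalIntegrable (fun t => Z' t - g t) volume a b :=
    (hZ'.continuous.intervalIntegrable _ _).sub (isACPiece_of_eq_integral hg hug hn).integrable
  have iLG : IntervalIntegrable (fun t => L (Z' t - g t)) volume a b := by
    rw [intervalIntegrable_iff] at iG ⊢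
    exact L.integrable_comp iG
  have hh : ∀ t ∈ Icc a b, L (Z t - u t) = L (Z a - u a) + ∫ s in a..t, L (Z' s - g s) := by
    intro t ht
    have h0a : 0 ≤ a := M.t_pred_nonneg hn
    have hbT : b ≤ T := M.t_le_of_idx hn
    have s1 : IntervalIntegrable g volume 0 a := hg.mono_set (by
      rw [uIcc_of_le h0a, uIcc_of_le hT.le]
      exact Icc_subset_Icc le_rfl (by linarith))
    have s2 : IntervalIntegrable g volume a t := hg.mono_set (by
      rw [uIcc_of_le ht.1, uIcc_of_le hT.le]
      exact Icc_subset_Icc h0a (ht.2.trans hbT))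
    have i3 := (hZ'.continuous.intervalIntegrable a t).sub s2
    rw [L.intervalIntegral_comp_comm i3, ← map_add, intervalIntegral.integral_sub
      (hZ'.continuous.intervalIntegrable a t) s2, intervalIntegral.integral_eq_sub_of_hasDerivAt
      (fun s _ => hZd s) (hZ'.continuous.intervalIntegrable _ _), hug t ⟨h0a.trans ht.1,
      ht.2.trans hbT⟩, hug a ⟨h0a, by linarith⟩,
      ← intervalIntegral.integral_add_adjacent_intervals s1 s2]
    congr 1
    abel
  have hparts := integral_inner_isPoly hlt.le iLG hh (hθ.clm L) hLc hLd
  have horth : ∫ t in a..b, inner ℝ (L (Z t - u t)) (L (Y' t - Z' t)) = 0 := by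
    rw [← neg_eq_zero, ← intervalIntegral.integral_neg, ← hP.orth n hn _ hθ']
    refine integral_congr_ae_Ioo hlt.le (Eventually.of_forall fun t ht => ?_)
    rw [hPZ ht, ← inner_neg_left, ← map_neg, neg_sub]
    rfl
  have hself := integral_inner_deriv_self (a := a) (b := b) hLc hLd
  have hsplit : ∫ s in a..b, inner ℝ (toL2 (deriv U s) - toL2 (deriv u s)) (toL2 (Y s - Z s))
      = (∫ t in a..b, inner ℝ (L (Y' t - Z' t)) (L (Y t - Z t)))
        + ∫ t in a..b, inner ℝ (L (Z' t - g t)) (L (Y t - Z t)) := by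
    have hc : Continuous fun t => L (Y t - Z t) := L.continuous.comp hθ.continuous
    rw [← intervalIntegral.integral_add (Continuous.intervalIntegrable (hLc.inner hc) _ _)
      (intervalIntegrable_inner iLG hc)]
    refine integral_congr_ae_Ioo hlt.le ?_
    filter_upwards [ae_mem_I_of_ae hgd hn] with t ht hm
    rw [(deriv_eq_of_eqOn_I hUY hYd hm).deriv, (ht hm).deriv, ← inner_add_left, ← map_add,
      sub_add_sub_cancel, ← toL2_sub]
    rfl
  have hfrac : ∫ s in a..b,
        inner ℝ (marchaud α (M.cut M.N fun r => grad (U r - u r)) s) (grad (U s - P s))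
      = ∫ s in a..b,
        inner ℝ (marchaud α (M.cut M.N fun r => grad (U r - u r)) s) (grad (Y s - Z s)) := by
    refine integral_congr_ae_Ioo hlt.le (Eventually.of_forall fun t ht => ?_)
    rw [hUY ht, hPZ ht]
  rw [hsplit, hself, hparts, horth, hZb, M.traceR_eq hn hUY hY.continuous] at herr
  rw [hfrac, M.traceR_eq hn hUY hY.continuous, M.traceR_eq hn hPZ hZ.continuous,
    M.traceL_eq hn hUY hY.continuous, ← ha, ← hb, ← herr, norm_sub_sq_real]
  have e : toL2 (Y a - M.traceL U (n - 1))
      = toL2 (Y a - Z a) + L (Z a - u a) - toL2 (M.traceL U (n - 1) - u a) := by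
    rw [hL, toL2CLM_apply]
    simp only [toL2_sub]
    abel
  rw [e, inner_sub_left, inner_add_left, real_inner_self_eq_norm_sq]
  simp only [hL, toL2CLM_apply, sub_self, map_zero, inner_zero_left]
  rw [real_inner_comm (toL2 (Y a - Z a)) (toL2 (M.traceL U (n - 1) - u a))]
  ring

end dg

/-! ### The energy estimate -/

section energy

variable {d : ℕ} {Ω : TopologicalSpace.Opens (EuclideanSpace ℝ (Fin d))} {T K α : ℝ}
  {M : TimeMesh T} {p : ℕ → ℕ} {f : ℝ → L2 Ω} {u₀ : L2 Ω} {u U P : ℝ → H10 Ω}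

theorem TimeMesh.le_max (a : ℕ → ℝ) {n : ℕ} (hn : n ∈ M.idx) : a n ≤ M.max a :=
  Finset.le_sup' a hn

theorem TimeMesh.max_le {a : ℕ → ℝ} {c : ℝ} (h : ∀ n ∈ M.idx, a n ≤ c) : M.max a ≤ c :=
  Finset.sup'_le _ _ h

theorem TimeMesh.min_le (a : ℕ → ℝ) {n : ℕ} (hn : n ∈ M.idx) : M.min a ≤ a n :=
  Finset.inf'_le a hn

theorem TimeMesh.last_mem_idx : M.N ∈ M.idx := M.mem_idx.2 ⟨M.N_pos, le_rfl⟩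

/-- The projection error `P - u` vanishes at the right end of each subinterval, so it is controlled
there by its derivative alone. -/
theorem projection_error_piece (hT : 0 < T) (hp : ∀ n ∈ M.idx, 1 ≤ p n) (hu : IsW11 T u)
    (hP : IsProjection M p u P) {n : ℕ} (hn : n ∈ M.idx) :
    ∃ G, IsACPiece (M.t (n - 1)) (M.t n) 0 G ((M.I n).indicator fun t => P t - u t) ∧
      ∫ s in M.t (n - 1)..M.t n, ‖G s‖ = ∫ s in M.t (n - 1)..M.t n, ‖deriv (P - u) s‖ ∧
      M.traceR P (n - 1) - u (M.t (n - 1)) = - ∫ s in M.t (n - 1)..M.t n, G s := by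
  have hlt := M.t_pred_lt hn
  obtain ⟨Z, hZ, hPZ⟩ := hP.mem n hn
  obtain ⟨Z', hZ', hZd⟩ := hZ.exists_hasDerivAt (hp n hn)
  obtain ⟨g, hg, hug, hgd⟩ := hu.exists_ae_hasDerivAt hT
  have hZb : Z (M.t n) = u (M.t n) := by
    rw [← hP.node n hn, M.traceL_eq hn hPZ hZ.continuous]
  have hpu := isACPiece_of_eq_integral hg hug hn
  refine ⟨fun s => Z' s - g s, ?_, ?_, ?_⟩
  · have := (isACPiece_of_eqOn_isPoly hn hPZ hZ'.continuous hZd).sub hpu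
    rwa [hZb, sub_self, indicator_fun_sub] at this
  · refine integral_congr_ae_Ioo hlt.le ?_
    filter_upwards [ae_mem_I_of_ae hgd hn] with t ht hm
    rw [((deriv_eq_of_eqOn_I hPZ hZd hm).sub (ht hm)).deriv]
  · have h0a := M.t_pred_nonneg hn
    have hbT := M.t_le_of_idx hn
    have s1 : IntervalIntegrable g volume 0 (M.t (n - 1)) := hg.mono_set (by
      rw [uIcc_of_le h0a, uIcc_of_le hT.le]
      exact Icc_subset_Icc le_rfl (by linarith))
    rw [intervalIntegral.integral_sub (hZ'.continuous.intervalIntegrable _ _) hpu.integrable,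
      intervalIntegral.integral_eq_sub_of_hasDerivAt (fun s _ => hZd s)
      (hZ'.continuous.intervalIntegrable _ _), hZb, M.traceR_eq hn hPZ hZ.continuous,
      hug (M.t n) ⟨by linarith, hbT⟩, hug (M.t (n - 1)) ⟨h0a, by linarith⟩,
      ← intervalIntegral.integral_add_adjacent_intervals s1 hpu.integrable]
    abel

/-- The pieces of the projection error have energies proportional to `k_j`, and the time steps up to
`t_n` sum to `t_n`. -/
theorem fracEnergy_projection_error_le (hα : -1 < α) (hα' : α < 0) (hT : 0 < T)
    (hp : ∀ n ∈ M.idx, 1 ≤ p n) (hu : IsW11 T u) (hP : IsProjection M p u P) {n : ℕ}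
    (hn : n ≤ M.N) :
    fracEnergy α (M.cut n fun t => grad (P t - u t))
      ≤ 8 * marchaudConst α * M.t n * M.max (fun n => M.k n ^ α *
            (∫ s in M.t (n - 1)..M.t n, ‖deriv (P - u) s‖) ^ 2) := by
  set R := M.max (fun n => M.k n ^ α *
            (∫ s in M.t (n - 1)..M.t n, ‖deriv (P - u) s‖) ^ 2) with hR
  have hC := marchaudConst_pos hα hα'
  have hac : IsPiecewiseAC M fun t => grad (P t - u t) :=
    ((hP.mem.isPiecewiseAC hp).sub hu.isPiecewiseAC).clm (gradCLM Ω)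
  have hb : ∀ j ∈ Finset.Icc 1 n,
      IsBump (M.t n) ((M.I j).indicator fun t => grad (P t - u t)) := by
    intro j hj
    obtain ⟨c, G, h⟩ := hac j (M.mem_idx_of_le hn hj)
    exact h.isBump (M.t_pred_nonneg (M.mem_idx_of_le hn hj))
      (M.t_mono (Finset.mem_Icc.1 hj).2 hn)
  have h1 := fracEnergy_sum_le hα hα' (Finset.Icc 1 n)
    (fun j => (M.I j).indicator fun t => grad (P t - u t)) hb (by
      intro t i hi j hj h h'
      exact M.eq_of_mem_I (M.mem_idx_of_le hn hi) (M.mem_idx_of_le hn hj)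
        (mem_of_indicator_ne_zero h) (mem_of_indicator_ne_zero h'))
  refine h1.trans ?_
  have h2 : ∀ j ∈ Finset.Icc 1 n,
      fracEnergy α ((M.I j).indicator fun t => grad (P t - u t))
        ≤ 4 * marchaudConst α * R * M.k j := by
    intro j hj
    have hj' := M.mem_idx_of_le hn hj
    obtain ⟨G, hG, hGi, -⟩ := projection_error_piece hT hp hu hP hj'
    have hpiece := hG.clm (gradCLM Ω)
    rw [indicator_fun_clm] at hpiece
    have hk := M.k_pos hj'
    have hlt := M.t_pred_lt hj'
    refine (hpiece.fracEnergy_le (M.t_pred_nonneg hj') hα hα').trans ?_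
    have hI : ∫ s in M.t (j - 1)..M.t j, ‖gradCLM Ω (G s)‖
        ≤ ∫ s in M.t (j - 1)..M.t j, ‖deriv (P - u) s‖ := by
      rw [← hGi]
      exact intervalIntegral.integral_mono_on hlt.le hpiece.integrable.norm hG.integrable.norm
        fun s _ => norm_grad_le _
    have hI0 : 0 ≤ ∫ s in M.t (j - 1)..M.t j, ‖gradCLM Ω (G s)‖ :=
      intervalIntegral.integral_nonneg hlt.le fun s _ => norm_nonneg _
    have hRj : M.k j ^ α * (∫ s in M.t (j - 1)..M.t j, ‖deriv (P - u) s‖) ^ 2 ≤ R :=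
      M.le_max (fun n => M.k n ^ α *
            (∫ s in M.t (n - 1)..M.t n, ‖deriv (P - u) s‖) ^ 2) hj'
    rw [map_zero, norm_zero, zero_add]
    change 4 * marchaudConst α * (M.k j) ^ (α + 1) * _ ≤ _
    rw [Real.rpow_add_one hk.ne']
    calc _ = 4 * marchaudConst α * M.k j
          * (M.k j ^ α * (∫ s in M.t (j - 1)..M.t j, ‖gradCLM Ω (G s)‖) ^ 2) := by ring
      _ ≤ 4 * marchaudConst α * M.k j
          * (M.k j ^ α * (∫ s in M.t (j - 1)..M.t j, ‖deriv (P - u) s‖) ^ 2) := by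
        gcongr
      _ ≤ 4 * marchaudConst α * M.k j * R := by gcongr
      _ = _ := by ring
  calc 2 * ∑ j ∈ Finset.Icc 1 n, fracEnergy α ((M.I j).indicator fun t => grad (P t - u t))
      ≤ 2 * ∑ j ∈ Finset.Icc 1 n, 4 * marchaudConst α * R * M.k j := by
        gcongr with j hj
        exact h2 j hj
    _ = _ := by
        rw [← Finset.mul_sum, M.sum_k]
        ring

theorem IsBump.mono {E : Type*} [NormedAddCommGroup E] {S S' : ℝ} {v : ℝ → E} (hv : IsBump S v)
    (h : S ≤ S') : IsBump S' v :=
  ⟨hv.meas, fun t ht => hv.supp t fun h' => ht ⟨h'.1, h'.2.trans_le h⟩, hv.bdd, hv.var⟩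

/-- The energy identities on the first `n` subintervals add up. -/
theorem energy_sum (hα : -1 < α) (hα' : α < 0) (hT : 0 < T)
    (hp : ∀ n ∈ M.idx, 1 ≤ p n) (hu : IsW11 T u) (hsol : IsSolution K α T f u₀ u)
    (hU : IsDGSolution M p K α f u₀ U) (hP : IsProjection M p u P) {n : ℕ} (hn : n ≤ M.N) :
    ‖toL2 (M.traceL U n - u (M.t n))‖ ^ 2 / 2
      + ∑ j ∈ Finset.Icc 1 n, ‖toL2 (M.traceR U (j - 1) - M.traceR P (j - 1))
          - toL2 (M.traceL U (j - 1) - u (M.t (j - 1)))‖ ^ 2 / 2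
      + K * ∑ j ∈ Finset.Icc 1 n, ∫ s in M.t (j - 1)..M.t j,
          inner ℝ (marchaud α (M.cut M.N fun r => grad (U r - u r)) s) (grad (U s - P s)) = 0 := by
  induction n with
  | zero =>
    have h0 := hU.initial
    rw [← hsol.initial] at h0
    simp [toL2_sub, M.t_zero, h0]
  | succ n ih =>
    have h1 := ih (by omega)
    have h2 := energy_step hα hα' hT hp hu hsol hU hP (n := n + 1)
      (M.mem_idx.2 ⟨by omega, hn⟩)
    rw [Finset.sum_Icc_succ_top (by omega), Finset.sum_Icc_succ_top (by omega)]
    simp only [Nat.add_sub_cancel] at h2 ⊢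
    linarith

/-- The fractional term of the summed energy identities, as a fractional form. -/
theorem sum_integral_eq_fracForm (hα : -1 < α) (hα' : α < 0)
    (hp : ∀ n ∈ M.idx, 1 ≤ p n) (hu : IsW11 T u)
    (hU : InTrialSpace M p U) (hP : InTrialSpace M p P) {n : ℕ} (hn : n ≤ M.N) :
    ∑ j ∈ Finset.Icc 1 n, ∫ s in M.t (j - 1)..M.t j,
        inner ℝ (marchaud α (M.cut M.N fun r => grad (U r - u r)) s) (grad (U s - P s))
      = fracForm α (M.cut n fun t => grad (U t - P t)) (M.cut n fun t => grad (U t - P t))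
        + fracForm α (M.cut n fun t => grad (P t - u t)) (M.cut n fun t => grad (U t - P t)) := by
  have hUac := hU.isPiecewiseAC hp
  have hPac := hP.isPiecewiseAC hp
  have huac : IsPiecewiseAC M u := hu.isPiecewiseAC
  have bψ : IsBump (M.t M.N) (M.cut M.N fun r => grad (U r - u r)) :=
    ((hUac.sub huac).clm (gradCLM Ω)).isBump_cut le_rfl
  have bw : IsBump (M.t n) (M.cut n fun t => grad (U t - P t)) :=
    ((hUac.sub hPac).clm (gradCLM Ω)).isBump_cut hn
  have bη : IsBump (M.t n) (M.cut n fun t => grad (P t - u t)) :=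
    ((hPac.sub huac).clm (gradCLM Ω)).isBump_cut hn
  rw [← M.integral_inner_cut hn,
    bψ.integral_inner_marchaud hα hα' (bw.mono (M.t_mono hn le_rfl)),
    IsBump.fracForm_congr_left (r := M.t n)
      (v' := fun t => M.cut n (fun t => grad (U t - P t)) t
        + M.cut n (fun t => grad (P t - u t)) t) ?_ fun t ht => M.cut_eq_zero_of_ge hn ht,
    bw.fracForm_add_left hα hα' bη bw]
  · intro t ht
    rw [M.cut_last_eq_of_lt hn ht, ← M.cut_add]
    congr 1
    funext s
    rw [grad_sub, grad_sub, grad_sub, sub_add_sub_cancel]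
  · intro j hj
    obtain ⟨Y, hY, hUY⟩ := hU j hj
    obtain ⟨Z, hZ, hPZ⟩ := hP j hj
    refine intervalIntegrable_congr_ae_Ioo (M.t_pred_lt hj).le
      (Eventually.of_forall fun t ht => ?_)
      (intervalIntegrable_inner (bψ.integrable_marchaud hα hα').intervalIntegrable
        ((gradCLM Ω).continuous.comp (hY.sub hZ).continuous))
    rw [hUY ht, hPZ ht]
    rfl

/-- The energy estimate for `U - P`: its nodal values, its jumps and its fractional energy up to
the time `t_n`. -/
theorem energy_estimate (hα : -1 < α) (hα' : α < 0) (hT : 0 < T) (hK : 0 < K)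
    (hp : ∀ n ∈ M.idx, 1 ≤ p n) (hu : IsW11 T u) (hsol : IsSolution K α T f u₀ u)
    (hU : IsDGSolution M p K α f u₀ U) (hP : IsProjection M p u P) {n : ℕ} (hn : n ≤ M.N) :
    ‖toL2 (M.traceL U n - u (M.t n))‖ ^ 2
      + ∑ j ∈ Finset.Icc 1 n, ‖toL2 (M.traceR U (j - 1) - M.traceR P (j - 1))
          - toL2 (M.traceL U (j - 1) - u (M.t (j - 1)))‖ ^ 2
      + K / 2 * fracEnergy α (M.cut n fun t => grad (U t - P t))
      ≤ 16 * K * marchaudConst α / (2 - 2 ^ (-α)) ^ 2 * M.t n * M.max (fun n => M.k n ^ α *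
            (∫ s in M.t (n - 1)..M.t n, ‖deriv (P - u) s‖) ^ 2) := by
  have hs := energy_sum hα hα' hT hp hu hsol hU hP hn
  have hE := fracEnergy_projection_error_le hα hα' hT hp hu hP hn
  rw [sum_integral_eq_fracForm hα hα' hp hu hU.mem hP.mem hn] at hs
  have bw : IsBump (M.t n) (M.cut n fun t => grad (U t - P t)) :=
    (((hU.mem.isPiecewiseAC hp).sub (hP.mem.isPiecewiseAC hp)).clm (gradCLM Ω)).isBump_cut hn
  have bη : IsBump (M.t n) (M.cut n fun t => grad (P t - u t)) :=
    (((hP.mem.isPiecewiseAC hp).sub hu.isPiecewiseAC).clm (gradCLM Ω)).isBump_cut hn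
  have hform := neg_le_of_abs_le (bη.abs_fracForm_le hα hα' bw)
  rw [bw.fracForm_self, ← Finset.sum_div] at hs
  set m := ‖toL2 (M.traceL U n - u (M.t n))‖ ^ 2
  set J := ∑ j ∈ Finset.Icc 1 n, ‖toL2 (M.traceR U (j - 1) - M.traceR P (j - 1))
          - toL2 (M.traceL U (j - 1) - u (M.t (j - 1)))‖ ^ 2
  set Nw := fracEnergy α (M.cut n fun t => grad (U t - P t))
  set Nη := fracEnergy α (M.cut n fun t => grad (P t - u t))
  set b := fracForm α (M.cut n fun t => grad (P t - u t)) (M.cut n fun t => grad (U t - P t))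
  set R := M.max (fun n => M.k n ^ α * (∫ s in M.t (n - 1)..M.t n, ‖deriv (P - u) s‖) ^ 2)
  have hc : 0 < (2 - (2 : ℝ) ^ (-α)) ^ 2 := by
    have := IsBump.two_sub_two_rpow_pos hα
    positivity
  have h1 : m + J + K / 2 * Nw ≤ 2 * K * (Nη / (2 - 2 ^ (-α)) ^ 2) := by
    have := mul_le_mul_of_nonneg_left hform hK.le
    linarith
  refine h1.trans ?_
  have h2 := mul_le_mul_of_nonneg_left (div_le_div_of_nonneg_right hE hc.le)
    (show 0 ≤ 2 * K by linarith)
  refine h2.trans (le_of_eq ?_)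
  ring

end energy

/-! ### From the energy to the errors -/

section errors

variable {d : ℕ} {Ω : TopologicalSpace.Opens (EuclideanSpace ℝ (Fin d))} {T K α : ℝ}
  {M : TimeMesh T} {p : ℕ → ℕ} {f : ℝ → L2 Ω} {u₀ : L2 Ω} {u U P : ℝ → H10 Ω}

/-- The constant of the energy estimate. -/
noncomputable def energyConst (K α : ℝ) : ℝ := 16 * K * marchaudConst α / (2 - 2 ^ (-α)) ^ 2

theorem energyConst_pos (hα : -1 < α) (hα' : α < 0) (hK : 0 < K) : 0 < energyConst K α := by
  have h1 := marchaudConst_pos hα hα'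
  have h2 := IsBump.two_sub_two_rpow_pos hα
  unfold energyConst
  positivity

/-- The right-hand side of the error estimate, without the constant. -/
noncomputable def errorBound (M : TimeMesh T) (α : ℝ) (u P : ℝ → H10 Ω) : ℝ :=
  M.max fun n => M.k n ^ α * (∫ s in M.t (n - 1)..M.t n, ‖deriv (P - u) s‖) ^ 2

/-- Since `α < 0`, the weight `k_n^α` is at least `T^α`. -/
theorem sq_integral_deriv_le (hα' : α < 0) (hT : 0 < T) {n : ℕ} (hn : n ∈ M.idx) :
    (∫ s in M.t (n - 1)..M.t n, ‖deriv (P - u) s‖) ^ 2 ≤ T ^ (-α) * errorBound M α u P := by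
  have h1 := M.le_max (fun n => M.k n ^ α *
    (∫ s in M.t (n - 1)..M.t n, ‖deriv (P - u) s‖) ^ 2) hn
  have h2 : T ^ α ≤ M.k n ^ α := Real.rpow_le_rpow_of_nonpos (M.k_pos hn) (M.k_le hn) hα'.le
  have h3 : 0 < T ^ α := Real.rpow_pos_of_pos hT α
  rw [Real.rpow_neg hT.le, ← div_eq_inv_mul, le_div_iff₀ h3, mul_comm]
  exact (mul_le_mul_of_nonneg_right h2 (sq_nonneg _)).trans h1

theorem errorBound_nonneg : 0 ≤ errorBound M α u P :=
  (mul_nonneg (Real.rpow_nonneg (M.k_pos M.last_mem_idx).le _) (sq_nonneg _)).trans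
    (M.le_max (fun n => M.k n ^ α *
      (∫ s in M.t (n - 1)..M.t n, ‖deriv (P - u) s‖) ^ 2) M.last_mem_idx)

/-- The two consequences of the energy estimate that are used: for the nodal values and for the
fractional energy. -/
theorem nodal_and_fracEnergy_le (hα : -1 < α) (hα' : α < 0) (hT : 0 < T) (hK : 0 < K)
    (hp : ∀ n ∈ M.idx, 1 ≤ p n) (hu : IsW11 T u) (hsol : IsSolution K α T f u₀ u)
    (hU : IsDGSolution M p K α f u₀ U) (hP : IsProjection M p u P) {n : ℕ} (hn : n ≤ M.N) :
    ‖toL2 (M.traceL U n - u (M.t n))‖ ^ 2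
        + ∑ i ∈ Finset.Icc 1 n, ‖toL2 (M.traceR U (i - 1) - M.traceR P (i - 1))
          - toL2 (M.traceL U (i - 1) - u (M.t (i - 1)))‖ ^ 2
      ≤ energyConst K α * M.t n * errorBound M α u P ∧
    K / 2 * fracEnergy α (M.cut n fun t => grad (U t - P t))
      ≤ energyConst K α * M.t n * errorBound M α u P := by
  have h1 := energy_estimate hα hα' hT hK hp hu hsol hU hP hn
  change _ ≤ energyConst K α * M.t n * errorBound M α u P at h1
  have h2 : 0 ≤ K / 2 * fracEnergy α (M.cut n fun t => grad (U t - P t)) :=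
    mul_nonneg (by linarith) (IsBump.fracEnergy_nonneg hα hα')
  have h3 : 0 ≤ ‖toL2 (M.traceL U n - u (M.t n))‖ ^ 2
      + ∑ i ∈ Finset.Icc 1 n, ‖toL2 (M.traceR U (i - 1) - M.traceR P (i - 1))
        - toL2 (M.traceL U (i - 1) - u (M.t (i - 1)))‖ ^ 2 :=
    add_nonneg (sq_nonneg _) (Finset.sum_nonneg fun i _ => sq_nonneg _)
  exact ⟨(le_add_of_nonneg_right h2).trans h1, (le_add_of_nonneg_left h3).trans h1⟩

/-- The nodal values of `U - P` from the left and from the right. -/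
theorem nodal_bounds (hα : -1 < α) (hα' : α < 0) (hT : 0 < T) (hK : 0 < K)
    (hp : ∀ n ∈ M.idx, 1 ≤ p n) (hu : IsW11 T u) (hsol : IsSolution K α T f u₀ u)
    (hU : IsDGSolution M p K α f u₀ U) (hP : IsProjection M p u P) {n : ℕ} (hn : n ∈ M.idx) :
    ‖toL2 (M.traceL U n - u (M.t n))‖ ^ 2 ≤ energyConst K α * T * errorBound M α u P ∧
      ‖toL2 (M.traceR U (n - 1) - M.traceR P (n - 1))‖ ^ 2
        ≤ 4 * (energyConst K α * T * errorBound M α u P) := by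
  have hn' := M.mem_idx.1 hn
  have hR := errorBound_nonneg (M := M) (α := α) (u := u) (P := P)
  have hC := energyConst_pos hα hα' hK
  have key : ∀ j ≤ M.N, ‖toL2 (M.traceL U j - u (M.t j))‖ ^ 2
      + ∑ i ∈ Finset.Icc 1 j, ‖toL2 (M.traceR U (i - 1) - M.traceR P (i - 1))
          - toL2 (M.traceL U (i - 1) - u (M.t (i - 1)))‖ ^ 2
      ≤ energyConst K α * T * errorBound M α u P := by
    intro j hj
    refine (nodal_and_fracEnergy_le hα hα' hT hK hp hu hsol hU hP hj).1.trans ?_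
    gcongr
    exact M.t_le hj
  have hJ0 : ∀ j, 0 ≤ ∑ i ∈ Finset.Icc 1 j, ‖toL2 (M.traceR U (i - 1) - M.traceR P (i - 1))
      - toL2 (M.traceL U (i - 1) - u (M.t (i - 1)))‖ ^ 2 := fun j =>
    Finset.sum_nonneg fun i _ => sq_nonneg _
  have k1 := key n hn'.2
  have k2 := key (n - 1) (by omega)
  have hJ := Finset.single_le_sum (f := fun i =>
      ‖toL2 (M.traceR U (i - 1) - M.traceR P (i - 1))
        - toL2 (M.traceL U (i - 1) - u (M.t (i - 1)))‖ ^ 2)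
    (fun i _ => sq_nonneg _) (Finset.mem_Icc.2 ⟨hn'.1, le_rfl⟩)
  refine ⟨by linarith [hJ0 n], ?_⟩
  have htri := norm_add_le (toL2 (M.traceR U (n - 1) - M.traceR P (n - 1))
    - toL2 (M.traceL U (n - 1) - u (M.t (n - 1)))) (toL2 (M.traceL U (n - 1) - u (M.t (n - 1))))
  rw [sub_add_cancel] at htri
  have h0 := hJ0 (n - 1)
  have hm := sq_nonneg ‖toL2 (M.traceL U n - u (M.t n))‖
  have htri2 := (pow_le_pow_left₀ (norm_nonneg _) htri 2).trans (add_sq_le (a := _) (b := _))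
  linarith

/-- The mean square of `U - P` over one subinterval, from the coercivity of the energy and the
Poincaré inequality with the constant `r`. -/
theorem integral_sq_le (hα : -1 < α) (hα' : α < 0) (hT : 0 < T) (hK : 0 < K)
    {r : ℝ} (hr : ∀ v : H10 Ω, ‖toL2 v‖ ≤ r * ‖grad v‖)
    (hp : ∀ n ∈ M.idx, 1 ≤ p n) (hu : IsW11 T u) (hsol : IsSolution K α T f u₀ u)
    (hU : IsDGSolution M p K α f u₀ U) (hP : IsProjection M p u P) {n : ℕ} (hn : n ∈ M.idx)
    {θ : ℝ → H10 Ω} (hθ : IsPoly (p n) θ) (hUθ : EqOn (fun t => U t - P t) θ (M.I n)) :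
    ∫ t in M.t (n - 1)..M.t n, ‖toL2 (θ t)‖ ^ 2
      ≤ r ^ 2 * (energyConst K α / (K * omegaKernel (α + 1) T)) *
        (M.t n * errorBound M α u P) := by
  have hn' := (M.mem_idx.1 hn).2
  have hlt := M.t_pred_lt hn
  have htn := M.t_pos hn
  have hω : 0 < omegaKernel (α + 1) T :=
    div_pos (Real.rpow_pos_of_pos hT _) (Real.Gamma_pos_of_pos (by linarith))
  have hωle : omegaKernel (α + 1) T ≤ omegaKernel (α + 1) (M.t n) := by
    unfold omegaKernel
    refine div_le_div_of_nonneg_right ?_ (Real.Gamma_pos_of_pos (by linarith)).le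
    exact Real.rpow_le_rpow_of_nonpos htn (M.t_le hn') (by linarith)
  have bw : IsBump (M.t n) (M.cut n fun t => grad (U t - P t)) :=
    (((hU.mem.isPiecewiseAC hp).sub (hP.mem.isPiecewiseAC hp)).clm (gradCLM Ω)).isBump_cut hn'
  have h1 := (nodal_and_fracEnergy_le hα hα' hT hK hp hu hsol hU hP hn').2
  have h2 := bw.two_mul_omegaKernel_mul_le hα hα' htn
  set Q := ∫ t, ‖M.cut n (fun t => grad (U t - P t)) t‖ ^ 2 with hQ
  have hQ0 : 0 ≤ Q := integral_nonneg fun t => sq_nonneg _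
  have hQle : Q ≤ energyConst K α / (K * omegaKernel (α + 1) T)
      * (M.t n * errorBound M α u P) := by
    have h4 : 2 * omegaKernel (α + 1) T * Q ≤ 2 * omegaKernel (α + 1) (M.t n) * Q := by gcongr
    have h5 := (mul_le_mul_of_nonneg_left (h4.trans h2) (show 0 ≤ K / 2 by linarith)).trans h1
    rw [div_mul_eq_mul_div, le_div_iff₀ (mul_pos hK hω)]
    refine le_trans (le_of_eq ?_) (h5.trans (le_of_eq ?_)) <;> ring
  have hθL : Continuous fun t => toL2 (θ t) := (toL2CLM Ω).continuous.comp hθ.continuous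
  have hθG : Continuous fun t => grad (θ t) := (gradCLM Ω).continuous.comp hθ.continuous
  have hIQ : ∫ t in M.t (n - 1)..M.t n, ‖grad (θ t)‖ ^ 2 ≤ Q := by
    rw [intervalIntegral.integral_of_le hlt.le, integral_Ioc_eq_integral_Ioo]
    refine le_trans (le_of_eq ?_) (setIntegral_le_integral (s := M.I n) bw.integrable_sq
      (Eventually.of_forall fun t => sq_nonneg _))
    refine setIntegral_congr_fun measurableSet_Ioo fun t ht => ?_
    rw [M.cut_of_mem hn' (Finset.mem_Icc.2 ⟨(M.mem_idx.1 hn).1, le_rfl⟩) ht, ← hUθ ht]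
  calc ∫ t in M.t (n - 1)..M.t n, ‖toL2 (θ t)‖ ^ 2
      ≤ ∫ t in M.t (n - 1)..M.t n, r ^ 2 * ‖grad (θ t)‖ ^ 2 := by
        refine intervalIntegral.integral_mono_on hlt.le
          ((hθL.norm.pow 2).intervalIntegrable _ _)
          ((continuous_const.mul (hθG.norm.pow 2)).intervalIntegrable _ _) fun t _ => ?_
        rw [← mul_pow]
        exact pow_le_pow_left₀ (norm_nonneg _) (hr _) 2
    _ = r ^ 2 * ∫ t in M.t (n - 1)..M.t n, ‖grad (θ t)‖ ^ 2 :=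
        intervalIntegral.integral_const_mul _ _
    _ ≤ r ^ 2 * (energyConst K α / (K * omegaKernel (α + 1) T)
          * (M.t n * errorBound M α u P)) := by
        gcongr
        exact hIQ.trans hQle
    _ = _ := by ring

/-- The weight of the maximum norm. -/
noncomputable def supWeight (M : TimeMesh T) (p : ℕ → ℕ) : ℝ :=
  M.min fun n => (M.t n)⁻¹ * M.k n ^ (min 1 (p n - 1))

theorem supWeight_pos : 0 < supWeight M p := by
  refine (Finset.lt_inf'_iff M.idx_nonempty).2 fun n hn => ?_
  exact mul_pos (inv_pos.2 (M.t_pos hn)) (pow_pos (M.k_pos hn) _)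

theorem supWeight_le : supWeight M p ≤ T⁻¹ * max 1 T := by
  refine (M.min_le _ M.last_mem_idx).trans ?_
  have hk := M.k_le M.last_mem_idx
  have hT : 0 < T := (M.k_pos M.last_mem_idx).trans_le hk
  rw [M.t_last]
  gcongr
  rcases Nat.eq_zero_or_pos (p M.N - 1) with h | h
  · rw [h, Nat.min_zero, pow_zero]
    exact le_max_left _ _
  · rw [Nat.min_eq_left h, pow_one]
    exact hk.trans (le_max_right _ _)

/-- The maximum of `U - P` on one subinterval: for degree one it is attained at an end point, and
for higher degrees the inverse inequality and the factor `k_n` of the weight reduce it to the mean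
square. -/
theorem supWeight_mul_sq_le (hα : -1 < α) (hα' : α < 0) (hT : 0 < T) (hK : 0 < K)
    {r : ℝ} (hr : ∀ v : H10 Ω, ‖toL2 v‖ ≤ r * ‖grad v‖)
    (hp : ∀ n ∈ M.idx, 1 ≤ p n) (hu : IsW11 T u) (hsol : IsSolution K α T f u₀ u)
    (hU : IsDGSolution M p K α f u₀ U) (hP : IsProjection M p u P) {n : ℕ} (hn : n ∈ M.idx)
    {t : ℝ} (ht : t ∈ M.I n) :
    supWeight M p * ‖toL2 (U t - P t)‖ ^ 2
      ≤ (T⁻¹ * max 1 T * (5 * energyConst K α * T)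
        + 8 * (r ^ 2 * (energyConst K α / (K * omegaKernel (α + 1) T))))
        * errorBound M α u P * (p n : ℝ) ^ 2 := by
  obtain ⟨Y, hY, hUY⟩ := hU.mem n hn
  obtain ⟨Z, hZ, hPZ⟩ := hP.mem n hn
  have hθ := hY.sub hZ
  have hlt := M.t_pred_lt hn
  have htI : t ∈ Icc (M.t (n - 1)) (M.t n) := Ioo_subset_Icc_self ht
  have hL := hθ.clm (toL2CLM Ω)
  have hpn := hp n hn
  have hp1 : (1 : ℝ) ≤ p n := by exact_mod_cast hpn
  have hR := errorBound_nonneg (M := M) (α := α) (u := u) (P := P)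
  have hC := energyConst_pos hα hα' hK
  have hω : 0 < omegaKernel (α + 1) T :=
    div_pos (Real.rpow_pos_of_pos hT _) (Real.Gamma_pos_of_pos (by linarith))
  have hp2 : (1 : ℝ) ≤ (p n : ℝ) ^ 2 := one_le_pow₀ hp1
  set R := errorBound M α u P with hRdef
  set D1 := T⁻¹ * max 1 T * (5 * energyConst K α * T) with hD1
  set D2 := r ^ 2 * (energyConst K α / (K * omegaKernel (α + 1) T)) with hD2
  have hmax : 0 < max 1 T := lt_max_of_lt_left one_pos
  have hD1' : 0 ≤ D1 := by positivity
  have hD2' : 0 ≤ D2 := by positivity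
  have e : toL2 (U t - P t) = toL2CLM Ω (Y t - Z t) := by
    rw [hUY ht, hPZ ht, toL2CLM_apply]
  rw [e]
  rcases Nat.eq_or_lt_of_le hpn with h1 | h2
  · rw [← h1] at hL
    have hend := hL.norm_le_max_of_degree_one htI
    obtain ⟨b1, b2⟩ := nodal_bounds hα hα' hT hK hp hu hsol hU hP hn
    rw [M.traceR_eq hn hUY hY.continuous, M.traceR_eq hn hPZ hZ.continuous] at b2
    rw [M.traceL_eq hn hUY hY.continuous, ← hP.node n hn,
      M.traceL_eq hn hPZ hZ.continuous] at b1
    rw [← toL2CLM_apply] at b1 b2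
    have hsq : ‖toL2CLM Ω (Y t - Z t)‖ ^ 2 ≤ 5 * energyConst K α * T * R := by
      have n1 := sq_nonneg ‖toL2CLM Ω (Y (M.t (n - 1)) - Z (M.t (n - 1)))‖
      have n2 := sq_nonneg ‖toL2CLM Ω (Y (M.t n) - Z (M.t n))‖
      rcases le_max_iff.1 hend with h | h
      · have := pow_le_pow_left₀ (norm_nonneg _) h 2
        linarith
      · have := pow_le_pow_left₀ (norm_nonneg _) h 2
        linarith
    calc supWeight M p * ‖toL2CLM Ω (Y t - Z t)‖ ^ 2
        ≤ (T⁻¹ * max 1 T) * (5 * energyConst K α * T * R) :=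
          mul_le_mul supWeight_le hsq (sq_nonneg _) (by positivity)
      _ = D1 * R := by rw [hD1]; ring
      _ ≤ (D1 + 8 * D2) * R * 1 := by
          have : 0 ≤ D2 * R := by positivity
          linarith
      _ ≤ (D1 + 8 * D2) * R * (p n : ℝ) ^ 2 := by gcongr
  · have hk := M.k_pos hn
    have htn := M.t_pos hn
    have hw : supWeight M p ≤ (M.t n)⁻¹ * M.k n := by
      have h3 : min 1 (p n - 1) = 1 := by omega
      refine (M.min_le (fun n => (M.t n)⁻¹ * M.k n ^ (min 1 (p n - 1))) hn).trans (le_of_eq ?_)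
      simp only [h3, pow_one]
    have hinv := hL.sq_norm_le hlt htI
    have hint := integral_sq_le hα hα' hT hK hr hp hu hsol hU hP hn hθ
      (fun s hs => by simp only [hUY hs, hPZ hs])
    -- The factor `k_n / t_n` of the weight cancels `1 / k_n` from the inverse inequality and `t_n`
    -- from the energy estimate.
    have hpp : ((p n : ℝ) + 1) ^ 2 ≤ 4 * (p n : ℝ) ^ 2 := by nlinarith
    have hsq : ‖toL2CLM Ω (Y t - Z t)‖ ^ 2
        ≤ 2 * (4 * (p n : ℝ) ^ 2) / M.k n * (D2 * (M.t n * R)) := by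
      refine hinv.trans (mul_le_mul ?_ hint ?_ ?_)
      · exact div_le_div_of_nonneg_right (by linarith) hk.le
      · exact intervalIntegral.integral_nonneg hlt.le fun s _ => sq_nonneg _
      · positivity
    calc supWeight M p * ‖toL2CLM Ω (Y t - Z t)‖ ^ 2
        ≤ ((M.t n)⁻¹ * M.k n) * (2 * (4 * (p n : ℝ) ^ 2) / M.k n * (D2 * (M.t n * R))) :=
          mul_le_mul hw hsq (sq_nonneg _) (by positivity)
      _ = 8 * D2 * R * (p n : ℝ) ^ 2 := by
          field_simp
          ring
      _ ≤ (D1 + 8 * D2) * R * (p n : ℝ) ^ 2 := by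
          have : 0 ≤ D1 * R * (p n : ℝ) ^ 2 := by positivity
          linarith

end errors

end SubdiffusionDG

theorem mainTheorem4 {d : ℕ} (hd : 1 ≤ d)
    (Ω : TopologicalSpace.Opens (EuclideanSpace ℝ (Fin d)))
    (hΩ : Bornology.IsBounded (Ω : Set (EuclideanSpace ℝ (Fin d))))
    (K α T : ℝ) (hK : 0 < K) (hα : -1 < α) (hα' : α < 0) (hT : 0 < T) :
    ∃ C : ℝ, 0 < C ∧
      ∀ (f : ℝ → L2 Ω) (u₀ : L2 Ω) (u : ℝ → H10 Ω),
        IntervalIntegrable f volume 0 T →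
        IsW11 T u →
        IsSolution K α T f u₀ u →
      ∀ (M : TimeMesh T) (p : ℕ → ℕ),
        (∀ i ∈ M.idx, ∀ j ∈ M.idx, i ≤ j → M.k i ≤ M.k j) →
        (∀ n ∈ M.idx, 1 ≤ p n) →
      ∀ (U P : ℝ → H10 Ω),
        IsDGSolution M p K α f u₀ U →
        IsProjection M p u P →
        M.max (fun n => max (‖toL2 (M.traceR U (n - 1) - u (M.t (n - 1)))‖ ^ 2)
            (‖toL2 (M.traceL U n - u (M.t n))‖ ^ 2))
          + M.min (fun n => (M.t n)⁻¹ * M.k n ^ (min 1 (p n - 1)))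
            * (normLinfL2 M (u - U) ^ 2 / M.max (fun n => (p n : ℝ) ^ 2))
        ≤ C * M.max (fun n => M.k n ^ α *
            (∫ s in M.t (n - 1)..M.t n, ‖deriv (P - u) s‖) ^ 2) := by
  obtain ⟨r, -, hr⟩ := exists_poincare hd hΩ
  set A := T⁻¹ * max 1 T * (5 * energyConst K α * T)
    + 8 * (r ^ 2 * (energyConst K α / (K * omegaKernel (α + 1) T))) with hA
  set B := T⁻¹ * max 1 T with hB
  have hC := energyConst_pos hα hα' hK
  have hmax : 0 < max 1 T := lt_max_of_lt_left one_pos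
  have hω : 0 < omegaKernel (α + 1) T :=
    div_pos (Real.rpow_pos_of_pos hT _) (Real.Gamma_pos_of_pos (by linarith))
  have hA0 : 0 ≤ A := by positivity
  have hB0 : 0 < B := by positivity
  have hTα : 0 < T ^ (-α) := Real.rpow_pos_of_pos hT _
  refine ⟨(8 * (energyConst K α * T) + 2 * T ^ (-α)) + (2 * A + 2 * (B * T ^ (-α))),
    by positivity, ?_⟩
  intro f u₀ u _ hu hsol M p _ hp U P hU hP
  change _ + supWeight M p * _ ≤ _ * errorBound M α u P
  have hR := errorBound_nonneg (M := M) (α := α) (u := u) (P := P)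
  set R := errorBound M α u P with hRdef
  rw [add_mul]
  refine add_le_add ?_ ?_
  · refine M.max_le fun n hn => ?_
    obtain ⟨b1, b2⟩ := nodal_bounds hα hα' hT hK hp hu hsol hU hP hn
    have hCTR : 0 ≤ energyConst K α * T * R := by positivity
    have hTR : 0 ≤ T ^ (-α) * R := by positivity
    refine _root_.max_le ?_ (by linarith)
    obtain ⟨G, hG, hGi, hGa⟩ := projection_error_piece hT hp hu hP hn
    have h1 : ‖toL2 (M.traceR P (n - 1) - u (M.t (n - 1)))‖ ^ 2 ≤ T ^ (-α) * R := by
      refine le_trans (pow_le_pow_left₀ (norm_nonneg _) ?_ 2) (sq_integral_deriv_le hα' hT hn)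
      refine (norm_toL2_le _).trans ?_
      rw [hGa, norm_neg, ← hGi]
      exact hG.norm_integral_le le_rfl hG.lt.le le_rfl
    have h2 : toL2 (M.traceR U (n - 1) - u (M.t (n - 1)))
        = toL2 (M.traceR U (n - 1) - M.traceR P (n - 1))
          + toL2 (M.traceR P (n - 1) - u (M.t (n - 1))) := by
      simp only [toL2_sub]
      abel
    have h3 := (pow_le_pow_left₀ (norm_nonneg _) (norm_add_le
      (toL2 (M.traceR U (n - 1) - M.traceR P (n - 1)))
      (toL2 (M.traceR P (n - 1) - u (M.t (n - 1))))) 2).trans add_sq_le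
    rw [← h2] at h3
    linarith
  · set D := (2 * A + 2 * (B * T ^ (-α))) * R with hD
    have hD0 : 0 ≤ D := by positivity
    set W := supWeight M p with hW
    have hW0 : 0 < W := supWeight_pos
    set Q := M.max (fun n => (p n : ℝ) ^ 2) with hQ
    have hpQ : ∀ n ∈ M.idx, (p n : ℝ) ^ 2 ≤ Q := fun n hn => M.le_max (fun n => (p n : ℝ) ^ 2) hn
    have hQ1 : 1 ≤ Q := by
      refine le_trans (one_le_pow₀ ?_) (hpQ M.N M.last_mem_idx)
      exact_mod_cast hp _ M.last_mem_idx
    have hQ0 : 0 < Q := one_pos.trans_le hQ1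
    have hpt : ∀ n ∈ M.idx, ∀ t ∈ M.I n, W * ‖toL2 ((u - U) t)‖ ^ 2 ≤ D * Q := by
      intro n hn t ht
      obtain ⟨G, hG, hGi, -⟩ := projection_error_piece hT hp hu hP hn
      have h1 := supWeight_mul_sq_le hα hα' hT hK hr hp hu hsol hU hP hn ht
      have h2 : ‖toL2 (P t - u t)‖ ^ 2 ≤ T ^ (-α) * R := by
        refine le_trans (pow_le_pow_left₀ (norm_nonneg _) ?_ 2) (sq_integral_deriv_le hα' hT hn)
        refine (norm_toL2_le _).trans ?_
        have := hG.norm_le t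
        rwa [indicator_of_mem ht, norm_zero, zero_add, hGi] at this
      have h3 : ‖toL2 ((u - U) t)‖ ^ 2
          ≤ 2 * (‖toL2 (U t - P t)‖ ^ 2 + ‖toL2 (P t - u t)‖ ^ 2) := by
        have e : toL2 ((u - U) t) = - (toL2 (U t - P t) + toL2 (P t - u t)) := by
          simp only [Pi.sub_apply, toL2_sub]
          abel
        rw [e, norm_neg]
        exact (pow_le_pow_left₀ (norm_nonneg _) (norm_add_le _ _) 2).trans add_sq_le
      have h4 : W * ‖toL2 (P t - u t)‖ ^ 2 ≤ B * (T ^ (-α) * R) :=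
        mul_le_mul supWeight_le h2 (sq_nonneg _) hB0.le
      have h5 : A * R * (p n : ℝ) ^ 2 ≤ A * R * Q := by
        gcongr
        exact hpQ n hn
      have h6 : B * (T ^ (-α) * R) * 1 ≤ B * (T ^ (-α) * R) * Q := by gcongr
      calc W * ‖toL2 ((u - U) t)‖ ^ 2
          ≤ W * (2 * (‖toL2 (U t - P t)‖ ^ 2 + ‖toL2 (P t - u t)‖ ^ 2)) := by gcongr
        _ ≤ 2 * (A * R * Q) + 2 * (B * (T ^ (-α) * R) * Q) := by linarith
        _ = D * Q := by
          rw [hD]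
          ring
    have hsup : normLinfL2 M (u - U) ≤ Real.sqrt (D * Q / W) := by
      refine M.max_le fun n hn => Real.sSup_le ?_ (Real.sqrt_nonneg _)
      rintro _ ⟨t, ht, rfl⟩
      refine Real.le_sqrt_of_sq_le ?_
      rw [le_div_iff₀ hW0, mul_comm]
      exact hpt n hn t ht
    have hn0 : 0 ≤ normLinfL2 M (u - U) := by
      refine le_trans (Real.sSup_nonneg ?_) (M.le_max (fun n =>
        sSup ((fun t => ‖toL2 ((u - U) t)‖) '' M.I n)) M.last_mem_idx)
      rintro _ ⟨t, -, rfl⟩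
      exact norm_nonneg _
    have hsq : normLinfL2 M (u - U) ^ 2 ≤ D * Q / W :=
      (pow_le_pow_left₀ hn0 hsup 2).trans (le_of_eq (Real.sq_sqrt (by positivity)))
    calc W * (normLinfL2 M (u - U) ^ 2 / Q) ≤ W * (D * Q / W / Q) := by gcongr
      _ = D := by field_simp
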